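/- **Corollary 1.2.** Let $n\ge 2$, $k\ge 1$, and let $X=\mathcal O_{\mathbb P^{n-1}}(-k)$ be the total space of the $k$-th power of the tautological line bundle over $\mathbb P^{n-1}$, with its standard complex structure $\mathcal J$; the complement of the zero section is identified with $(\mathbb C^n\setminus\{0\})/\mathbb Z_k$ through $z\mapsto z^{\otimes k}$. Write $\mathbf z=|z_1|^2+\dots+|z_n|^2$. Let $g$ be a ${\rm U}(n)$-invariant Kähler metric on $X$ which arises from a Kähler potential $\phi(\mathbf z)$, that is, $\phi$ is a smooth function of $\mathbf z>0$ and the Kähler form $\omega=g(\mathcal J\cdot,\cdot)$ satisfies $\omega=\sqrt{-1}\,\partial\bar\partial\phi(\mathbf z)$ on $\mathbb C^n\setminus\{0\}$. Suppose that $g$ is ALE of some order $\tau>0$: it is complete, and there are a finite subgroup $\Gamma\subset{\rm SO}(2n)$ acting freely on $\mathbb R^{2n}\setminus\{0\}$, a compact set $K\subset X$ and a diffeomorphism $X\setminus K\to(\mathbb R^{2n}\setminus B(0,R))/\Gamma$ in which $\partial^{m}(g_{ij}-\delta_{ij})=O(|x|^{-\tau-m})$ for every $m\ge0$. Then there are a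 smooth function $u:X\to(0,\infty)$ with $$u^2=\Big(\mathbf z\frac{\partial\phi}{\partial\mathbf z}\Big)^{-2}\ \text{ on } \mathbb C^n\setminus\{0\},\qquad u=O(r^{-2})\ \text{ as } r\to\infty,$$ where $r$ is the $g$-distance to a fixed base point, and a complex structure $\widehat{\mathcal J}\ne\mathcal J$ on $X$ such that the metric $\widehat g=u^2g$ is Kähler with respect to $\widehat{\mathcal J}$ on $X$. Complex orbifold coordinates at the added point of the one-point compactification $\widehat X=X\cup\{\infty\}$ are given as follows: the map $\mathbb C^n\to\widehat X$ which sends $0$ to $\infty$ and $\xi\neq0$ to the class of $z=\xi/|\xi|^2$ is continuous and open, its fibres are the orbits of $\mathbb Z_k$ (acting by scalar $k$-th roots of unity), and it is holomorphic with respect to $\widehat{\mathcal J}$ on $\mathbb C^n\setminus\{0\}$. Put $\boldsymbol\xi=|\xi_1|^2+\dots+|\xi_n|^2=1/\mathbf z$. The Kähler conformal compactification $(\widehat X,\widehat g,\widehat{\mathcal J})$ has Kähler potential $$\widehat\phi(\mathbf z)=-\int\Big(\mathbf z^2\frac{\partial\phi}{\partial\mathbf z}\Big)^{-1}d\mathbf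 z ,$$ that is: antiderivatives $\widehat\phi$ of $-(\mathbf z^2\,\partial\phi/\partial\mathbf z)^{-1}$ on $\mathbf z>0$ exist, and for each of them, in the coordinates $\xi\in\mathbb C^n\setminus\{0\}$, the Kähler form $\widehat\omega=\widehat g(\widehat{\mathcal J}\cdot,\cdot)$ equals $\sqrt{-1}\,\partial_\xi\bar\partial_\xi\,\widehat\phi(1/\boldsymbol\xi)$. Moreover, for the inversion $\varphi(z)=(\bar z_1/\mathbf z,\,z_2/\mathbf z,\dots,z_n/\mathbf z)$, one has at every point of the punctured $z_1$-axis $$\varphi^*\big(\sqrt{-1}\,\partial_\xi\bar\partial_\xi\,\widehat\phi(1/\boldsymbol\xi)\big)=\Big(\mathbf z\frac{\partial\phi}{\partial\mathbf z}\Big)^{-2}\sqrt{-1}\,\partial\bar\partial\phi(\mathbf z),$$ and likewise with the conjugate in the $j$-th place and the $z_j$-axis, for every $j$. -/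

import Mathlib

open Set Filter Topology Bundle
open scoped Manifold ContDiff

noncomputable section

/-! ### The total space of `𝒪(-k)` over `ℙⁿ⁻¹` -/

/-- Pairs `(z, t)` with `z ∈ ℂⁿ ∖ {0}` and `t ∈ ℂ`; such a pair stands for the element
`t · z^{⊗k}` of the `k`-th power of the line spanned by `z`. -/
abbrev LinePair (n : ℕ) : Type := {p : (Fin n → ℂ) × ℂ // p.1 ≠ 0}

/-- `(z, t)` and `(μ z, s)` represent the same element `t · z^{⊗k} = s · (μ z)^{⊗k}` iff
`t = μ ^ k s`. -/
def linePairSetoid (n k : ℕ) : Setoid (LinePair n) where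
  r p q := ∃ μ : ℂ, μ ≠ 0 ∧ q.1.1 = μ • p.1.1 ∧ p.1.2 = μ ^ k * q.1.2
  iseqv :=
    { refl := fun p => ⟨1, one_ne_zero, by simp, by simp⟩
      symm := by
        rintro p q ⟨μ, hμ, h1, h2⟩
        refine ⟨μ⁻¹, inv_ne_zero hμ, ?_, ?_⟩
        · rw [h1, smul_smul, inv_mul_cancel₀ hμ, one_smul]
        · rw [h2, ← mul_assoc, ← mul_pow, inv_mul_cancel₀ hμ, one_pow, one_mul]
      trans := by
        rintro p q r ⟨μ, hμ, h1, h2⟩ ⟨ν, hν, h3, h4⟩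
        refine ⟨ν * μ, mul_ne_zero hν hμ, ?_, ?_⟩
        · rw [h3, h1, smul_smul]
        · rw [h2, h4, mul_pow]; ring }

/-- The total space of `𝒪(-k)`, the `k`-th power of the tautological line bundle over `ℙⁿ⁻¹`. -/
def TautPow (n k : ℕ) : Type := Quotient (linePairSetoid n k)

instance (n k : ℕ) : TopologicalSpace (TautPow n k) :=
  inferInstanceAs (TopologicalSpace (Quotient (linePairSetoid n k)))

namespace TautPow

variable {n k : ℕ}

/-- The element `t · z^{⊗k}`. -/
def mk (p : LinePair n) : TautPow n k := Quotient.mk (linePairSetoid n k) p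

theorem isQuotientMap_mk : IsQuotientMap (mk : LinePair n → TautPow n k) :=
  isQuotientMap_quotient_mk'

theorem mk_eq_mk {p q : LinePair n} : (mk p : TautPow n k) = mk q ↔
    ∃ μ : ℂ, μ ≠ 0 ∧ q.1.1 = μ • p.1.1 ∧ p.1.2 = μ ^ k * q.1.2 :=
  Quotient.eq (r := linePairSetoid n k)

/-- The points over `{z_j ≠ 0} ⊆ ℙⁿ⁻¹`. -/
def chartSource (j : Fin n) : Set (TautPow n k) := {x | ∃ p : LinePair n, p.1.1 j ≠ 0 ∧ mk p = x}

theorem mk_mem_chartSource {j : Fin n} {p : LinePair n} :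
    (mk p : TautPow n k) ∈ chartSource j ↔ p.1.1 j ≠ 0 := by
  constructor
  · rintro ⟨q, hq, h⟩
    obtain ⟨μ, hμ, h1, -⟩ := mk_eq_mk.1 h
    rw [h1]
    simpa [hμ] using hq
  · intro h
    exact ⟨p, h, rfl⟩

theorem isOpen_chartSource (j : Fin n) : IsOpen (chartSource j : Set (TautPow n k)) := by
  rw [← isQuotientMap_mk.isOpen_preimage]
  have : mk ⁻¹' (chartSource j : Set (TautPow n k)) = {p : LinePair n | p.1.1 j ≠ 0} := by
    ext p; exact mk_mem_chartSource
  rw [this]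
  exact isOpen_ne_fun (by fun_prop) continuous_const

/-- The coordinates over `{z_j ≠ 0}`: the `i`-th coordinate, `i ≠ j`, is the affine coordinate
`z_i / z_j`, the `j`-th one is the fibre coordinate `t z_j ^ k`. -/
def chartFun (j : Fin n) : TautPow n k → (Fin n → ℂ) :=
  Quotient.lift (s := linePairSetoid n k)
    (fun p : LinePair n => Function.update (fun i => p.1.1 i / p.1.1 j) j (p.1.2 * p.1.1 j ^ k)) (by
    rintro p q ⟨μ, hμ, h1, h2⟩
    have e1 : (fun i => q.1.1 i / q.1.1 j) = fun i => p.1.1 i / p.1.1 j := by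
      funext i
      simp only [h1, Pi.smul_apply, smul_eq_mul]
      rw [mul_div_mul_left _ _ hμ]
    have e2 : p.1.2 * p.1.1 j ^ k = q.1.2 * q.1.1 j ^ k := by
      simp only [h1, h2, Pi.smul_apply, smul_eq_mul]; ring
    simp only [e1, e2])

theorem chartFun_mk (j : Fin n) (p : LinePair n) : chartFun j (mk p : TautPow n k) =
    Function.update (fun i => p.1.1 i / p.1.1 j) j (p.1.2 * p.1.1 j ^ k) := rfl

theorem update_one_ne_zero (j : Fin n) (w : Fin n → ℂ) : Function.update w j 1 ≠ 0 := by
  intro h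
  have := congrFun h j
  simp at this

/-- The inverse of `chartFun j`. -/
def chartInv (j : Fin n) (w : Fin n → ℂ) : TautPow n k :=
  mk ⟨(Function.update w j 1, w j), update_one_ne_zero j w⟩

/-- The standard chart of `𝒪(-k)` over `{z_j ≠ 0}`. -/
def chart (j : Fin n) : OpenPartialHomeomorph (TautPow n k) (Fin n → ℂ) where
  toFun := chartFun j
  invFun := chartInv j
  source := chartSource j
  target := univ
  map_source' _ _ := mem_univ _
  map_target' w _ := by
    rw [chartInv, mk_mem_chartSource]
    simp
  left_inv' := by
    rintro x ⟨p, hp, rfl⟩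
    rw [chartFun_mk, chartInv, mk_eq_mk]
    refine ⟨p.1.1 j, hp, ?_, ?_⟩
    · funext i
      by_cases h : i = j
      · subst h; simp
      · simp [h, mul_div_cancel₀ _ hp]
    · simp [mul_comm]
  right_inv' := by
    intro w _
    rw [chartInv, chartFun_mk]
    funext i
    by_cases h : i = j
    · subst h; simp
    · simp [h]
  open_source := isOpen_chartSource j
  open_target := isOpen_univ
  continuousOn_toFun := by
    rw [isQuotientMap_mk.continuousOn_isOpen_iff (isOpen_chartSource j)]
    have h : ContinuousOn (fun p : LinePair n =>
        Function.update (fun i => p.1.1 i / p.1.1 j) j (p.1.2 * p.1.1 j ^ k))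
        {p : LinePair n | p.1.1 j ≠ 0} := by
      rw [continuousOn_pi]
      intro i
      by_cases h : i = j
      · subst h
        simp only [Function.update_self]
        fun_prop
      · simp only [Function.update_of_ne h]
        exact ContinuousOn.div (by fun_prop) (by fun_prop) (fun p hp => hp)
    exact h.mono (fun p hp => mk_mem_chartSource.1 hp)
  continuousOn_invFun := by
    refine Continuous.continuousOn (isQuotientMap_mk.continuous.comp ?_)
    refine Continuous.subtype_mk ?_ _
    exact (continuous_id.update j continuous_const).prodMk (continuous_apply j)

theorem exists_mem_chartSource (x : TautPow n k) : ∃ j : Fin n, x ∈ chartSource j := by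
  obtain ⟨p, rfl⟩ := isQuotientMap_mk.surjective x
  obtain ⟨j, hj⟩ := Function.ne_iff.1 p.2
  exact ⟨j, mk_mem_chartSource.2 hj⟩

instance (n k : ℕ) : ChartedSpace (Fin n → ℂ) (TautPow n k) where
  atlas := range chart
  chartAt x := chart (exists_mem_chartSource x).choose
  mem_chart_source x := (exists_mem_chartSource x).choose_spec
  chart_mem_atlas _ := mem_range_self _

/-- The coordinate changes are holomorphic. -/
theorem contDiffOn_transition (i j : Fin n) (m : ℕ∞ω) :
    ContDiffOn ℂ m ((chart j : OpenPartialHomeomorph (TautPow n k) _) ∘ (chart i).symm)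
      ((chart i).symm ≫ₕ (chart j : OpenPartialHomeomorph (TautPow n k) _)).source := by
  have hs : ∀ w ∈ ((chart i).symm ≫ₕ
      (chart j : OpenPartialHomeomorph (TautPow n k) _)).source,
      Function.update w i (1 : ℂ) j ≠ 0 := by
    intro w hw
    rw [OpenPartialHomeomorph.trans_source] at hw
    exact mk_mem_chartSource.1 hw.2
  have hu : ∀ l : Fin n, ContDiff ℂ m (fun w : Fin n → ℂ => Function.update w i (1 : ℂ) l) := by
    intro l
    by_cases h : l = i
    · subst h; simpa using contDiff_const
    · simpa [h] using contDiff_apply ℂ ℂ l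
  change ContDiffOn ℂ m (fun w => chartFun j (chartInv i w : TautPow n k)) _
  rw [contDiffOn_pi]
  intro l
  by_cases h : l = j
  · subst h
    simp only [chartInv, chartFun_mk, Function.update_self]
    exact ((contDiff_apply ℂ ℂ i).mul ((hu l).pow k)).contDiffOn
  · simp only [chartInv, chartFun_mk, Function.update_of_ne h]
    exact (hu l).contDiffOn.div (hu j).contDiffOn hs

/-- `𝒪(-k)` is a complex manifold. -/
instance (n k : ℕ) (m : ℕ∞ω) : IsManifold 𝓘(ℂ, Fin n → ℂ) m (TautPow n k) := by
  refine isManifold_of_contDiffOn _ _ _ ?_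
  rintro _ _ ⟨i, rfl⟩ ⟨j, rfl⟩
  simpa using contDiffOn_transition (k := k) i j m

/-- `𝒪(-k)` as a real manifold. -/
instance (n k : ℕ) (m : ℕ∞ω) : IsManifold 𝓘(ℝ, Fin n → ℂ) m (TautPow n k) := by
  refine isManifold_of_contDiffOn _ _ _ ?_
  rintro _ _ ⟨i, rfl⟩ ⟨j, rfl⟩
  simpa using (contDiffOn_transition (k := k) i j m).restrict_scalars ℝ

end TautPow

/-! ### Complex structures, Kähler metrics -/

/-- The (real) tangent space of `𝒪(-k)` at `x`. -/
abbrev TautTangent {n k : ℕ} (x : TautPow n k) : Type := TangentSpace 𝓘(ℝ, Fin n → ℂ) x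

/-- Smooth Riemannian metrics on `𝒪(-k)`. -/
abbrev TautMetric (n k : ℕ) : Type :=
  ContMDiffRiemannianMetric 𝓘(ℝ, Fin n → ℂ) ∞ (Fin n → ℂ) (fun x : TautPow n k => TautTangent x)

/-- The differential at `z` of a map `F : ℂⁿ → 𝒪(-k)` (as a map of real manifolds). -/
def tautDiff {n k : ℕ} (F : (Fin n → ℂ) → TautPow n k) (z : Fin n → ℂ) (v : Fin n → ℂ) :
    TautTangent (F z) :=
  mfderiv 𝓘(ℝ, Fin n → ℂ) 𝓘(ℝ, Fin n → ℂ) F z v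

/-- Fields of endomorphisms of the tangent spaces of `𝒪(-k)`. -/
abbrev TautEndo (n k : ℕ) : Type := ∀ x : TautPow n k, TautTangent x →L[ℝ] TautTangent x

/-- The standard complex structure of `𝒪(-k)`: multiplication by `i` in the holomorphic charts. -/
def stdJ (n k : ℕ) : TautEndo n k :=
  fun _ => (Complex.I • ContinuousLinearMap.id ℝ (Fin n → ℂ) : (Fin n → ℂ) →L[ℝ] (Fin n → ℂ))

/-- `J` is an integrable complex structure on the manifold underlying `𝒪(-k)`: around every
point there is a smooth parametrization by an open subset of `ℂⁿ` which carries multiplication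
by `i` to `J`. -/
def IsComplexStructure {n k : ℕ} (J : TautEndo n k) : Prop :=
  ∀ x : TautPow n k, ∃ (U : Set (Fin n → ℂ)) (F : (Fin n → ℂ) → TautPow n k),
    IsOpen U ∧ x ∈ F '' U ∧
    ContMDiffOn 𝓘(ℝ, Fin n → ℂ) 𝓘(ℝ, Fin n → ℂ) ∞ F U ∧
    ∀ y ∈ U, Function.Bijective (tautDiff F y) ∧
      ∀ v, tautDiff F y (Complex.I • v) = J (F y) (tautDiff F y v)

/-- The fundamental form `ω(v, w) = g(J v, w)`. -/
def fundamentalForm {n k : ℕ} (g : TautMetric n k) (J : TautEndo n k) (x : TautPow n k)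
    (v w : TautTangent x) : ℝ :=
  g.inner x (J x v) w

/-- The pull-back of a two-form on `𝒪(-k)` by a map from `ℂⁿ`. -/
def pullForm {n k : ℕ} (Om : ∀ x : TautPow n k, TautTangent x → TautTangent x → ℝ)
    (F : (Fin n → ℂ) → TautPow n k) (z v w : Fin n → ℂ) : ℝ :=
  Om (F z) (tautDiff F z v) (tautDiff F z w)

/-- Closedness, for a two-form on `𝒪(-k)`, computed in the charts. -/
def IsClosedTwoForm {n k : ℕ} (Om : ∀ x : TautPow n k, TautTangent x → TautTangent x → ℝ) : Prop :=
  ∀ e ∈ atlas (Fin n → ℂ) (TautPow n k), ∀ p ∈ e.target, ∀ a b c : Fin n → ℂ,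
    fderiv ℝ (fun y => pullForm Om e.symm y b c) p a
      + fderiv ℝ (fun y => pullForm Om e.symm y c a) p b
      + fderiv ℝ (fun y => pullForm Om e.symm y a b) p c = 0

/-- `g` is a Kähler metric with respect to the complex structure `J`. -/
structure IsKahler {n k : ℕ} (g : TautMetric n k) (J : TautEndo n k) : Prop where
  complexStructure : IsComplexStructure J
  hermitian : ∀ (x : TautPow n k) (v w : TautTangent x), g.inner x (J x v) (J x w) = g.inner x v w
  closed : IsClosedTwoForm (fundamentalForm g J)

/-! ### Kähler potentials on `ℂⁿ ∖ {0}` -/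

/-- `𝐳 = |z_1|² + ⋯ + |z_n|²`. -/
def radSq {n : ℕ} (z : Fin n → ℂ) : ℝ := ∑ i, Complex.normSq (z i)

/-- The two-form `√-1 ∂∂̄ f` on `ℂⁿ`, as a real bilinear form: since
`√-1 ∂∂̄ f = - (1/2) d (df ∘ i)`, its value on `(v, w)` is
`(D²f(i v, w) - D²f(v, i w)) / 2`. For `f = |z|²` on `ℂ` it is `√-1 dz ∧ dz̄ = 2 dx ∧ dy`. -/
def ddbar {n : ℕ} (f : (Fin n → ℂ) → ℝ) (z v w : Fin n → ℂ) : ℝ :=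
  (fderiv ℝ (fderiv ℝ f) z (Complex.I • v) w - fderiv ℝ (fderiv ℝ f) z v (Complex.I • w)) / 2

open Classical in
/-- The map `z ↦ z^{⊗k}` from `ℂⁿ ∖ {0}` to `𝒪(-k)`. For `k ≥ 1` it identifies the quotient of
`ℂⁿ ∖ {0}` by the group `ℤ_k` of scalar `k`-th roots of unity with the complement of the zero
section. The value at `z = 0` is irrelevant. -/
def tensorPow (n k : ℕ) [NeZero n] (z : Fin n → ℂ) : TautPow n k :=
  if h : z ≠ 0 then TautPow.mk ⟨(z, 1), h⟩
  else TautPow.mk ⟨(fun _ => 1, 1), fun h0 => one_ne_zero (congrFun h0 (0 : Fin n))⟩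

/-- The metric `g` on `𝒪(-k)` arises from the potential `φ(𝐳)`, a smooth function of `𝐳 > 0`:
on `ℂⁿ ∖ {0}` its Kähler form is `√-1 ∂∂̄ φ(𝐳)`. -/
def ArisesFrom {n k : ℕ} [NeZero n] (g : TautMetric n k) (φ : ℝ → ℝ) : Prop :=
  ContDiffOn ℝ ∞ φ (Ioi 0) ∧
  ∀ z : Fin n → ℂ, z ≠ 0 → ∀ v w : Fin n → ℂ,
    pullForm (fundamentalForm g (stdJ n k)) (tensorPow n k) z v w
      = ddbar (fun y => φ (radSq y)) z v w

/-! ### ALE metrics -/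

/-- The Riemannian distance of `g`. -/
def riemDist {n k : ℕ} (g : TautMetric n k) (x y : TautPow n k) : ENNReal :=
  letI : RiemannianBundle (fun x : TautPow n k => TautTangent x) := ⟨g.toRiemannianMetric⟩
  Manifold.riemannianEDist 𝓘(ℝ, Fin n → ℂ) x y

/-- `g` is a complete Riemannian metric. -/
def IsCompleteMetric {n k : ℕ} (g : TautMetric n k) : Prop :=
  ∀ s : ℕ → TautPow n k,
    (∀ ε : ENNReal, 0 < ε → ∃ N : ℕ, ∀ i ≥ N, ∀ j ≥ N, riemDist g (s i) (s j) < ε) →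
    ∃ x, Tendsto s atTop (𝓝 x)

/-- The components `(Ψ^* g)_{ij}` at `x` of `g` in the coordinates given by a parametrization `Ψ`. -/
def metricCoeff {n k : ℕ} (g : TautMetric n k) (Ψ : EuclideanSpace ℝ (Fin (2 * n)) → TautPow n k)
    (i j : Fin (2 * n)) (x : EuclideanSpace ℝ (Fin (2 * n))) : ℝ :=
  g.inner (Ψ x)
    (mfderiv 𝓘(ℝ, EuclideanSpace ℝ (Fin (2 * n))) 𝓘(ℝ, Fin n → ℂ) Ψ x
      (EuclideanSpace.single i (1 : ℝ)))
    (mfderiv 𝓘(ℝ, EuclideanSpace ℝ (Fin (2 * n))) 𝓘(ℝ, Fin n → ℂ) Ψ x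
      (EuclideanSpace.single j (1 : ℝ)))

/-- `g` is an asymptotically locally Euclidean metric of order `τ` on `𝒪(-k)`: it is complete, and
outside a compact set `K` the space is diffeomorphic to `(ℝ²ⁿ ∖ B(0, R)) / Γ`, with `Γ ⊂ SO(2n)`
finite and acting freely on `ℝ²ⁿ ∖ {0}`, in such a way that the metric coefficients satisfy
`∂^m (g_{ij} - δ_{ij}) = O(|x|^{-τ-m})` for all `m ≥ 0`. The diffeomorphism is given through
the composition `Ψ` of the quotient map by `Γ` with the inverse diffeomorphism, that is, by a
local diffeomorphism `Ψ` from `ℝ²ⁿ ∖ B(0, R)` onto the complement of `K` whose fibres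
are the orbits of `Γ`. -/
def IsALE {n k : ℕ} (g : TautMetric n k) (τ : ℝ) : Prop :=
  IsCompleteMetric g ∧
  ∃ (Γ : Subgroup (EuclideanSpace ℝ (Fin (2 * n)) ≃ₗᵢ[ℝ] EuclideanSpace ℝ (Fin (2 * n))))
    (K : Set (TautPow n k)) (R : ℝ) (Ψ : EuclideanSpace ℝ (Fin (2 * n)) → TautPow n k),
    Finite Γ ∧
    (∀ γ ∈ Γ, LinearMap.det (γ.toLinearEquiv : EuclideanSpace ℝ (Fin (2 * n)) →ₗ[ℝ]
      EuclideanSpace ℝ (Fin (2 * n))) = 1) ∧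
    (∀ γ ∈ Γ, γ ≠ 1 → ∀ x, x ≠ 0 → γ x ≠ x) ∧
    IsCompact K ∧ 0 < R ∧
    ContMDiffOn 𝓘(ℝ, EuclideanSpace ℝ (Fin (2 * n))) 𝓘(ℝ, Fin n → ℂ) ∞ Ψ {x | R < ‖x‖} ∧
    (∀ x, R < ‖x‖ → Function.Bijective
      (mfderiv 𝓘(ℝ, EuclideanSpace ℝ (Fin (2 * n))) 𝓘(ℝ, Fin n → ℂ) Ψ x)) ∧
    Ψ '' {x | R < ‖x‖} = Kᶜ ∧
    (∀ x y, R < ‖x‖ → R < ‖y‖ → (Ψ x = Ψ y ↔ ∃ γ ∈ Γ, γ x = y)) ∧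
    ∀ (i j : Fin (2 * n)) (m : ℕ),
      (fun x => iteratedFDeriv ℝ m (fun y => metricCoeff g Ψ i j y - if i = j then 1 else 0) x)
        =O[Bornology.cobounded _] (fun x => ‖x‖ ^ (-τ - m))

/-- `g` is a `U(n)`-invariant Kähler ALE metric on `𝒪(-k)` which arises from the Kähler
potential `φ(𝐳)`. -/
structure IsInvariantKahlerALE {n k : ℕ} [NeZero n] (g : TautMetric n k) (φ : ℝ → ℝ) : Prop where
  kahler : IsKahler g (stdJ n k)
  potential : ArisesFrom g φ
  ale : ∃ τ : ℝ, 0 < τ ∧ IsALE g τ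

/-! ### The compactification and its coordinates at infinity -/

/-- The radial inversion `ξ ↦ ξ / |ξ|²` of `ℂⁿ ∖ {0}`. -/
def radInv {n : ℕ} (ξ : Fin n → ℂ) : Fin n → ℂ := (((radSq ξ)⁻¹ : ℝ) : ℂ) • ξ

/-- The inversion `z ↦ (z_1 / 𝐳, …, z̄_j / 𝐳, …, z_n / 𝐳)`, with a conjugate in the `j`-th
place only. -/
def conjInv {n : ℕ} (j : Fin n) (z : Fin n → ℂ) : Fin n → ℂ :=
  radInv (Function.update z j (starRingEnd ℂ (z j)))

/-- The coordinates `ξ` near infinity: the map from `ℂⁿ ∖ {0}` to `𝒪(-k)` taking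
`ξ` to the class of its radial inverse. -/
def xiMap (n k : ℕ) [NeZero n] (ξ : Fin n → ℂ) : TautPow n k := tensorPow n k (radInv ξ)

open Classical in
/-- The extension of `xiMap` by `0 ↦ ∞`, a map from `ℂⁿ` to the one-point compactification. -/
def xiChart (n k : ℕ) [NeZero n] (ξ : Fin n → ℂ) : OnePoint (TautPow n k) :=
  if ξ = 0 then OnePoint.infty else (xiMap n k ξ : OnePoint (TautPow n k))

/-- `u` is a conformal compactification factor for `g`: a positive smooth function with
`u = O(r^{-2})` as `r → ∞`, where `r` is the distance to a fixed base point. -/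
structure IsCompactificationFactor {n k : ℕ} (g : TautMetric n k) (u : TautPow n k → ℝ) :
    Prop where
  smooth : ContMDiff 𝓘(ℝ, Fin n → ℂ) 𝓘(ℝ, ℝ) ∞ u
  pos : ∀ x, 0 < u x
  decay : ∀ x₀ : TautPow n k, ∃ C r₀ : ℝ, ∀ x : TautPow n k,
    ENNReal.ofReal r₀ ≤ riemDist g x₀ x →
      ENNReal.ofReal (u x) * riemDist g x₀ x ^ 2 ≤ ENNReal.ofReal C

/-- `ĝ = u² g`, together with the complex structure `Ĵ`, is a Kähler conformal compactification
of `g` on the one-point compactification of `𝒪(-k)`: the factor `u` is a conformal compactification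
factor, `ĝ` is Kähler with respect to `Ĵ`, which is different from the original complex
structure, and `ξ ∈ ℂⁿ` are complex orbifold coordinates at the added point
(which is `ξ = 0`), with orbifold group `ℤ_k`. -/
structure IsKahlerCompactification {n k : ℕ} [NeZero n] (g : TautMetric n k)
    (u : TautPow n k → ℝ) (ghat : TautMetric n k) (Jhat : TautEndo n k) : Prop where
  factor : IsCompactificationFactor g u
  conformal : ∀ (x : TautPow n k) (v w : TautTangent x),
    ghat.inner x v w = u x ^ 2 * g.inner x v w
  kahler : IsKahler ghat Jhat
  different : Jhat ≠ stdJ n k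
  chart_continuous : Continuous (xiChart n k)
  chart_open : IsOpenMap (xiChart n k)
  chart_fibre : ∀ ξ η : Fin n → ℂ,
    xiChart n k ξ = xiChart n k η ↔ ∃ ζ : ℂ, ζ ^ k = 1 ∧ η = ζ • ξ
  chart_holomorphic : ∀ ξ : Fin n → ℂ, ξ ≠ 0 → ∀ v : Fin n → ℂ,
    tautDiff (xiMap n k) ξ (Complex.I • v) = Jhat (xiMap n k ξ) (tautDiff (xiMap n k) ξ v)

/-- `φ̂` is an indefinite integral `- ∫ (𝐳² ∂φ/∂𝐳)⁻¹ d𝐳` on `𝐳 > 0`. -/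
def IsHatPotential (φ φhat : ℝ → ℝ) : Prop :=
  ∀ t : ℝ, 0 < t → HasDerivAt φhat (-(t ^ 2 * deriv φ t)⁻¹) t

end

/-!
The proof rests on the function `ψ(𝐳) = 𝐳 φ'(𝐳)`: for the metric `g`, a horizontal vector at `z`
(one that is orthogonal to the complex line through `z`) of Euclidean length `√𝐳` has squared length
`2 ψ(𝐳)`.

*Extension over the zero section.* In the standard charts `ψ` is the squared length of a smooth
nowhere vanishing horizontal vector field, divided by a smooth positive function, so it extends
to a smooth positive function `moment` on the whole of `𝒪(-k)` (`contMDiff_moment`,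
`moment_pos`). The conformal factor is `u = 1 / moment`.

*The complex structure.* `hatJ` is obtained from the standard one by complex conjugation in the
fibres: the fibre coordinates `z_j ^ k` are replaced by `ξ_j ^ (-k)`, where `ξ = z / 𝐳`. Under this
inversion, a radial form with coefficients `(φ', φ'')` becomes, after multiplication of the metric by
`ψ⁻²` and change of the complex structure, the radial form of a potential with
`ψ̂ = 1 / ψ` (`radForm_radInv`, `hatForm_xiMap`). Integrating this relation gives the formula for
the potential `φ̂` (`ddbar_hat`), and closedness of radial forms gives the Kähler property off the
zero section, hence everywhere by density (`isKahler_hat`). The identity on the coordinate axes holds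
because there the differential of the inversion with one conjugate is complex linear
(`radForm_conjInv`).

*Decay.* What has to be shown is `r ≤ C √ψ` near infinity. A great circle through Hermitian
orthogonal vectors of length `√s` is horizontal and has constant speed `√(2 ψ(s))`, and any two points
of a level set `𝐳 = s` are joined by three such arcs (`exists_arcJoined`); so the diameter of the level
set is at most a multiple of `√ψ(s)`. On the other hand, sufficiently high level sets lie in the ALE
end and separate its inner boundary from infinity, because `𝒪(-k)` has only one end
(`EuclideanEnd.exists_fibreSq_bound`); so such a level set meets every ray of the end. For a function
`f` that is `Γ`-invariant, homogeneous of degree one and vanishes on one ray but not on another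
(`exists_invariant_homogeneous`), the gradient bound along the three arcs shows that the point of the
second ray in the level set has norm at most `C √ψ(s)`. Joining a base point to the level set along
this ray gives the estimate (`EuclideanEnd.exists_riemDist_le_sqrt_moment`, `moment_inv_decay`).
-/


noncomputable section

/-! ### Radial functions on `ℂⁿ` -/

/-- The real inner product `Re ∑ v̄ᵢ wᵢ` of `ℂⁿ`, as a continuous bilinear map. (The norm of
`Fin n → ℂ` is the supremum norm, so this is not its inner product.) -/
def rin {n : ℕ} : (Fin n → ℂ) →L[ℝ] (Fin n → ℂ) →L[ℝ] ℝ :=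
  ∑ i, (innerSL ℝ (E := ℂ)).bilinearComp (ContinuousLinearMap.proj i)
    (ContinuousLinearMap.proj i)

theorem rin_apply {n : ℕ} (v w : Fin n → ℂ) :
    rin v w = ∑ i, ((v i).re * (w i).re + (v i).im * (w i).im) := by
  simp only [rin, sum_apply]
  refine Finset.sum_congr rfl fun i _ => ?_
  simp [Complex.inner, Complex.mul_re]
  ring

theorem rin_comm {n : ℕ} (v w : Fin n → ℂ) : rin v w = rin w v := by
  simp only [rin_apply]
  exact Finset.sum_congr rfl fun i _ => by ring

theorem rin_self {n : ℕ} (z : Fin n → ℂ) : rin z z = radSq z := by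
  simp only [rin_apply, radSq, Complex.normSq_apply]

theorem rin_I_left {n : ℕ} (v w : Fin n → ℂ) : rin (Complex.I • v) w = -rin v (Complex.I • w) := by
  simp only [rin_apply, ← Finset.sum_neg_distrib]
  refine Finset.sum_congr rfl fun i _ => ?_
  simp

theorem I_smul_I_smul {n : ℕ} (v : Fin n → ℂ) : Complex.I • Complex.I • v = -v := by
  rw [smul_smul, Complex.I_mul_I, neg_one_smul]

theorem rin_self_I {n : ℕ} (v : Fin n → ℂ) : rin v (Complex.I • v) = 0 := by
  have h := rin_I_left v v
  rw [rin_comm] at h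
  linarith

theorem radSq_nonneg {n : ℕ} (z : Fin n → ℂ) : 0 ≤ radSq z :=
  Finset.sum_nonneg fun _ _ => Complex.normSq_nonneg _

theorem radSq_eq_zero {n : ℕ} {z : Fin n → ℂ} : radSq z = 0 ↔ z = 0 := by
  rw [radSq, Finset.sum_eq_zero_iff_of_nonneg fun _ _ => Complex.normSq_nonneg _]
  simp [funext_iff]

theorem radSq_pos {n : ℕ} {z : Fin n → ℂ} : 0 < radSq z ↔ z ≠ 0 := by
  rw [(radSq_nonneg z).lt_iff_ne, ne_comm, Ne, radSq_eq_zero]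

theorem radSq_smul {n : ℕ} (c : ℂ) (z : Fin n → ℂ) :
    radSq (c • z) = Complex.normSq c * radSq z := by
  simp [radSq, Finset.mul_sum]

theorem hasStrictFDerivAt_radSq {n : ℕ} (z : Fin n → ℂ) :
    HasStrictFDerivAt (radSq : (Fin n → ℂ) → ℝ) ((2 : ℝ) • rin z) z := by
  have h : (radSq : (Fin n → ℂ) → ℝ) = fun z => rin z z := funext fun z => (rin_self z).symm
  rw [h]
  refine ((rin (n := n)).hasStrictFDerivAt.clm_apply (hasStrictFDerivAt_id z)).congr_fderiv ?_
  refine ContinuousLinearMap.ext fun v => ?_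
  have := rin_comm v z
  simp only [add_apply, ContinuousLinearMap.comp_apply, ContinuousLinearMap.flip_apply,
    ContinuousLinearMap.id_apply, id_eq, smul_apply, smul_eq_mul]
  linarith

theorem contDiff_radSq {n : ℕ} {m : ℕ∞ω} : ContDiff ℝ m (radSq : (Fin n → ℂ) → ℝ) := by
  have h : (radSq : (Fin n → ℂ) → ℝ) = fun z => rin z z := funext fun z => (rin_self z).symm
  rw [h]
  exact (rin (n := n)).contDiff.clm_apply contDiff_id

/-- The value on `(v, w)` of `√-1 ∂∂̄ h(𝐳)` at a point `z` where `h' (𝐳) = p` and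
`h'' (𝐳) = q`. -/
def radForm {n : ℕ} (p q : ℝ) (z v w : Fin n → ℂ) : ℝ :=
  2 * q * (rin z (Complex.I • v) * rin z w - rin z v * rin z (Complex.I • w))
    + 2 * p * rin (Complex.I • v) w

theorem ddbar_radial {n : ℕ} {h h₁ : ℝ → ℝ} {q : ℝ} {z : Fin n → ℂ}
    (h1 : ∀ᶠ t in 𝓝 (radSq z), HasDerivAt h (h₁ t) t) (h2 : HasDerivAt h₁ q (radSq z))
    (v w : Fin n → ℂ) :
    ddbar (fun y => h (radSq y)) z v w = radForm (h₁ (radSq z)) q z v w := by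
  have c : ContinuousAt (radSq : (Fin n → ℂ) → ℝ) z := (contDiff_radSq (m := 0)).continuous.continuousAt
  have e1 : fderiv ℝ (fun y : Fin n → ℂ => h (radSq y))
      =ᶠ[𝓝 z] fun y => (2 * h₁ (radSq y)) • rin y := by
    filter_upwards [c.eventually h1] with y hy
    have := (hy.comp_hasFDerivAt y (hasStrictFDerivAt_radSq y).hasFDerivAt).fderiv
    rw [smul_smul, mul_comm] at this
    exact this
  have e2 : HasFDerivAt (fun y : Fin n → ℂ => (2 * h₁ (radSq y)) • (rin y))
      ((2 * h₁ (radSq z)) • rin + ((2 * q) • ((2 : ℝ) • rin z)).smulRight (rin z)) z := by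
    have a := (h2.const_mul 2).comp_hasFDerivAt z (hasStrictFDerivAt_radSq z).hasFDerivAt
    exact a.smul (rin (n := n)).hasFDerivAt
  rw [ddbar, e1.fderiv_eq, e2.fderiv, radForm]
  simp only [add_apply, smul_apply, smul_eq_mul,
    ContinuousLinearMap.smulRight_apply]
  have := rin_I_left v w
  linear_combination (- h₁ (radSq z)) * this

/-! ### The radial inversion -/

/-- The differential of the radial inversion: the reflection in the real line spanned by `ξ`,
scaled by `1 / |ξ|²`. -/
def radInvDiff {n : ℕ} (ξ v : Fin n → ℂ) : Fin n → ℂ :=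
  (radSq ξ)⁻¹ • (v - (2 * (radSq ξ)⁻¹ * rin ξ v) • ξ)

theorem radInv_eq {n : ℕ} (ξ : Fin n → ℂ) : radInv ξ = (radSq ξ)⁻¹ • ξ := by
  ext i; simp [radInv]

theorem radSq_real_smul {n : ℕ} (c : ℝ) (z : Fin n → ℂ) : radSq (c • z) = c ^ 2 * radSq z := by
  rw [← rin_self, ← rin_self]
  simp
  ring

theorem radSq_radInv {n : ℕ} (ξ : Fin n → ℂ) : radSq (radInv ξ) = (radSq ξ)⁻¹ := by
  rw [radInv_eq, radSq_real_smul]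
  by_cases h : radSq ξ = 0
  · simp [h]
  · field_simp

theorem radInv_ne_zero {n : ℕ} {ξ : Fin n → ℂ} (h : ξ ≠ 0) : radInv ξ ≠ 0 := by
  rw [← radSq_pos, radSq_radInv]
  exact inv_pos.2 (radSq_pos.2 h)

theorem radInv_radInv {n : ℕ} (ξ : Fin n → ℂ) : radInv (radInv ξ) = ξ := by
  by_cases h : ξ = 0
  · simp [h, radInv]
  · rw [radInv_eq, radSq_radInv, radInv_eq, smul_smul, inv_inv,
      mul_inv_cancel₀ (radSq_pos.2 h).ne', one_smul]

theorem hasStrictFDerivAt_radInv {n : ℕ} {ξ : Fin n → ℂ} (h : ξ ≠ 0) :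
    ∃ L : (Fin n → ℂ) →L[ℝ] (Fin n → ℂ),
      HasStrictFDerivAt radInv L ξ ∧ ∀ v, L v = radInvDiff ξ v := by
  have h0 := (radSq_pos.2 h).ne'
  have e : (radInv : (Fin n → ℂ) → (Fin n → ℂ)) = fun ξ => (radSq ξ)⁻¹ • ξ := funext radInv_eq
  rw [e]
  refine ⟨_, ((hasStrictFDerivAt_inv h0).comp ξ (hasStrictFDerivAt_radSq ξ)).smul
    (hasStrictFDerivAt_id ξ), fun v => ?_⟩
  simp only [radInvDiff, add_apply, smul_apply,
    ContinuousLinearMap.smulRight_apply, ContinuousLinearMap.comp_apply, smul_eq_mul,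
    ContinuousLinearMap.toSpanSingleton_apply, ContinuousLinearMap.id_apply, sub_eq_add_neg, ← neg_smul,
    smul_add]
  congr 1
  rw [smul_smul]
  congr 1
  field_simp

theorem differentiableAt_radInv {n : ℕ} {ξ : Fin n → ℂ} (h : ξ ≠ 0) :
    DifferentiableAt ℝ radInv ξ := by
  obtain ⟨L, hL, -⟩ := hasStrictFDerivAt_radInv h
  exact hL.differentiableAt

theorem fderiv_radInv {n : ℕ} {ξ : Fin n → ℂ} (h : ξ ≠ 0) (v : Fin n → ℂ) :
    fderiv ℝ radInv ξ v = radInvDiff ξ v := by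
  obtain ⟨L, hL, hv⟩ := hasStrictFDerivAt_radInv h
  rw [hL.hasFDerivAt.fderiv, hv]

/-- Write `ψ = 𝐳 p` for a radial Kähler form with coefficients `p`, `q`, and let `G` be its metric.
The pull-back of `ψ⁻² G` by the radial inversion, combined with the complex structure of the
`ξ`-coordinates, is again a radial Kähler form, with coefficient `p⁻¹` in place of `p`. -/
theorem radForm_radInv {n : ℕ} {p q : ℝ} (hp : p ≠ 0) {ξ : Fin n → ℂ} (h : ξ ≠ 0)
    (v w : Fin n → ℂ) :
    (((radSq ξ)⁻¹ * p) ^ 2)⁻¹ * radForm p q (radInv ξ)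
        (-(Complex.I • radInvDiff ξ (Complex.I • v))) (radInvDiff ξ w)
      = radForm p⁻¹ (q / (radSq ξ ^ 2 * p ^ 2)) ξ v w := by
  have h0 := (radSq_pos.2 h).ne'
  have e1 := rin_self ξ
  have e2 := rin_self_I ξ
  have e7 : rin (Complex.I • v) ξ = rin ξ (Complex.I • v) := rin_comm _ _
  have hI : ∀ (c : ℝ) (x : Fin n → ℂ), Complex.I • c • x = c • Complex.I • x :=
    fun c x => smul_comm _ _ _
  simp only [radForm, radInvDiff, radInv_eq, smul_neg, smul_sub, hI, map_neg, map_sub, map_smul,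
    neg_apply, sub_apply, smul_apply,
    smul_eq_mul, I_smul_I_smul, e1, e2, e7]
  field_simp
  ring

/-! ### The potential of the compactification -/

theorem exists_isHatPotential {φ : ℝ → ℝ} (hc : ContinuousOn (deriv φ) (Ioi 0))
    (h0 : ∀ t, 0 < t → deriv φ t ≠ 0) : ∃ φhat : ℝ → ℝ, IsHatPotential φ φhat := by
  have hf : ContinuousOn (fun t : ℝ => -(t ^ 2 * deriv φ t)⁻¹) (Ioi 0) := by
    refine (ContinuousOn.inv₀ (by fun_prop) fun t ht => ?_).neg
    exact mul_ne_zero (pow_ne_zero _ (ne_of_gt ht)) (h0 t ht)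
  refine ⟨fun t => ∫ x in (1 : ℝ)..t, -(x ^ 2 * deriv φ x)⁻¹, fun t ht => ?_⟩
  refine intervalIntegral.integral_hasDerivAt_right ?_
    (hf.stronglyMeasurableAtFilter isOpen_Ioi t ht) (hf.continuousAt (Ioi_mem_nhds ht))
  refine (hf.mono fun x hx => ?_).intervalIntegrable
  exact lt_of_lt_of_le (lt_min one_pos ht) hx.1

theorem hasDerivAt_inv_deriv {φ : ℝ → ℝ} (hφ : ContDiffOn ℝ ∞ φ (Ioi 0)) {t : ℝ} (ht : 0 < t)
    (h0 : deriv φ t⁻¹ ≠ 0) : HasDerivAt (fun t => (deriv φ t⁻¹)⁻¹)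
      (deriv (deriv φ) t⁻¹ / (t ^ 2 * deriv φ t⁻¹ ^ 2)) t := by
  have hc : ContDiffAt ℝ 1 (deriv φ) t⁻¹ :=
    ((hφ.deriv_of_isOpen isOpen_Ioi (m := 1) (by norm_cast)).contDiffAt
      (Ioi_mem_nhds (inv_pos.2 ht)))
  have h1 := (hc.differentiableAt one_ne_zero).hasDerivAt.comp t (hasDerivAt_inv ht.ne')
  have h2 := h1.inv h0
  refine h2.congr_deriv ?_
  simp only [Function.comp_apply]
  field_simp

theorem ddbar_hat {n : ℕ} {φ φhat : ℝ → ℝ} (hφ : ContDiffOn ℝ ∞ φ (Ioi 0))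
    (hh : IsHatPotential φ φhat) {ξ : Fin n → ℂ} (hξ : ξ ≠ 0)
    (h0 : deriv φ (radSq ξ)⁻¹ ≠ 0) (v w : Fin n → ℂ) :
    ddbar (fun η => φhat (radSq η)⁻¹) ξ v w
      = radForm (deriv φ (radSq ξ)⁻¹)⁻¹
          (deriv (deriv φ) (radSq ξ)⁻¹ / (radSq ξ ^ 2 * deriv φ (radSq ξ)⁻¹ ^ 2)) ξ v w := by
  have hs := radSq_pos.2 hξ
  refine ddbar_radial (h := fun t => φhat t⁻¹) (h₁ := fun t => (deriv φ t⁻¹)⁻¹) ?_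
    (hasDerivAt_inv_deriv hφ hs h0) v w
  filter_upwards [Ioi_mem_nhds hs] with t ht
  have ht0 : t ≠ 0 := ne_of_gt ht
  refine ((hh t⁻¹ (inv_pos.2 ht)).comp t (hasDerivAt_inv ht0)).congr_deriv ?_
  rw [mul_inv]
  field_simp

theorem ddbar_pot {n : ℕ} {φ : ℝ → ℝ} (hφ : ContDiffOn ℝ ∞ φ (Ioi 0)) {z : Fin n → ℂ}
    (hz : z ≠ 0) (v w : Fin n → ℂ) :
    ddbar (fun y => φ (radSq y)) z v w
      = radForm (deriv φ (radSq z)) (deriv (deriv φ) (radSq z)) z v w := by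
  have hs := radSq_pos.2 hz
  refine ddbar_radial ?_ ?_ v w
  · filter_upwards [Ioi_mem_nhds hs] with t ht
    exact ((hφ.contDiffAt (Ioi_mem_nhds ht)).differentiableAt (by simp)).hasDerivAt
  · have hc : ContDiffAt ℝ 1 (deriv φ) (radSq z) :=
      ((hφ.deriv_of_isOpen isOpen_Ioi (m := 1) (by norm_cast)).contDiffAt (Ioi_mem_nhds hs))
    exact (hc.differentiableAt one_ne_zero).hasDerivAt

/-- A radial form `√-1 ∂∂̄ h(𝐳)` is closed. -/
theorem radForm_closed {n : ℕ} {p q : ℝ → ℝ} {r : ℝ} {z : Fin n → ℂ}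
    (hp : HasDerivAt p (q (radSq z)) (radSq z)) (hq : HasDerivAt q r (radSq z))
    (a b c : Fin n → ℂ) :
    fderiv ℝ (fun y => radForm (p (radSq y)) (q (radSq y)) y b c) z a
      + fderiv ℝ (fun y => radForm (p (radSq y)) (q (radSq y)) y c a) z b
      + fderiv ℝ (fun y => radForm (p (radSq y)) (q (radSq y)) y a b) z c = 0 := by
  have hP := hp.comp_hasFDerivAt z (hasStrictFDerivAt_radSq z).hasFDerivAt
  have hQ := hq.comp_hasFDerivAt z (hasStrictFDerivAt_radSq z).hasFDerivAt
  have hr : ∀ b : Fin n → ℂ, HasFDerivAt (fun y => rin y b) ((rin (n := n)).flip b) z :=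
    fun b => ((rin (n := n)).flip b).hasFDerivAt
  have key : ∀ a b c : Fin n → ℂ,
      fderiv ℝ (fun y => radForm (p (radSq y)) (q (radSq y)) y b c) z a
        = 2 * (r * (2 * rin z a)) * (rin z (Complex.I • b) * rin z c
            - rin z b * rin z (Complex.I • c))
          + 2 * q (radSq z) * (rin a (Complex.I • b) * rin z c + rin z (Complex.I • b) * rin a c
            - rin a b * rin z (Complex.I • c) - rin z b * rin a (Complex.I • c))
          + 2 * (q (radSq z) * (2 * rin z a)) * rin (Complex.I • b) c := by
    intro a b c
    have := (((hQ.const_mul 2).mul (((hr (Complex.I • b)).mul (hr c)).sub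
      ((hr b).mul (hr (Complex.I • c))))).add
        ((hP.const_mul 2).mul_const (rin (Complex.I • b) c))).fderiv
    refine (DFunLike.congr_fun this a).trans ?_
    simp only [add_apply, smul_apply, sub_apply, smul_eq_mul, ContinuousLinearMap.flip_apply,
      Function.comp_apply, Pi.sub_apply, Pi.mul_apply]
    ring
  rw [key, key, key]
  have e1 := rin_I_left a b
  have e2 := rin_I_left b c
  have e3 := rin_I_left c a
  have f1 : rin a (Complex.I • b) = -rin b (Complex.I • a) := by rw [rin_comm, rin_I_left]
  have f2 : rin b (Complex.I • c) = -rin c (Complex.I • b) := by rw [rin_comm, rin_I_left]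
  have f3 : rin c (Complex.I • a) = -rin a (Complex.I • c) := by rw [rin_comm, rin_I_left]
  have g1 := rin_comm b a
  have g2 := rin_comm c b
  have g3 := rin_comm c a
  rw [e1, e2, e3, g1, g2, g3, f1, f2, f3]
  ring

/-! ### The inversion along a coordinate axis -/

/-- Conjugation of the `j`-th coordinate, as a real linear map. -/
def conjAt {n : ℕ} (j : Fin n) : (Fin n → ℂ) →L[ℝ] (Fin n → ℂ) :=
  ContinuousLinearMap.pi fun i =>
    if i = j then (Complex.conjCLE : ℂ →L[ℝ] ℂ).comp (ContinuousLinearMap.proj i)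
    else ContinuousLinearMap.proj i

theorem conjAt_apply {n : ℕ} (j : Fin n) (v : Fin n → ℂ) :
    conjAt j v = Function.update v j (starRingEnd ℂ (v j)) := by
  ext i
  by_cases h : i = j
  · subst h; simp [conjAt]
  · simp [conjAt, h]

theorem rin_conjAt {n : ℕ} (j : Fin n) (v w : Fin n → ℂ) :
    rin (conjAt j v) (conjAt j w) = rin v w := by
  simp only [rin_apply, conjAt_apply]
  refine Finset.sum_congr rfl fun i _ => ?_
  by_cases h : i = j
  · subst h; simp
  · simp [h]

theorem radSq_conjAt {n : ℕ} (j : Fin n) (z : Fin n → ℂ) : radSq (conjAt j z) = radSq z := by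
  rw [← rin_self, rin_conjAt, rin_self]

theorem rin_axis {n : ℕ} {j : Fin n} {z : Fin n → ℂ} (hz : ∀ i, i ≠ j → z i = 0)
    (v : Fin n → ℂ) : rin z v = (z j).re * (v j).re + (z j).im * (v j).im := by
  rw [rin_apply, Finset.sum_eq_single j]
  · intro i _ hi; simp [hz i hi]
  · simp

theorem conjAt_axis {n : ℕ} {j : Fin n} {z : Fin n → ℂ} (hz : ∀ i, i ≠ j → z i = 0) :
    ∀ i, i ≠ j → conjAt j z i = 0 := by
  intro i hi
  simp [conjAt_apply, hi, hz i hi]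

theorem rin_I_conjAt {n : ℕ} (j : Fin n) (v w : Fin n → ℂ) :
    rin (Complex.I • conjAt j v) (conjAt j w)
      = rin (Complex.I • v) w - 2 * ((v j).re * (w j).im - (v j).im * (w j).re) := by
  have : rin (Complex.I • conjAt j v) (conjAt j w) - rin (Complex.I • v) w
      = - 2 * ((v j).re * (w j).im - (v j).im * (w j).re) := by
    rw [rin_apply, rin_apply, ← Finset.sum_sub_distrib, Finset.sum_eq_single j]
    · simp [conjAt_apply]; ring
    · intro i _ hi; simp [conjAt_apply, hi]
    · simp
  linarith

theorem conjInv_eq {n : ℕ} (j : Fin n) (z : Fin n → ℂ) : conjInv j z = radInv (conjAt j z) := by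
  rw [conjInv, conjAt_apply]

theorem conjAt_ne_zero {n : ℕ} {j : Fin n} {z : Fin n → ℂ} (hz : z ≠ 0) : conjAt j z ≠ 0 := by
  rw [← radSq_pos, radSq_conjAt]; exact radSq_pos.2 hz

theorem radSq_conjInv {n : ℕ} (j : Fin n) (z : Fin n → ℂ) :
    radSq (conjInv j z) = (radSq z)⁻¹ := by
  rw [conjInv_eq, radSq_radInv, radSq_conjAt]

theorem fderiv_conjInv {n : ℕ} (j : Fin n) {z : Fin n → ℂ} (hz : z ≠ 0) (v : Fin n → ℂ) :
    fderiv ℝ (conjInv j) z v = radInvDiff (conjAt j z) (conjAt j v) := by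
  have e : (conjInv j : (Fin n → ℂ) → _) = radInv ∘ conjAt j := funext (conjInv_eq j)
  rw [e, fderiv_comp z (differentiableAt_radInv (conjAt_ne_zero hz)) (conjAt j).differentiableAt,
    ContinuousLinearMap.fderiv, ContinuousLinearMap.comp_apply, fderiv_radInv (conjAt_ne_zero hz)]

/-- On the `j`-th axis the differential of `conjInv j` is complex linear, and it scales the radial
Kähler form of the compactification to the original one. -/
theorem radForm_conjInv {n : ℕ} {j : Fin n} {p q : ℝ} (hp : p ≠ 0) {z : Fin n → ℂ} (h : z ≠ 0)
    (hz : ∀ i, i ≠ j → z i = 0) (v w : Fin n → ℂ) :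
    radForm p⁻¹ (q / ((radSq z)⁻¹ ^ 2 * p ^ 2)) (conjInv j z) (fderiv ℝ (conjInv j) z v)
        (fderiv ℝ (conjInv j) z w)
      = ((radSq z * p) ^ 2)⁻¹ * radForm p q z v w := by
  have h0 := (radSq_pos.2 h).ne'
  rw [fderiv_conjInv j h, fderiv_conjInv j h, conjInv_eq]
  set c := conjAt (n := n) j with hc
  have hI : ∀ (c : ℝ) (x : Fin n → ℂ), Complex.I • c • x = c • Complex.I • x :=
    fun c x => smul_comm _ _ _
  have hs : radSq z = (z j).re ^ 2 + (z j).im ^ 2 := by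
    rw [← rin_self, rin_axis hz]; ring
  have hI1 : ∀ v, rin (c z) (Complex.I • c v) = - rin z (Complex.I • v) := by
    intro v
    rw [rin_axis (conjAt_axis hz), rin_axis hz]
    simp [hc, conjAt_apply]
    ring
  have hI2 : ∀ v, rin (Complex.I • c v) (c z) = - rin z (Complex.I • v) := by
    intro v; rw [rin_comm, hI1]
  have hI3 : ∀ v, rin (Complex.I • c z) (c v) = rin z (Complex.I • v) := by
    intro v; rw [rin_I_left, hI1, neg_neg]
  have hI4 : rin (Complex.I • c v) (c w) = rin (Complex.I • v) w
      - 2 / radSq z * (rin z (Complex.I • v) * rin z w - rin z v * rin z (Complex.I • w)) := by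
    rw [hc, rin_I_conjAt, rin_axis hz, rin_axis hz, rin_axis hz, rin_axis hz]
    rw [hs] at h0 ⊢
    simp only [Pi.smul_apply, smul_eq_mul, Complex.mul_re, Complex.mul_im, Complex.I_re,
      Complex.I_im]
    field_simp
    ring
  simp only [radForm, radInvDiff, radInv_eq, smul_sub, hI, map_sub, map_smul,
    sub_apply, smul_apply, smul_eq_mul, rin_self, rin_self_I, hI1, hI2, hI3, hI4]
  simp only [hc, radSq_conjAt, rin_conjAt]
  field_simp
  ring

/-! ### Differentials of maps into `𝒪(-k)` -/

section Differentials

variable {n k : ℕ}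

/-- The index of the standard chart that is preferred at `x`. -/
def TautPow.idx (x : TautPow n k) : Fin n := (TautPow.exists_mem_chartSource x).choose

theorem TautPow.mem_chartSource_idx (x : TautPow n k) : x ∈ TautPow.chartSource x.idx :=
  (TautPow.exists_mem_chartSource x).choose_spec

open TautPow

theorem tautDiff_eq_fderiv {F : (Fin n → ℂ) → TautPow n k} {z : Fin n → ℂ}
    (hF : MDifferentiableAt 𝓘(ℝ, Fin n → ℂ) 𝓘(ℝ, Fin n → ℂ) F z) (v : Fin n → ℂ) :
    tautDiff F z v = fderiv ℝ (fun y => chartFun (F z).idx (F y)) z v := by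
  rw [tautDiff, hF.mfderiv]
  simp only [writtenInExtChartAt, mfld_simps, fderivWithin_univ]
  rfl

theorem tautDiff_comp {F : (Fin n → ℂ) → TautPow n k} {G : (Fin n → ℂ) → (Fin n → ℂ)}
    {z : Fin n → ℂ} (hF : MDifferentiableAt 𝓘(ℝ, Fin n → ℂ) 𝓘(ℝ, Fin n → ℂ) F (G z))
    (hG : DifferentiableAt ℝ G z) (v : Fin n → ℂ) :
    tautDiff (F ∘ G) z v = tautDiff F (G z) (fderiv ℝ G z v) := by
  rw [tautDiff, mfderiv_comp z hF hG.mdifferentiableAt, mfderiv_eq_fderiv]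
  rfl

theorem pullForm_comp (Om : ∀ x : TautPow n k, TautTangent x → TautTangent x → ℝ)
    {F : (Fin n → ℂ) → TautPow n k} {G : (Fin n → ℂ) → (Fin n → ℂ)} {z : Fin n → ℂ}
    (hF : MDifferentiableAt 𝓘(ℝ, Fin n → ℂ) 𝓘(ℝ, Fin n → ℂ) F (G z))
    (hG : DifferentiableAt ℝ G z) (v w : Fin n → ℂ) :
    pullForm Om (F ∘ G) z v w = pullForm Om F (G z) (fderiv ℝ G z v) (fderiv ℝ G z w) := by
  rw [pullForm, tautDiff_comp hF hG, tautDiff_comp hF hG]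
  rfl

theorem pullForm_congr (Om : ∀ x : TautPow n k, TautTangent x → TautTangent x → ℝ)
    {F F' : (Fin n → ℂ) → TautPow n k} {z : Fin n → ℂ} (h : F =ᶠ[𝓝 z] F') (v w : Fin n → ℂ) :
    pullForm Om F z v w = pullForm Om F' z v w := by
  have key : ∀ x y : TautPow n k, x = y → ∀ a b : Fin n → ℂ, Om x a b = Om y a b := by
    rintro x _ rfl a b; rfl
  have e : ∀ v, (tautDiff F z v : Fin n → ℂ) = tautDiff F' z v := fun v =>
    DFunLike.congr_fun (h.mfderiv_eq (I := 𝓘(ℝ, Fin n → ℂ)) (I' := 𝓘(ℝ, Fin n → ℂ))) v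
  rw [pullForm, pullForm]
  refine (key _ _ h.self_of_nhds _ _).trans ?_
  rw [show (tautDiff F z v : Fin n → ℂ) = tautDiff F' z v from e v,
    show (tautDiff F z w : Fin n → ℂ) = tautDiff F' z w from e w]

theorem tautDiff_congr {F F' : (Fin n → ℂ) → TautPow n k} {z : Fin n → ℂ} (h : F =ᶠ[𝓝 z] F')
    (v : Fin n → ℂ) : (tautDiff F z v : Fin n → ℂ) = tautDiff F' z v :=
  DFunLike.congr_fun (h.mfderiv_eq (I := 𝓘(ℝ, Fin n → ℂ)) (I' := 𝓘(ℝ, Fin n → ℂ))) v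

namespace TautPow

theorem chart_mem_atlas' (j : Fin n) :
    (chart j : OpenPartialHomeomorph (TautPow n k) _) ∈ atlas (Fin n → ℂ) (TautPow n k) :=
  mem_range_self j

theorem contMDiff_chartInv (j : Fin n) :
    ContMDiff 𝓘(ℝ, Fin n → ℂ) 𝓘(ℝ, Fin n → ℂ) ∞ (chartInv j : (Fin n → ℂ) → TautPow n k) := by
  have := contMDiffOn_symm_of_mem_maximalAtlas (I := 𝓘(ℝ, Fin n → ℂ)) (n := ∞)
    (IsManifold.subset_maximalAtlas (chart_mem_atlas' (n := n) (k := k) j))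
  rw [← contMDiffOn_univ]
  exact this

theorem contMDiffOn_chartFun (j : Fin n) :
    ContMDiffOn 𝓘(ℝ, Fin n → ℂ) 𝓘(ℝ, Fin n → ℂ) ∞ (chartFun j : TautPow n k → _)
      (chartSource j) :=
  contMDiffOn_of_mem_maximalAtlas (I := 𝓘(ℝ, Fin n → ℂ)) (n := ∞)
    (IsManifold.subset_maximalAtlas (chart_mem_atlas' (n := n) (k := k) j))

theorem contMDiffAt_chartFun {j : Fin n} {x : TautPow n k} (hx : x ∈ chartSource j) :
    ContMDiffAt 𝓘(ℝ, Fin n → ℂ) 𝓘(ℝ, Fin n → ℂ) ∞ (chartFun j : TautPow n k → _) x :=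
  (contMDiffOn_chartFun j).contMDiffAt ((isOpen_chartSource j).mem_nhds hx)

theorem mdifferentiableAt_chartInv (j : Fin n) (p : Fin n → ℂ) :
    MDifferentiableAt 𝓘(ℝ, Fin n → ℂ) 𝓘(ℝ, Fin n → ℂ)
      (chartInv j : (Fin n → ℂ) → TautPow n k) p :=
  (contMDiff_chartInv j p).mdifferentiableAt (by simp)

theorem chartInv_mem_chartSource (j : Fin n) (p : Fin n → ℂ) :
    (chartInv j p : TautPow n k) ∈ chartSource j :=
  (chart j : OpenPartialHomeomorph (TautPow n k) _).map_target (mem_univ p)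

theorem chartFun_chartInv (j : Fin n) (p : Fin n → ℂ) :
    chartFun j (chartInv j p : TautPow n k) = p :=
  (chart j : OpenPartialHomeomorph (TautPow n k) _).right_inv (mem_univ p)

theorem chartInv_chartFun {j : Fin n} {x : TautPow n k} (hx : x ∈ chartSource j) :
    (chartInv j (chartFun j x) : TautPow n k) = x :=
  (chart j : OpenPartialHomeomorph (TautPow n k) _).left_inv hx

theorem bijective_tautDiff_of_leftInverse {F : (Fin n → ℂ) → TautPow n k} {z : Fin n → ℂ}
    {P : TautPow n k → (Fin n → ℂ)}
    (hF : MDifferentiableAt 𝓘(ℝ, Fin n → ℂ) 𝓘(ℝ, Fin n → ℂ) F z)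
    (hP : MDifferentiableAt 𝓘(ℝ, Fin n → ℂ) 𝓘(ℝ, Fin n → ℂ) P (F z))
    (h : ∀ y, P (F y) = y) : Function.Bijective (tautDiff F z) := by
  have hc := mfderiv_comp z hP hF
  have he : P ∘ F = id := funext h
  rw [he, mfderiv_id] at hc
  have hi : Function.Injective (tautDiff F z) := by
    intro v w hvw
    have a := DFunLike.congr_fun hc v
    have b := DFunLike.congr_fun hc w
    have : mfderiv 𝓘(ℝ, Fin n → ℂ) 𝓘(ℝ, Fin n → ℂ) F z v
      = mfderiv 𝓘(ℝ, Fin n → ℂ) 𝓘(ℝ, Fin n → ℂ) F z w := hvw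
    have c := congrArg (mfderiv 𝓘(ℝ, Fin n → ℂ) 𝓘(ℝ, Fin n → ℂ) P (F z)) this
    exact a.trans (c.trans b.symm)
  refine ⟨hi, ?_⟩
  let L : (Fin n → ℂ) →L[ℝ] (Fin n → ℂ) := mfderiv 𝓘(ℝ, Fin n → ℂ) 𝓘(ℝ, Fin n → ℂ) F z
  have hl := LinearMap.injective_iff_surjective (f := (L : (Fin n → ℂ) →ₗ[ℝ] (Fin n → ℂ)))
  exact hl.1 hi

theorem bijective_tautDiff_chartInv (j : Fin n) (p : Fin n → ℂ) :
    Function.Bijective (tautDiff (chartInv j : (Fin n → ℂ) → TautPow n k) p) :=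
  bijective_tautDiff_of_leftInverse (mdifferentiableAt_chartInv j p)
    ((contMDiffAt_chartFun (chartInv_mem_chartSource j p)).mdifferentiableAt (by simp))
    (chartFun_chartInv j)

theorem differentiableAt_transition {i j : Fin n} {p : Fin n → ℂ}
    (h : (chartInv i p : TautPow n k) ∈ chartSource j) :
    DifferentiableAt ℂ (fun y => chartFun j (chartInv i y : TautPow n k)) p := by
  have hs := ((chart i : OpenPartialHomeomorph (TautPow n k) _).symm.trans (chart j)).open_source
  refine ((contDiffOn_transition (k := k) i j 1).contDiffAt (hs.mem_nhds ?_)).differentiableAt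
    one_ne_zero
  rw [OpenPartialHomeomorph.trans_source]
  exact ⟨mem_univ _, h⟩

/-- The standard charts are holomorphic for the standard complex structure. -/
theorem tautDiff_chartInv_I (j : Fin n) (p v : Fin n → ℂ) :
    tautDiff (chartInv j : (Fin n → ℂ) → TautPow n k) p (Complex.I • v)
      = stdJ n k (chartInv j p) (tautDiff (chartInv j) p v) := by
  rw [tautDiff_eq_fderiv (mdifferentiableAt_chartInv j p),
    tautDiff_eq_fderiv (mdifferentiableAt_chartInv j p),
    (differentiableAt_transition (mem_chartSource_idx (chartInv j p))).fderiv_restrictScalars ℝ]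
  exact (fderiv ℂ (fun y => chartFun (chartInv j p : TautPow n k).idx
    (chartInv j y : TautPow n k)) p).map_smul Complex.I v

end TautPow

/-! ### Homogeneous coordinates -/

/-- The map `z ↦ (z_i / z_j, z_j ^ m)`; the power stands in the `j`-th place. For `m = k` it
is the standard chart in the coordinates `z`, for `m = -k` it is the chart of the compactification
in the coordinates `ξ`. -/
def lineCoord (j : Fin n) (m : ℤ) (z : Fin n → ℂ) : Fin n → ℂ :=
  Function.update (fun i => z i / z j) j (z j ^ m)

theorem hasStrictFDerivAt_lineCoord {j : Fin n} (m : ℤ) {z : Fin n → ℂ} (hz : z j ≠ 0) :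
    ∃ L : (Fin n → ℂ) →L[ℂ] (Fin n → ℂ), HasStrictFDerivAt (lineCoord j m) L z ∧
      ∀ v, L v = Function.update (fun i => (v i * z j - z i * v j) / z j ^ 2) j
        (m * z j ^ (m - 1) * v j) := by
  let P : Fin n → (Fin n → ℂ) →L[ℂ] ℂ := fun i => ContinuousLinearMap.proj i
  have hP : ∀ i, HasStrictFDerivAt (fun z : Fin n → ℂ => z i) (P i) z :=
    fun i => (P i).hasStrictFDerivAt
  refine ⟨ContinuousLinearMap.pi fun i => if i = j then (m * z j ^ (m - 1)) • P j
    else (z j ^ 2)⁻¹ • (z j • P i - z i • P j), ?_, ?_⟩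
  · refine hasStrictFDerivAt_pi'.2 fun i => ?_
    by_cases h : i = j
    · subst h
      have e : (fun x : Fin n → ℂ => lineCoord i m x i) = (fun y : ℂ => y ^ m) ∘ fun x => x i := by
        funext x; simp [lineCoord]
      rw [e]
      refine ((hasStrictDerivAt_zpow m (z i) (Or.inl hz)).comp_hasStrictFDerivAt z
        (hP i)).congr_fderiv ?_
      ext v; simp
    · have e : (fun x : Fin n → ℂ => lineCoord j m x i) = fun x => x i * (x j)⁻¹ := by
        funext x; simp [lineCoord, h, div_eq_mul_inv]
      rw [e]
      refine ((hP i).mul ((hasStrictDerivAt_inv hz).comp_hasStrictFDerivAt z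
        (hP j))).congr_fderiv ?_
      refine ContinuousLinearMap.ext fun v => ?_
      simp [h, P]
      field_simp
      ring
  · intro v
    ext i
    by_cases h : i = j
    · subst h; simp [P]
    · simp [h, P]
      field_simp

theorem lineCoord_diff_surjective {j : Fin n} {m : ℤ} (hm : m ≠ 0) {z : Fin n → ℂ} (hz : z j ≠ 0)
    (L : (Fin n → ℂ) →L[ℂ] (Fin n → ℂ))
    (hL : ∀ v, L v = Function.update (fun i => (v i * z j - z i * v j) / z j ^ 2) j
        (m * z j ^ (m - 1) * v j)) : Function.Surjective L := by
  refine (LinearMap.injective_iff_surjective (K := ℂ) (V := Fin n → ℂ)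
    (f := L.toLinearMap)).1 ?_
  refine (injective_iff_map_eq_zero _).2 fun v hv => ?_
  have h0 : L v = 0 := hv
  rw [hL] at h0
  have hj : v j = 0 := by
    have := congrFun h0 j
    simpa [hm, hz, zpow_ne_zero] using this
  funext i
  by_cases h : i = j
  · rw [h, hj]; rfl
  · have := congrFun h0 i
    simpa [h, hj, hz] using this

theorem exists_lineCoord_eq {j : Fin n} {m : ℤ} (hm : m ≠ 0) {p : Fin n → ℂ} (hp : p j ≠ 0) :
    ∃ z : Fin n → ℂ, z j ≠ 0 ∧ lineCoord j m z = p := by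
  have : ∃ c : ℂ, c ≠ 0 ∧ c ^ m = p j := by
    have hn : m.natAbs ≠ 0 := Int.natAbs_ne_zero.2 hm
    rcases Int.natAbs_eq m with h | h
    · obtain ⟨c, hc⟩ := IsAlgClosed.exists_pow_nat_eq (p j) (Nat.pos_of_ne_zero hn)
      refine ⟨c, ?_, ?_⟩
      · rintro rfl; rw [zero_pow hn] at hc; exact hp hc.symm
      · rw [h, zpow_natCast, hc]
    · obtain ⟨c, hc⟩ := IsAlgClosed.exists_pow_nat_eq (p j)⁻¹ (Nat.pos_of_ne_zero hn)
      refine ⟨c, ?_, ?_⟩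
      · rintro rfl; rw [zero_pow hn] at hc; exact inv_ne_zero hp hc.symm
      · rw [h, zpow_neg, zpow_natCast, hc, inv_inv]
  obtain ⟨c, hc0, hc⟩ := this
  refine ⟨c • Function.update p j 1, by simpa using hc0, ?_⟩
  funext i
  by_cases h : i = j
  · subst h; simp [lineCoord, hc]
  · simp [lineCoord, h, hc0]

theorem ne_zero_of_apply_ne {z : Fin n → ℂ} {j : Fin n} (hz : z j ≠ 0) : z ≠ 0 := by
  rintro rfl; exact hz rfl

variable [NeZero n]

theorem tensorPow_of_ne {z : Fin n → ℂ} (hz : z ≠ 0) :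
    tensorPow n k z = TautPow.mk ⟨(z, 1), hz⟩ := by
  rw [tensorPow, dif_pos hz]

theorem tensorPow_mem_chartSource {z : Fin n → ℂ} {j : Fin n} (hz : z j ≠ 0) :
    tensorPow n k z ∈ chartSource j := by
  rw [tensorPow_of_ne (ne_zero_of_apply_ne hz), mk_mem_chartSource]
  exact hz

theorem chartFun_tensorPow {z : Fin n → ℂ} {j : Fin n} (hz : z j ≠ 0) :
    chartFun j (tensorPow n k z) = lineCoord j k z := by
  rw [tensorPow_of_ne (ne_zero_of_apply_ne hz), chartFun_mk, lineCoord]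
  simp

theorem tensorPow_eq {z : Fin n → ℂ} {j : Fin n} (hz : z j ≠ 0) :
    tensorPow n k z = chartInv j (lineCoord j k z) := by
  rw [← chartFun_tensorPow hz, chartInv_chartFun (tensorPow_mem_chartSource hz)]

theorem tensorPow_eventuallyEq {z : Fin n → ℂ} {j : Fin n} (hz : z j ≠ 0) :
    tensorPow n k =ᶠ[𝓝 z] chartInv j ∘ lineCoord j k := by
  have : ∀ᶠ y in 𝓝 z, (y : Fin n → ℂ) j ≠ 0 :=
    (continuous_apply j).continuousAt.eventually_ne hz
  filter_upwards [this] with y hy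
  exact tensorPow_eq hy

theorem contMDiffAt_tensorPow {z : Fin n → ℂ} (hz : z ≠ 0) :
    ContMDiffAt 𝓘(ℝ, Fin n → ℂ) 𝓘(ℝ, Fin n → ℂ) ∞ (tensorPow n k) z := by
  obtain ⟨j, hj⟩ := Function.ne_iff.1 hz
  refine ContMDiffAt.congr_of_eventuallyEq ?_ (tensorPow_eventuallyEq hj)
  refine (contMDiff_chartInv j).contMDiffAt.comp z (ContDiffAt.contMDiffAt ?_)
  refine contDiffAt_pi.2 fun i => ?_
  have hc : ∀ i, ContDiffAt ℝ ∞ (fun y : Fin n → ℂ => y i) z :=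
    fun i => (contDiff_apply ℝ ℂ i).contDiffAt
  by_cases h : i = j
  · subst h
    simpa [lineCoord] using (hc i).pow k
  · simpa [lineCoord, h, div_eq_mul_inv] using (hc i).mul ((hc j).inv hj)

end Differentials

/-! ### Metrics on `𝒪(-k)` in the standard charts -/

section Metrics

open TautPow

variable {n k : ℕ}

theorem contDiff_pullMetric (g : TautMetric n k) (j : Fin n)
    {V W : (Fin n → ℂ) → (Fin n → ℂ)} (hV : ContDiff ℝ ∞ V) (hW : ContDiff ℝ ∞ W) :
    ContDiff ℝ ∞ fun p => g.inner (chartInv j p) (tautDiff (chartInv j) p (V p))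
      (tautDiff (chartInv j) p (W p)) := by
  let : RiemannianBundle (fun x : TautPow n k => TautTangent x) := ⟨g.toRiemannianMetric⟩
  have key : ∀ V : (Fin n → ℂ) → (Fin n → ℂ), ContDiff ℝ ∞ V →
      ContMDiff 𝓘(ℝ, Fin n → ℂ) (𝓘(ℝ, Fin n → ℂ).prod 𝓘(ℝ, Fin n → ℂ)) ∞
        (fun p => (⟨chartInv j p, tautDiff (chartInv j) p (V p)⟩ :
          TotalSpace (Fin n → ℂ) (fun x : TautPow n k => TautTangent x))) := by
    intro V hV
    have h1 := (contMDiff_chartInv (k := k) j).contMDiff_tangentMap (m := ∞) (by simp)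
    have h2 : ContMDiff 𝓘(ℝ, Fin n → ℂ) 𝓘(ℝ, Fin n → ℂ).tangent ∞
        (fun p => (⟨p, V p⟩ : TangentBundle 𝓘(ℝ, Fin n → ℂ) (Fin n → ℂ))) :=
      contMDiff_vectorSpace_iff_contDiff.2 hV
    exact h1.comp h2
  rw [← contMDiff_iff_contDiff]
  exact ContMDiff.inner_bundle (E := fun x : TautPow n k => TautTangent x) (key V hV) (key W hW)

set_option synthInstance.maxHeartbeats 400000 in
/-- The conformal metric `u² g`. -/
def conformalMetric (g : TautMetric n k) (u : TautPow n k → ℝ)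
    (hu : ContMDiff 𝓘(ℝ, Fin n → ℂ) 𝓘(ℝ, ℝ) ∞ u) (hpos : ∀ x, 0 < u x) : TautMetric n k where
  inner x := (u x ^ 2) • g.inner x
  symm x v w := by
    change u x ^ 2 * g.inner x v w = u x ^ 2 * g.inner x w v
    rw [g.symm]
  pos x v hv := mul_pos (pow_pos (hpos x) 2) (g.pos x v hv)
  isVonNBounded x := by
    have h := (g.isVonNBounded x).image ((u x)⁻¹ • ContinuousLinearMap.id ℝ (TautTangent x))
    refine Bornology.IsVonNBounded.subset ?_ h
    intro v hv
    refine ⟨u x • v, ?_, ?_⟩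
    · change g.inner x (u x • v) (u x • v) < 1
      have hv' : u x ^ 2 * g.inner x v v < 1 := hv
      rw [map_smul, map_smul, smul_apply, smul_eq_mul, smul_eq_mul]
      linarith
    · change (u x)⁻¹ • u x • v = v
      rw [smul_smul, inv_mul_cancel₀ (hpos x).ne', one_smul]
  contMDiff := (hu.pow 2).smul_section g.contMDiff

/-! ### The norm of the fibre coordinate -/

/-- The function on `𝒪(-k)` equal to `𝐳 ^ k` off the zero section: `|t|² 𝐳 ^ k` at the
element `t · z^{⊗k}`. -/
def fibreSq : TautPow n k → ℝ :=
  Quotient.lift (s := linePairSetoid n k)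
    (fun p : LinePair n => Complex.normSq p.1.2 * radSq p.1.1 ^ k) (by
    rintro p q ⟨μ, hμ, h1, h2⟩
    simp only [h1, h2, radSq_smul, map_mul, map_pow, mul_pow]
    ring)

theorem fibreSq_mk (p : LinePair n) :
    fibreSq (mk p : TautPow n k) = Complex.normSq p.1.2 * radSq p.1.1 ^ k := rfl

theorem continuous_fibreSq : Continuous (fibreSq : TautPow n k → ℝ) := by
  refine isQuotientMap_mk.continuous_iff.2 ?_
  have h := (contDiff_radSq (n := n) (m := 0)).continuous
  change Continuous fun p : LinePair n => Complex.normSq p.1.2 * radSq p.1.1 ^ k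
  exact (Complex.continuous_normSq.comp (by fun_prop)).mul ((h.comp (by fun_prop)).pow k)

theorem fibreSq_nonneg (x : TautPow n k) : 0 ≤ fibreSq x := by
  obtain ⟨p, rfl⟩ := isQuotientMap_mk.surjective x
  exact mul_nonneg (Complex.normSq_nonneg _) (pow_nonneg (radSq_nonneg _) _)

theorem fibreSq_chartInv (j : Fin n) (p : Fin n → ℂ) : fibreSq (chartInv j p : TautPow n k)
    = Complex.normSq (p j) * radSq (Function.update p j 1) ^ k := rfl

theorem radSq_update_pos (j : Fin n) (p : Fin n → ℂ) : 0 < radSq (Function.update p j 1) :=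
  radSq_pos.2 (update_one_ne_zero j p)

theorem fibreSq_chartInv_pos {j : Fin n} {p : Fin n → ℂ} :
    0 < fibreSq (chartInv j p : TautPow n k) ↔ p j ≠ 0 := by
  rw [fibreSq_chartInv, mul_pos_iff_of_pos_right (pow_pos (radSq_update_pos j p) k),
    Complex.normSq_pos]

theorem fibreSq_tensorPow [NeZero n] {z : Fin n → ℂ} (hz : z ≠ 0) :
    fibreSq (tensorPow n k z) = radSq z ^ k := by
  rw [tensorPow_of_ne hz, fibreSq_mk]
  simp

theorem exists_tensorPow_eq [NeZero n] (hk : k ≠ 0) {x : TautPow n k} (hx : fibreSq x ≠ 0) :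
    ∃ z : Fin n → ℂ, z ≠ 0 ∧ tensorPow n k z = x := by
  obtain ⟨j, hj⟩ := exists_mem_chartSource x
  rw [← chartInv_chartFun hj] at hx ⊢
  have h0 := fibreSq_chartInv_pos.1 (lt_of_le_of_ne (fibreSq_nonneg _) (Ne.symm hx))
  obtain ⟨z, hz, e⟩ := exists_lineCoord_eq (m := k) (by exact_mod_cast hk) h0
  exact ⟨z, ne_zero_of_apply_ne hz, by rw [tensorPow_eq hz, e]⟩

theorem tensorPow_eq_iff [NeZero n] {z w : Fin n → ℂ} (hz : z ≠ 0) (hw : w ≠ 0) (hk : k ≠ 0) :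
    tensorPow n k z = tensorPow n k w ↔ ∃ ζ : ℂ, ζ ^ k = 1 ∧ w = ζ • z := by
  rw [tensorPow_of_ne hz, tensorPow_of_ne hw, mk_eq_mk]
  constructor
  · rintro ⟨μ, -, h1, h2⟩
    exact ⟨μ, by simpa using h2.symm, h1⟩
  · rintro ⟨ζ, h1, h2⟩
    refine ⟨ζ, ?_, h2, by simp [h1]⟩
    rintro rfl
    rw [zero_pow hk] at h1
    exact zero_ne_one h1

/-! ### The pulled back metric -/

variable [NeZero n]

theorem tautDiff_tensorPow {j : Fin n} {z : Fin n → ℂ} (hz : z j ≠ 0) :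
    ∃ L : (Fin n → ℂ) →L[ℂ] (Fin n → ℂ),
      (∀ v, L v = Function.update (fun i => (v i * z j - z i * v j) / z j ^ 2) j
        ((k : ℤ) * z j ^ ((k : ℤ) - 1) * v j)) ∧
      (∀ (Om : ∀ x : TautPow n k, TautTangent x → TautTangent x → ℝ) (v w : Fin n → ℂ),
        pullForm Om (tensorPow n k) z v w
          = pullForm Om (chartInv j) (lineCoord j k z) (L v) (L w)) := by
  obtain ⟨L, hL, hv⟩ := hasStrictFDerivAt_lineCoord k hz
  refine ⟨L, by exact_mod_cast hv, fun Om v w => ?_⟩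
  have hd := hL.hasFDerivAt.restrictScalars ℝ
  rw [pullForm_congr Om (tensorPow_eventuallyEq hz),
    pullForm_comp Om (mdifferentiableAt_chartInv j _) hd.differentiableAt, hd.fderiv]
  rfl

/-- On `ℂⁿ ∖ {0}` the metric is expressed through the first two derivatives of the potential. -/
theorem metric_tensorPow {g : TautMetric n k} {φ : ℝ → ℝ} (hg : ArisesFrom g φ)
    {z : Fin n → ℂ} (hz : z ≠ 0) (v w : Fin n → ℂ) :
    pullForm (fun x v w => g.inner x v w) (tensorPow n k) z v w
      = radForm (deriv φ (radSq z)) (deriv (deriv φ) (radSq z)) z (-(Complex.I • v)) w := by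
  rw [← ddbar_pot hg.1 hz, ← hg.2 z hz]
  obtain ⟨j, hj⟩ := Function.ne_iff.1 hz
  obtain ⟨L, -, hL⟩ := tautDiff_tensorPow (k := k) hj
  rw [hL, hL, pullForm, pullForm, fundamentalForm, ← tautDiff_chartInv_I, map_neg, map_smul,
    smul_neg, I_smul_I_smul, neg_neg]

theorem metric_tensorPow_horizontal {g : TautMetric n k} {φ : ℝ → ℝ} (hg : ArisesFrom g φ)
    {z : Fin n → ℂ} (hz : z ≠ 0) {v : Fin n → ℂ} (h1 : rin z v = 0)
    (h2 : rin z (Complex.I • v) = 0) :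
    pullForm (fun x v w => g.inner x v w) (tensorPow n k) z v v
      = 2 * deriv φ (radSq z) * radSq v := by
  rw [metric_tensorPow hg hz, radForm, smul_neg, I_smul_I_smul, neg_neg, h1, h2, rin_self]
  ring

theorem rin_single {n : ℕ} (z : Fin n → ℂ) (i : Fin n) (a : ℂ) :
    rin z (Pi.single i a) = (z i).re * a.re + (z i).im * a.im := by
  rw [rin_apply, Finset.sum_eq_single i]
  · simp
  · intro l _ hl; simp [hl]
  · simp

/-! ### The momentum function `𝐳 φ'(𝐳)` and its extension across the zero section -/

/-- A vector field in the `j`-th chart which is tangent to the level sets of `fibreSq` and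
orthogonal to the fibres, and whose `i`-th coordinate does not vanish. -/
def horizontal {n : ℕ} (k : ℕ) (j i : Fin n) (p : Fin n → ℂ) : Fin n → ℂ :=
  Function.update (fun l => (if l = i then 1 else 0) + p l * starRingEnd ℂ (p i)) j
    (-(k * p j * starRingEnd ℂ (p i)))

theorem contDiff_horizontal {n : ℕ} (k : ℕ) (j i : Fin n) : ContDiff ℝ ∞ (horizontal k j i) := by
  have hc : ∀ l, ContDiff ℝ ∞ (fun p : Fin n → ℂ => p l) := fun l => contDiff_apply ℝ ℂ l
  have hb : ContDiff ℝ ∞ (fun p : Fin n → ℂ => starRingEnd ℂ (p i)) :=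
    Complex.conjCLE.contDiff.comp (hc i)
  refine contDiff_pi.2 fun l => ?_
  by_cases h : l = j
  · subst h
    simpa [horizontal] using ((contDiff_const.mul (hc l)).mul hb).neg
  · simpa [horizontal, h] using contDiff_const.add ((hc l).mul hb)

theorem horizontal_ne_zero {n : ℕ} (k : ℕ) {j i : Fin n} (hij : i ≠ j) (p : Fin n → ℂ) :
    horizontal k j i p ≠ 0 := by
  intro h
  have h1 := congrFun h i
  simp only [horizontal, Function.update_of_ne hij, if_true, Pi.zero_apply, Complex.mul_conj] at h1
  have h2 := congrArg Complex.re h1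
  simp only [Complex.add_re, Complex.one_re, Complex.ofReal_re, Complex.zero_re] at h2
  have := Complex.normSq_nonneg (p i)
  linarith

/-- The function `𝐳 φ'(𝐳)` in the `j`-th chart, computed from the length of a horizontal vector
field. -/
def chartMoment (g : TautMetric n k) (j i : Fin n) (p : Fin n → ℂ) : ℝ :=
  pullForm (fun x v w => g.inner x v w) (chartInv j) p (horizontal k j i p) (horizontal k j i p)
    * (radSq (Function.update p j 1) * (2 * (1 + Complex.normSq (p i)))⁻¹)

omit [NeZero n] in
theorem contDiff_chartMoment (g : TautMetric n k) (j i : Fin n) :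
    ContDiff ℝ ∞ (chartMoment g j i) := by
  have hc : ∀ l, ContDiff ℝ ∞ (fun p : Fin n → ℂ => p l) := fun l => contDiff_apply ℝ ℂ l
  refine (contDiff_pullMetric g j (contDiff_horizontal k j i)
    (contDiff_horizontal k j i)).mul (ContDiff.mul (contDiff_radSq.comp ?_) (ContDiff.inv ?_ ?_))
  · refine contDiff_pi.2 fun l => ?_
    by_cases h : l = j
    · subst h; simpa using contDiff_const
    · simpa [h] using hc l
  · refine contDiff_const.mul (contDiff_const.add ?_)
    simp only [Complex.normSq_apply]
    have h1 := Complex.reCLM.contDiff.comp (hc i)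
    have h2 := Complex.imCLM.contDiff.comp (hc i)
    exact (h1.mul h1).add (h2.mul h2)
  · intro p
    have := Complex.normSq_nonneg (p i)
    positivity

omit [NeZero n] in
theorem chartMoment_pos (g : TautMetric n k) {j i : Fin n} (hij : i ≠ j) (p : Fin n → ℂ) :
    0 < chartMoment g j i p := by
  have h1 := radSq_update_pos j p
  have h2 := Complex.normSq_nonneg (p i)
  refine mul_pos (g.pos _ _ ?_) (by positivity)
  intro h
  refine horizontal_ne_zero k hij p ((bijective_tautDiff_chartInv (k := k) j p).1 ?_)
  rw [h]
  exact (ContinuousLinearMap.map_zero (mfderiv 𝓘(ℝ, Fin n → ℂ) 𝓘(ℝ, Fin n → ℂ)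
    (chartInv j : _ → TautPow n k) p)).symm

theorem chartMoment_lineCoord {g : TautMetric n k} {φ : ℝ → ℝ} (hg : ArisesFrom g φ)
    {j i : Fin n} (hij : i ≠ j) {z : Fin n → ℂ} (hz : z j ≠ 0) :
    chartMoment g j i (lineCoord j k z) = radSq z * deriv φ (radSq z) := by
  have hz0 := ne_zero_of_apply_ne hz
  obtain ⟨L, hLv, hL⟩ := tautDiff_tensorPow (k := k) hz
  have hzc : starRingEnd ℂ (z j) ≠ 0 := by simpa using hz
  set b : ℂ := -(z j * starRingEnd ℂ (z i) / starRingEnd ℂ (z j)) with hb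
  set v : Fin n → ℂ := Pi.single i (z j) + Pi.single j b with hv
  have hLv' : L v = horizontal k j i (lineCoord j k z) := by
    rw [hLv]
    funext l
    by_cases h : l = j
    · subst h
      simp only [Function.update_self, horizontal, lineCoord, Function.update_of_ne hij, hv,
        Pi.add_apply, Pi.single_apply, hij.symm, if_false, if_true, map_div₀, zero_add, hb]
      rw [zpow_sub_one₀ hz]
      field_simp
      push_cast
      ring
    · by_cases h' : l = i
      · subst h'
        simp only [horizontal, lineCoord, Function.update_of_ne h, hv,
          Pi.add_apply, Pi.single_apply, h, hij.symm, if_false, if_true, map_div₀, hb]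
        field_simp
        ring
      · simp only [horizontal, lineCoord, Function.update_of_ne h, Function.update_of_ne hij, hv,
          Pi.add_apply, Pi.single_apply, h, h', hij.symm, if_false, if_true, map_div₀, hb]
        field_simp
        ring
  have hbz : (z j).re * b.re + (z j).im * b.im = - ((z i).re * (z j).re + (z i).im * (z j).im)
      ∧ (z j).re * b.im - (z j).im * b.re = - ((z i).re * (z j).im - (z i).im * (z j).re) := by
    have : starRingEnd ℂ (z j) * b = - (z j * starRingEnd ℂ (z i)) := by
      rw [hb]; field_simp
    have h1 := congrArg Complex.re this
    have h2 := congrArg Complex.im this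
    simp at h1 h2
    constructor <;> linarith
  have hnb : Complex.normSq b = Complex.normSq (z i) := by
    rw [hb, Complex.normSq_neg, Complex.normSq_div, Complex.normSq_mul, Complex.normSq_conj,
      Complex.normSq_conj]
    have := (Complex.normSq_pos.2 hz).ne'
    field_simp
  have h1 : rin z v = 0 := by
    rw [hv, map_add, rin_single, rin_single]
    linarith [hbz.1]
  have h2 : rin z (Complex.I • v) = 0 := by
    rw [hv, smul_add, ← Pi.single_smul, ← Pi.single_smul, map_add, rin_single, rin_single]
    simp only [smul_eq_mul, Complex.mul_re, Complex.mul_im, Complex.I_re, Complex.I_im]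
    linarith [hbz.2]
  have h3 : radSq v = Complex.normSq (z i) + Complex.normSq (z j) := by
    rw [← rin_self, hv, map_add, rin_single, rin_single, Pi.add_apply, Pi.add_apply,
      Pi.single_eq_same, Pi.single_eq_same, Pi.single_eq_of_ne hij, Pi.single_eq_of_ne hij.symm,
      ← hnb, Complex.normSq_apply, Complex.normSq_apply]
    simp only [add_zero, zero_add]
    ring
  have h4 : Function.update (lineCoord j k z) j 1 = (z j)⁻¹ • z := by
    funext l
    by_cases h : l = j
    · subst h; simp [hz]
    · simp [h, lineCoord, div_eq_inv_mul]
  have h5 : lineCoord j k z i = z i / z j := by simp [lineCoord, hij]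
  rw [chartMoment, ← hLv', ← hL, metric_tensorPow_horizontal hg hz0 h1 h2, h3, h4, radSq_smul, h5,
    Complex.normSq_div, Complex.normSq_inv]
  have := Complex.normSq_pos.2 hz
  have := Complex.normSq_nonneg (z i)
  field_simp
  ring

theorem chartMoment_eq {g : TautMetric n k} {φ : ℝ → ℝ} (hg : ArisesFrom g φ) (hk : k ≠ 0)
    {j i : Fin n} (hij : i ≠ j) {p : Fin n → ℂ} {s : ℝ} (hs : 0 < s)
    (hsp : s ^ k = fibreSq (chartInv j p : TautPow n k)) :
    chartMoment g j i p = s * deriv φ s := by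
  have hp : p j ≠ 0 := by
    rw [← fibreSq_chartInv_pos (k := k), ← hsp]; positivity
  obtain ⟨z, hz, rfl⟩ := exists_lineCoord_eq (m := k) (by exact_mod_cast hk) hp
  rw [← tensorPow_eq hz, fibreSq_tensorPow (ne_zero_of_apply_ne hz)] at hsp
  rw [chartMoment_lineCoord hg hij hz, (pow_left_inj₀ hs.le (radSq_nonneg z) hk).1 hsp]

/-- The extension of the function `𝐳 φ'(𝐳)` to `𝒪(-k)`. On the zero section it is defined as a limit,
which exists under the assumptions of `contMDiff_moment`. -/
def moment (k : ℕ) (φ : ℝ → ℝ) (x : TautPow n k) : ℝ :=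
  if fibreSq x = 0 then limUnder (𝓝[>] 0) (fun s => s * deriv φ s)
  else fibreSq x ^ (k : ℝ)⁻¹ * deriv φ (fibreSq x ^ (k : ℝ)⁻¹)

theorem moment_chartInv {g : TautMetric n k} {φ : ℝ → ℝ} (hg : ArisesFrom g φ) (hk : k ≠ 0)
    {j i : Fin n} (hij : i ≠ j) (p : Fin n → ℂ) :
    moment k φ (chartInv j p) = chartMoment g j i p := by
  by_cases h : p j = 0
  · have h0 : fibreSq (chartInv j p : TautPow n k) = 0 := by simp [fibreSq_chartInv, h]
    rw [moment, if_pos h0]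
    refine Tendsto.limUnder_eq ?_
    -- The fibre through `p` is parametrized by the value `s` of `𝐳`.
    set ρ := radSq (Function.update p j 1) with hρ
    have hρ0 : 0 < ρ := radSq_update_pos j p
    set c : ℝ → (Fin n → ℂ) := fun s => Function.update p j ((√(s ^ k / ρ ^ k) : ℝ) : ℂ) with hc
    have hc0 : c 0 = p := by
      rw [hc]
      simp only [zero_pow hk, zero_div, Real.sqrt_zero, Complex.ofReal_zero, ← h,
        Function.update_eq_self]
    have hcc : Continuous c := by
      refine Continuous.update continuous_const j ?_
      fun_prop
    have hlim : Tendsto (fun s => chartMoment g j i (c s)) (𝓝[>] 0) (𝓝 (chartMoment g j i p)) := by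
      have := ((contDiff_chartMoment g j i).continuous.comp hcc).tendsto 0
      rw [Function.comp_apply, hc0] at this
      exact this.mono_left nhdsWithin_le_nhds
    refine hlim.congr' ?_
    filter_upwards [self_mem_nhdsWithin] with s hs
    have hs' : (0 : ℝ) < s := hs
    refine chartMoment_eq hg hk hij hs' ?_
    rw [fibreSq_chartInv, hc]
    simp only [Function.update_self, Function.update_idem, ← hρ, Complex.normSq_ofReal]
    rw [Real.mul_self_sqrt (by positivity)]
    field_simp
  · have h0 := (fibreSq_chartInv_pos (k := k) (j := j)).2 h
    rw [moment, if_neg h0.ne', chartMoment_eq hg hk hij (Real.rpow_pos_of_pos h0 _)]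
    rw [← Real.rpow_natCast, ← Real.rpow_mul h0.le, inv_mul_cancel₀ (by exact_mod_cast hk),
      Real.rpow_one]

omit [NeZero n] in
theorem moment_eq {φ : ℝ → ℝ} (hk : k ≠ 0) {x : TautPow n k} {s : ℝ} (hs : 0 < s)
    (hx : fibreSq x = s ^ k) : moment k φ x = s * deriv φ s := by
  have e : fibreSq x ^ (k : ℝ)⁻¹ = s := by
    rw [hx, Real.pow_rpow_inv_natCast hs.le hk]
  rw [moment, if_neg (by rw [hx]; positivity), e]

omit [NeZero n] in
theorem exists_ne_index (hn : 2 ≤ n) (j : Fin n) : ∃ i : Fin n, i ≠ j := by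
  have : Nontrivial (Fin n) := Fin.nontrivial_iff_two_le.2 hn
  exact exists_ne j

theorem contMDiff_moment {g : TautMetric n k} {φ : ℝ → ℝ} (hg : ArisesFrom g φ) (hk : k ≠ 0)
    (hn : 2 ≤ n) : ContMDiff 𝓘(ℝ, Fin n → ℂ) 𝓘(ℝ, ℝ) ∞ (moment k φ : TautPow n k → ℝ) := by
  intro x
  obtain ⟨j, hj⟩ := exists_mem_chartSource x
  obtain ⟨i, hij⟩ := exists_ne_index hn j
  have h := (contDiff_chartMoment g j i).contMDiff.contMDiffAt.comp x (contMDiffAt_chartFun hj)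
  refine h.congr_of_eventuallyEq ?_
  filter_upwards [(isOpen_chartSource j).mem_nhds hj] with y hy
  rw [Function.comp_apply, ← moment_chartInv hg hk hij, chartInv_chartFun hy]

theorem moment_pos {g : TautMetric n k} {φ : ℝ → ℝ} (hg : ArisesFrom g φ) (hk : k ≠ 0)
    (hn : 2 ≤ n) (x : TautPow n k) : 0 < moment k φ x := by
  obtain ⟨j, hj⟩ := exists_mem_chartSource x
  obtain ⟨i, hij⟩ := exists_ne_index hn j
  rw [← chartInv_chartFun hj, moment_chartInv hg hk hij]
  exact chartMoment_pos g hij _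

theorem deriv_pot_pos {g : TautMetric n k} {φ : ℝ → ℝ} (hg : ArisesFrom g φ) (hk : k ≠ 0)
    (hn : 2 ≤ n) {s : ℝ} (hs : 0 < s) : 0 < deriv φ s := by
  set z : Fin n → ℂ := Pi.single 0 ((√s : ℝ) : ℂ) with hz
  have h1 : radSq z = s := by
    rw [← rin_self, hz, rin_single]
    simp [Real.mul_self_sqrt hs.le]
  have h2 : z ≠ 0 := radSq_pos.1 (h1 ▸ hs)
  have h3 := moment_pos hg hk hn (tensorPow n k z)
  rw [moment_eq hk hs (by rw [fibreSq_tensorPow h2, h1])] at h3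
  exact (mul_pos_iff_of_pos_left hs).1 h3

end Metrics

/-! ### The complex structure of the compactification -/

section HatStructure

open TautPow

variable {n k : ℕ}

theorem contDiff_radSq_update (j : Fin n) :
    ContDiff ℝ ∞ fun q : Fin n → ℂ => radSq (Function.update q j 1) := by
  refine contDiff_radSq.comp (contDiff_pi.2 fun l => ?_)
  by_cases h : l = j
  · subst h; simpa using contDiff_const
  · simpa [h] using contDiff_apply ℝ ℂ l

/-- The change of coordinates from the `j`-th chart of the compactification, with fibre
coordinate `ξ_j ^ (-k)`, to the `j`-th standard chart, with fibre coordinate `z_j ^ k`. It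
conjugates the fibres. -/
def fromHat (k : ℕ) (j : Fin n) (q : Fin n → ℂ) : Fin n → ℂ :=
  Function.update q j (starRingEnd ℂ (q j) * (((radSq (Function.update q j 1) ^ k)⁻¹ : ℝ) : ℂ))

/-- The inverse of `fromHat`. -/
def toHat (k : ℕ) (j : Fin n) (p : Fin n → ℂ) : Fin n → ℂ :=
  Function.update p j (starRingEnd ℂ (p j) * ((radSq (Function.update p j 1) ^ k : ℝ) : ℂ))

theorem contDiff_update_conj_mul (j : Fin n) {r : (Fin n → ℂ) → ℝ} (hr : ContDiff ℝ ∞ r) :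
    ContDiff ℝ ∞ fun q : Fin n → ℂ =>
      Function.update q j (starRingEnd ℂ (q j) * ((r q : ℝ) : ℂ)) := by
  refine contDiff_pi.2 fun l => ?_
  by_cases h : l = j
  · subst h
    simp only [Function.update_self]
    exact (Complex.conjCLE.contDiff.comp (contDiff_apply ℝ ℂ l)).mul
      (Complex.ofRealCLM.contDiff.comp hr)
  · simpa [h] using contDiff_apply ℝ ℂ l

theorem contDiff_fromHat (k : ℕ) (j : Fin n) : ContDiff ℝ ∞ (fromHat k j) :=
  contDiff_update_conj_mul j (((contDiff_radSq_update j).pow k).inv fun q =>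
    (pow_pos (radSq_update_pos j q) k).ne')

theorem contDiff_toHat (k : ℕ) (j : Fin n) : ContDiff ℝ ∞ (toHat k j) :=
  contDiff_update_conj_mul j ((contDiff_radSq_update j).pow k)

theorem fromHat_toHat (k : ℕ) (j : Fin n) (p : Fin n → ℂ) : fromHat k j (toHat k j p) = p := by
  have h := (pow_pos (radSq_update_pos j p) k).ne'
  rw [fromHat, toHat]
  simp only [Function.update_idem, Function.update_self, map_mul, Complex.conj_conj,
    Complex.conj_ofReal]
  rw [mul_assoc, ← Complex.ofReal_mul, mul_inv_cancel₀ h, Complex.ofReal_one, mul_one,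
    Function.update_eq_self]

theorem toHat_fromHat (k : ℕ) (j : Fin n) (q : Fin n → ℂ) : toHat k j (fromHat k j q) = q := by
  have h := (pow_pos (radSq_update_pos j q) k).ne'
  rw [fromHat, toHat]
  simp only [Function.update_idem, Function.update_self, map_mul, Complex.conj_conj,
    Complex.conj_ofReal]
  rw [mul_assoc, ← Complex.ofReal_mul, inv_mul_cancel₀ h, Complex.ofReal_one, mul_one,
    Function.update_eq_self]

theorem differentiableAt_fromHat (k : ℕ) (j : Fin n) (q : Fin n → ℂ) :
    DifferentiableAt ℝ (fromHat k j) q :=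
  (contDiff_fromHat k j).differentiable (by simp) q

theorem differentiableAt_toHat (k : ℕ) (j : Fin n) (q : Fin n → ℂ) :
    DifferentiableAt ℝ (toHat k j) q :=
  (contDiff_toHat k j).differentiable (by simp) q

theorem fderiv_toHat_fromHat (k : ℕ) (j : Fin n) (q v : Fin n → ℂ) :
    fderiv ℝ (toHat k j) (fromHat k j q) (fderiv ℝ (fromHat k j) q v) = v := by
  have h := fderiv_comp q (differentiableAt_toHat k j (fromHat k j q))
    (differentiableAt_fromHat k j q)
  rw [show toHat k j ∘ fromHat k j = id from funext (toHat_fromHat k j), fderiv_id] at h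
  exact (DFunLike.congr_fun h v).symm

theorem fderiv_fromHat_toHat (k : ℕ) (j : Fin n) (p v : Fin n → ℂ) :
    fderiv ℝ (fromHat k j) (toHat k j p) (fderiv ℝ (toHat k j) p v) = v := by
  have h := fderiv_comp p (differentiableAt_fromHat k j (toHat k j p))
    (differentiableAt_toHat k j p)
  rw [show fromHat k j ∘ toHat k j = id from funext (fromHat_toHat k j), fderiv_id] at h
  exact (DFunLike.congr_fun h v).symm

/-- The parametrization of the points over `{z_j ≠ 0}` by the `j`-th holomorphic coordinates of
the compactification. -/
def hatChartInv (k : ℕ) (j : Fin n) (q : Fin n → ℂ) : TautPow n k := chartInv j (fromHat k j q)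

/-- The complex structure of the compactification. In the standard chart preferred at a point,
it is multiplication by `i` transported by `fromHat`; since the transitions between the
parametrizations `hatChartInv` are holomorphic, it does not depend on this choice. -/
def hatJ (n k : ℕ) : TautEndo n k := fun x =>
  (((fderiv ℝ (fromHat k x.idx) (toHat k x.idx (chartFun x.idx x))).comp
    (Complex.I • ContinuousLinearMap.id ℝ (Fin n → ℂ))).comp
      (fderiv ℝ (toHat k x.idx) (chartFun x.idx x)) : (Fin n → ℂ) →L[ℝ] (Fin n → ℂ))

theorem contMDiff_hatChartInv (k : ℕ) (j : Fin n) :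
    ContMDiff 𝓘(ℝ, Fin n → ℂ) 𝓘(ℝ, Fin n → ℂ) ∞ (hatChartInv k j) :=
  (contMDiff_chartInv j).comp (contDiff_fromHat k j).contMDiff

theorem mdifferentiableAt_hatChartInv (k : ℕ) (j : Fin n) (q : Fin n → ℂ) :
    MDifferentiableAt 𝓘(ℝ, Fin n → ℂ) 𝓘(ℝ, Fin n → ℂ) (hatChartInv k j) q :=
  (contMDiff_hatChartInv k j q).mdifferentiableAt (by simp)

theorem tautDiff_hatChartInv (j : Fin n) (q v : Fin n → ℂ) :
    tautDiff (hatChartInv k j) q v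
      = tautDiff (chartInv j) (fromHat k j q) (fderiv ℝ (fromHat k j) q v) :=
  tautDiff_comp (mdifferentiableAt_chartInv j _) (differentiableAt_fromHat k j q) v

theorem bijective_tautDiff_hatChartInv (j : Fin n) (q : Fin n → ℂ) :
    Function.Bijective (tautDiff (hatChartInv k j) q) := by
  have h := bijective_tautDiff_chartInv (k := k) j (fromHat k j q)
  have e : tautDiff (hatChartInv k j) q
      = tautDiff (chartInv j) (fromHat k j q) ∘ fderiv ℝ (fromHat k j) q :=
    funext (tautDiff_hatChartInv j q)
  rw [e]
  refine h.comp ⟨fun v w hvw => ?_, fun v => ⟨fderiv ℝ (toHat k j) (fromHat k j q) v, ?_⟩⟩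
  · rw [← fderiv_toHat_fromHat k j q v, hvw, fderiv_toHat_fromHat]
  · have := fderiv_fromHat_toHat k j (fromHat k j q) v
    rwa [toHat_fromHat] at this

/-- The transitions between the hat charts are those of `𝒪(k)`. -/
theorem hat_transition {i j : Fin n} {q : Fin n → ℂ}
    (h : (hatChartInv k j q) ∈ chartSource i) :
    toHat k i (chartFun i (hatChartInv k j q))
      = Function.update (fun l => Function.update q j 1 l / Function.update q j 1 i) i
          (q j / Function.update q j 1 i ^ k) := by
  set W : Fin n → ℂ := Function.update q j 1 with hW
  have hWi : W i ≠ 0 := by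
    have := mk_mem_chartSource.1 h
    simpa [fromHat, hW] using this
  have e0 : hatChartInv k j q = mk ⟨(W, starRingEnd ℂ (q j) * (((radSq W ^ k)⁻¹ : ℝ) : ℂ)),
      update_one_ne_zero j q⟩ := by
    simp only [hatChartInv, chartInv, fromHat, Function.update_idem, Function.update_self, ← hW]
  have e1 : Function.update (fun l => W l / W i) i 1 = (W i)⁻¹ • W := by
    funext l
    by_cases h : l = i
    · subst h; simp [hWi]
    · simp [h, div_eq_inv_mul]
  rw [e0, chartFun_mk, toHat]
  simp only [Function.update_idem, Function.update_self, e1, radSq_smul]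
  congr 1
  have hR : (radSq W : ℂ) ≠ 0 := by
    exact_mod_cast (radSq_update_pos j q).ne'
  have hn : ((Complex.normSq (W i) : ℝ) : ℂ) = W i * starRingEnd ℂ (W i) := by
    rw [Complex.mul_conj]
  have hc : starRingEnd ℂ (W i) ≠ 0 := by simpa using hWi
  simp only [map_mul, Complex.conj_conj, Complex.conj_ofReal, map_pow, Complex.normSq_inv]
  push_cast
  rw [hn]
  field_simp
  rw [div_pow, mul_pow]
  field_simp

theorem differentiableAt_hat_transition {i j : Fin n} {q : Fin n → ℂ}
    (h : (hatChartInv k j q) ∈ chartSource i) :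
    DifferentiableAt ℂ (fun q => toHat k i (chartFun i (hatChartInv k j q))) q := by
  have hWi : Function.update q j 1 i ≠ 0 := by
    have := mk_mem_chartSource.1 h
    simpa [fromHat] using this
  have hev : ∀ᶠ y in 𝓝 q, hatChartInv k j y ∈ chartSource i :=
    (contMDiff_hatChartInv k j).continuous.continuousAt.eventually
      ((isOpen_chartSource i).mem_nhds h)
  refine DifferentiableAt.congr_of_eventuallyEq ?_ (hev.mono fun y hy => hat_transition hy)
  have hu : ∀ l, DifferentiableAt ℂ (fun y : Fin n → ℂ => Function.update y j 1 l) q := by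
    intro l
    by_cases h : l = j
    · subst h; simp
    · simpa [h] using differentiableAt_apply l q
  refine differentiableAt_pi.2 fun l => ?_
  by_cases hl : l = i
  · subst hl
    simp only [Function.update_self, div_eq_mul_inv]
    exact (differentiableAt_apply j q).fun_mul
      ((differentiableAt_inv (pow_ne_zero k hWi)).comp q ((hu l).fun_pow k))
  · simp only [Function.update_of_ne hl, div_eq_mul_inv]
    exact (hu l).fun_mul ((differentiableAt_inv hWi).comp q (hu i))

theorem hatJ_hatChartInv (j : Fin n) (q v : Fin n → ℂ) :
    tautDiff (hatChartInv k j) q (Complex.I • v)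
      = hatJ n k (hatChartInv k j q) (tautDiff (hatChartInv k j) q v) := by
  set x := hatChartInv k j q with hx
  set T : (Fin n → ℂ) → (Fin n → ℂ) := fun y => toHat k x.idx (chartFun x.idx (hatChartInv k j y))
    with hT
  have hTd : DifferentiableAt ℂ T q := differentiableAt_hat_transition (mem_chartSource_idx x)
  have hTq : T q = toHat k x.idx (chartFun x.idx x) := rfl
  have e : (fun y => chartFun x.idx (hatChartInv k j y)) = fromHat k x.idx ∘ T := by
    funext y; simp only [hT, Function.comp_apply, fromHat_toHat]
  have hd : ∀ v, tautDiff (hatChartInv k j) q v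
      = fderiv ℝ (fromHat k x.idx) (T q) (fderiv ℂ T q v) := by
    intro v
    rw [tautDiff_eq_fderiv (mdifferentiableAt_hatChartInv k j q), ← hx, e,
      fderiv_comp q (differentiableAt_fromHat _ _ _) (hTd.restrictScalars ℝ),
      hTd.fderiv_restrictScalars ℝ]
    rfl
  have hp : chartFun x.idx x = fromHat k x.idx (T q) := by rw [hTq, fromHat_toHat]
  rw [hd, hd]
  change _ = fderiv ℝ (fromHat k x.idx) (toHat k x.idx (chartFun x.idx x))
    (Complex.I • fderiv ℝ (toHat k x.idx) (chartFun x.idx x)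
      (fderiv ℝ (fromHat k x.idx) (T q) (fderiv ℂ T q v)))
  rw [hp, fderiv_toHat_fromHat, toHat_fromHat, map_smul]

theorem exists_hatChartInv_eq (x : TautPow n k) : ∃ j q, hatChartInv k j q = x := by
  obtain ⟨j, hj⟩ := exists_mem_chartSource x
  exact ⟨j, toHat k j (chartFun j x), by rw [hatChartInv, fromHat_toHat, chartInv_chartFun hj]⟩

theorem isComplexStructure_hatJ : IsComplexStructure (hatJ n k) := by
  intro x
  obtain ⟨j, q, rfl⟩ := exists_hatChartInv_eq x
  exact ⟨univ, hatChartInv k j, isOpen_univ, mem_image_of_mem _ (mem_univ q),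
    (contMDiff_hatChartInv k j).contMDiffOn, fun y _ =>
      ⟨bijective_tautDiff_hatChartInv j y, fun v => hatJ_hatChartInv j y v⟩⟩

theorem hatJ_hatJ (x : TautPow n k) (v : TautTangent x) :
    hatJ n k x (hatJ n k x v) = -v := by
  obtain ⟨j, q, rfl⟩ := exists_hatChartInv_eq x
  obtain ⟨a, rfl⟩ := (bijective_tautDiff_hatChartInv j q).2 v
  rw [← hatJ_hatChartInv, ← hatJ_hatChartInv, I_smul_I_smul]
  exact ContinuousLinearMap.map_neg (mfderiv 𝓘(ℝ, Fin n → ℂ) 𝓘(ℝ, Fin n → ℂ)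
    (hatChartInv k j) q) a

/-! ### The coordinates at infinity -/

variable [NeZero n]

omit [NeZero n] in
theorem fromHat_lineCoord {j : Fin n} {ξ : Fin n → ℂ} (hξ : ξ j ≠ 0) :
    fromHat k j (lineCoord j (-k) ξ) = lineCoord j k (radInv ξ) := by
  have h0 := (radSq_pos.2 (ne_zero_of_apply_ne hξ)).ne'
  have h1 : (radSq ξ : ℂ) ≠ 0 := by exact_mod_cast h0
  have e : Function.update (lineCoord j (-k) ξ) j 1 = (ξ j)⁻¹ • ξ := by
    funext l
    by_cases h : l = j
    · subst h; simp [hξ]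
    · simp [h, lineCoord, div_eq_inv_mul]
  rw [fromHat, e, radSq_smul]
  funext l
  by_cases h : l = j
  · subst h
    have hn : ((Complex.normSq (ξ l) : ℝ) : ℂ) = ξ l * starRingEnd ℂ (ξ l) := by
      rw [Complex.mul_conj]
    have hc : starRingEnd ℂ (ξ l) ≠ 0 := by simpa using hξ
    simp only [lineCoord, Function.update_self, radInv, Pi.smul_apply, smul_eq_mul, zpow_natCast,
      zpow_neg, map_inv₀, map_pow]
    push_cast
    rw [hn]
    field_simp
    rw [div_pow, mul_pow]
    field_simp
    rw [div_pow]
    field_simp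
  · simp only [lineCoord, Function.update_of_ne h, radInv, Pi.smul_apply, smul_eq_mul]
    push_cast
    field_simp

omit [NeZero n] in
theorem radInv_apply_ne {j : Fin n} {ξ : Fin n → ℂ} (hξ : ξ j ≠ 0) : radInv ξ j ≠ 0 := by
  have h0 := (radSq_pos.2 (ne_zero_of_apply_ne hξ)).ne'
  simp [radInv, hξ, h0]

theorem xiMap_eq {j : Fin n} {ξ : Fin n → ℂ} (hξ : ξ j ≠ 0) :
    xiMap n k ξ = hatChartInv k j (lineCoord j (-k) ξ) := by
  rw [hatChartInv, fromHat_lineCoord hξ, xiMap, tensorPow_eq (radInv_apply_ne hξ)]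

theorem xiMap_eventuallyEq {j : Fin n} {ξ : Fin n → ℂ} (hξ : ξ j ≠ 0) :
    xiMap n k =ᶠ[𝓝 ξ] hatChartInv k j ∘ lineCoord j (-k) := by
  have : ∀ᶠ y in 𝓝 ξ, (y : Fin n → ℂ) j ≠ 0 :=
    (continuous_apply j).continuousAt.eventually_ne hξ
  filter_upwards [this] with y hy
  exact xiMap_eq hy

theorem tautDiff_xiMap {j : Fin n} {ξ : Fin n → ℂ} (hξ : ξ j ≠ 0) :
    ∃ L : (Fin n → ℂ) →L[ℂ] (Fin n → ℂ), HasStrictFDerivAt (lineCoord j (-k)) L ξ ∧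
      ∀ v, (tautDiff (xiMap n k) ξ v : Fin n → ℂ)
        = tautDiff (hatChartInv k j) (lineCoord j (-k) ξ) (L v) := by
  obtain ⟨L, hL, -⟩ := hasStrictFDerivAt_lineCoord (-k : ℤ) hξ
  refine ⟨L, hL, fun v => ?_⟩
  have hd := hL.hasFDerivAt.restrictScalars ℝ
  rw [tautDiff_congr (xiMap_eventuallyEq hξ),
    tautDiff_comp (mdifferentiableAt_hatChartInv k j _) hd.differentiableAt, hd.fderiv]
  rfl

theorem tautDiff_xiMap_I {ξ : Fin n → ℂ} (hξ : ξ ≠ 0) (v : Fin n → ℂ) :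
    tautDiff (xiMap n k) ξ (Complex.I • v)
      = hatJ n k (xiMap n k ξ) (tautDiff (xiMap n k) ξ v) := by
  have key : ∀ x y : TautPow n k, x = y → ∀ a b : Fin n → ℂ, a = b →
      (hatJ n k x a : Fin n → ℂ) = hatJ n k y b := by
    rintro x _ rfl a _ rfl; rfl
  obtain ⟨j, hj⟩ := Function.ne_iff.1 hξ
  obtain ⟨L, -, hL⟩ := tautDiff_xiMap (k := k) hj
  refine (hL _).trans ?_
  rw [map_smul]
  exact (hatJ_hatChartInv j _ _).trans (key _ _ (xiMap_eq hj).symm _ _ (hL v).symm)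

theorem surjective_tautDiff_xiMap (hk : k ≠ 0) {ξ : Fin n → ℂ} (hξ : ξ ≠ 0) :
    Function.Surjective (tautDiff (xiMap n k) ξ) := by
  obtain ⟨j, hj⟩ := Function.ne_iff.1 hξ
  obtain ⟨L, hL, hv⟩ := tautDiff_xiMap (k := k) hj
  obtain ⟨L', hL', hv'⟩ := hasStrictFDerivAt_lineCoord (-k : ℤ) hj
  obtain rfl := hL.hasFDerivAt.unique hL'.hasFDerivAt
  intro w
  obtain ⟨a, ha⟩ := (bijective_tautDiff_hatChartInv (k := k) j (lineCoord j (-k) ξ)).2 w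
  obtain ⟨b, rfl⟩ := lineCoord_diff_surjective (by simpa using hk) hj L hv' a
  exact ⟨b, (hv b).trans ha⟩

theorem mdifferentiableAt_tensorPow {z : Fin n → ℂ} (hz : z ≠ 0) :
    MDifferentiableAt 𝓘(ℝ, Fin n → ℂ) 𝓘(ℝ, Fin n → ℂ) (tensorPow n k) z :=
  (contMDiffAt_tensorPow hz).mdifferentiableAt (by simp)

theorem pullForm_xiMap (Om : ∀ x : TautPow n k, TautTangent x → TautTangent x → ℝ)
    {ξ : Fin n → ℂ} (hξ : ξ ≠ 0) (v w : Fin n → ℂ) :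
    pullForm Om (xiMap n k) ξ v w
      = pullForm Om (tensorPow n k) (radInv ξ) (radInvDiff ξ v) (radInvDiff ξ w) := by
  rw [← fderiv_radInv hξ, ← fderiv_radInv hξ]
  exact pullForm_comp Om (mdifferentiableAt_tensorPow (radInv_ne_zero hξ))
    (differentiableAt_radInv hξ) v w

theorem exists_xiMap_eq (hk : k ≠ 0) {x : TautPow n k} (hx : fibreSq x ≠ 0) :
    ∃ ξ : Fin n → ℂ, ξ ≠ 0 ∧ xiMap n k ξ = x := by
  obtain ⟨z, hz, rfl⟩ := exists_tensorPow_eq hk hx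
  exact ⟨radInv z, radInv_ne_zero hz, by rw [xiMap, radInv_radInv]⟩

end HatStructure

/-! ### Closedness under pull-back -/

set_option synthInstance.maxHeartbeats 200000 in
/-- The exterior derivative of a two-form commutes with pull-back. -/
theorem cyclic_fderiv_pullback {E F : Type*} [NormedAddCommGroup E] [NormedSpace ℝ E]
    [NormedAddCommGroup F] [NormedSpace ℝ F] {A : F → F →L[ℝ] F →L[ℝ] ℝ} {G : E → F} {x : E}
    (hA : DifferentiableAt ℝ A (G x)) (hG : ContDiffAt ℝ 2 G x)
    (hanti : ∀ v w, A (G x) v w = -A (G x) w v) (a b c : E) :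
    fderiv ℝ (fun y => A (G y) (fderiv ℝ G y b) (fderiv ℝ G y c)) x a
      + fderiv ℝ (fun y => A (G y) (fderiv ℝ G y c) (fderiv ℝ G y a)) x b
      + fderiv ℝ (fun y => A (G y) (fderiv ℝ G y a) (fderiv ℝ G y b)) x c
    = fderiv ℝ (fun y => A y (fderiv ℝ G x b) (fderiv ℝ G x c)) (G x) (fderiv ℝ G x a)
      + fderiv ℝ (fun y => A y (fderiv ℝ G x c) (fderiv ℝ G x a)) (G x) (fderiv ℝ G x b)
      + fderiv ℝ (fun y => A y (fderiv ℝ G x a) (fderiv ℝ G x b)) (G x) (fderiv ℝ G x c) := by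
  have hG1 : HasFDerivAt G (fderiv ℝ G x) x :=
    (hG.differentiableAt two_ne_zero).hasFDerivAt
  have hG2 : HasFDerivAt (fderiv ℝ G) (fderiv ℝ (fderiv ℝ G) x) x :=
    ((hG.fderiv_right (m := 1) (by norm_num)).differentiableAt one_ne_zero).hasFDerivAt
  have hsymm : ∀ a b, fderiv ℝ (fderiv ℝ G) x a b = fderiv ℝ (fderiv ℝ G) x b a := fun a b =>
    (hG.isSymmSndFDerivAt (by simp)).eq a b
  have hAG := HasFDerivAt.comp (g := A) (g' := fderiv ℝ A (G x)) x hA.hasFDerivAt hG1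
  have key : ∀ a b c, fderiv ℝ (fun y => A (G y) (fderiv ℝ G y b) (fderiv ℝ G y c)) x a
      = fderiv ℝ A (G x) (fderiv ℝ G x a) (fderiv ℝ G x b) (fderiv ℝ G x c)
        + A (G x) (fderiv ℝ (fderiv ℝ G) x a b) (fderiv ℝ G x c)
        + A (G x) (fderiv ℝ G x b) (fderiv ℝ (fderiv ℝ G) x a c) := by
    intro a b c
    have hb := hG2.clm_apply (hasFDerivAt_const b x)
    have hc := hG2.clm_apply (hasFDerivAt_const c x)
    have h := DFunLike.congr_fun ((hAG.clm_apply hb).clm_apply hc).fderiv a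
    refine h.trans ?_
    simp only [add_apply, ContinuousLinearMap.comp_apply,
      ContinuousLinearMap.flip_apply, Function.comp_apply, zero_apply, map_zero,
      zero_add]
    ring
  have key' : ∀ u v w, fderiv ℝ (fun y => A y v w) (G x) u = fderiv ℝ A (G x) u v w := by
    intro u v w
    have h := DFunLike.congr_fun ((hA.hasFDerivAt.clm_apply (hasFDerivAt_const v _)).clm_apply
      (hasFDerivAt_const w _)).fderiv u
    refine h.trans ?_
    simp
  rw [key, key, key, key', key', key', hsymm b a, hsymm c a, hsymm c b,
    hanti (fderiv ℝ G x b) (fderiv ℝ (fderiv ℝ G) x a c),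
    hanti (fderiv ℝ G x c) (fderiv ℝ (fderiv ℝ G) x a b),
    hanti (fderiv ℝ G x a) (fderiv ℝ (fderiv ℝ G) x b c)]
  ring

/-! ### The Kähler property of the compactification -/

section Kahler

open TautPow

variable {n k : ℕ}

theorem dense_apply_ne_zero (j : Fin n) : Dense {p : Fin n → ℂ | p j ≠ 0} :=
  (dense_compl_singleton (0 : ℂ)).preimage (isOpenMap_eval j)

theorem continuous_pullMetric_hatChartInv (g : TautMetric n k) (j : Fin n) (v w : Fin n → ℂ) :
    Continuous fun q => g.inner (hatChartInv k j q) (tautDiff (hatChartInv k j) q v)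
      (tautDiff (hatChartInv k j) q w) := by
  have hV : ∀ v, ContDiff ℝ ∞ fun p => fderiv ℝ (fromHat k j) (toHat k j p) v := fun v =>
    (((contDiff_fromHat k j).fderiv_right (m := ∞) (by simp)).clm_apply contDiff_const).comp
      (contDiff_toHat k j)
  have h := (contDiff_pullMetric g j (hV v) (hV w)).continuous.comp
    (contDiff_fromHat k j).continuous
  refine h.congr fun q => ?_
  rw [tautDiff_hatChartInv, tautDiff_hatChartInv, Function.comp_apply, toHat_fromHat]
  rfl

theorem fundamentalForm_hat_chartInv (g : TautMetric n k) (j : Fin n) (p v w : Fin n → ℂ) :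
    pullForm (fundamentalForm g (hatJ n k)) (chartInv j) p v w
      = g.inner (chartInv j p)
          (tautDiff (chartInv j) p (fderiv ℝ (fromHat k j) (toHat k j p)
            (Complex.I • fderiv ℝ (toHat k j) p v)))
          (tautDiff (chartInv j) p w) := by
  obtain ⟨q, rfl⟩ : ∃ q, p = fromHat k j q := ⟨toHat k j p, (fromHat_toHat k j p).symm⟩
  have h := hatJ_hatChartInv (k := k) j q (fderiv ℝ (toHat k j) (fromHat k j q) v)
  have e := fderiv_fromHat_toHat k j (fromHat k j q) v
  rw [toHat_fromHat] at e
  rw [tautDiff_hatChartInv, tautDiff_hatChartInv, e] at h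
  rw [pullForm, fundamentalForm, toHat_fromHat, h]
  rfl

/-- The fundamental form in the `j`-th chart, as a field of continuous bilinear maps. -/
def chartForm (g : TautMetric n k) (j : Fin n) (p : Fin n → ℂ) :
    (Fin n → ℂ) →L[ℝ] (Fin n → ℂ) →L[ℝ] ℝ :=
  let D : (Fin n → ℂ) →L[ℝ] (Fin n → ℂ) :=
    mfderiv 𝓘(ℝ, Fin n → ℂ) 𝓘(ℝ, Fin n → ℂ) (chartInv j : _ → TautPow n k) p
  let J : (Fin n → ℂ) →L[ℝ] (Fin n → ℂ) := hatJ n k (chartInv j p)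
  let B : (Fin n → ℂ) →L[ℝ] (Fin n → ℂ) →L[ℝ] ℝ := g.inner (chartInv j p)
  B.bilinearComp (J.comp D) D

theorem chartForm_apply (g : TautMetric n k) (j : Fin n) (p v w : Fin n → ℂ) :
    chartForm g j p v w = pullForm (fundamentalForm g (hatJ n k)) (chartInv j) p v w := rfl

theorem contDiff_chartForm_apply (g : TautMetric n k) (j : Fin n) (v w : Fin n → ℂ) :
    ContDiff ℝ ∞ fun p => pullForm (fundamentalForm g (hatJ n k)) (chartInv j) p v w := by
  simp only [fundamentalForm_hat_chartInv]
  refine contDiff_pullMetric g j ?_ contDiff_const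
  have h1 : ContDiff ℝ ∞ fun p => fderiv ℝ (fromHat k j) (toHat k j p) :=
    ((contDiff_fromHat k j).fderiv_right (m := ∞) (by simp)).comp (contDiff_toHat k j)
  have h2 : ContDiff ℝ ∞ fun p => fderiv ℝ (toHat k j) p v :=
    ((contDiff_toHat k j).fderiv_right (m := ∞) (by simp)).clm_apply contDiff_const
  exact h1.clm_apply (h2.const_smul Complex.I)

theorem contDiff_chartForm (g : TautMetric n k) (j : Fin n) : ContDiff ℝ ∞ (chartForm g j) := by
  refine contDiff_clm_apply_iff.2 fun v => contDiff_clm_apply_iff.2 fun w => ?_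
  exact contDiff_chartForm_apply g j v w

variable [NeZero n] {g ghat : TautMetric n k} {φ : ℝ → ℝ}

theorem moment_xiMap (hk : k ≠ 0) {ξ : Fin n → ℂ} (hξ : ξ ≠ 0) :
    moment k φ (xiMap n k ξ) = (radSq ξ)⁻¹ * deriv φ (radSq ξ)⁻¹ := by
  refine moment_eq hk (inv_pos.2 (radSq_pos.2 hξ)) ?_
  rw [xiMap, fibreSq_tensorPow (radInv_ne_zero hξ), radSq_radInv]

/-- In the coordinates at infinity, the form of the conformal metric is radial. -/
theorem hatForm_xiMap (hg : ArisesFrom g φ) (hk : k ≠ 0) (hn : 2 ≤ n)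
    (hc : ∀ (x : TautPow n k) (v w : TautTangent x),
      ghat.inner x v w = ((moment k φ x)⁻¹) ^ 2 * g.inner x v w)
    {ξ : Fin n → ℂ} (hξ : ξ ≠ 0) (v w : Fin n → ℂ) :
    pullForm (fundamentalForm ghat (hatJ n k)) (xiMap n k) ξ v w
      = radForm (deriv φ (radSq ξ)⁻¹)⁻¹
          (deriv (deriv φ) (radSq ξ)⁻¹ / (radSq ξ ^ 2 * deriv φ (radSq ξ)⁻¹ ^ 2)) ξ v w := by
  have hp := deriv_pot_pos hg hk hn (inv_pos.2 (radSq_pos.2 hξ))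
  rw [← radForm_radInv hp.ne' hξ, pullForm, fundamentalForm, ← tautDiff_xiMap_I hξ, hc,
    moment_xiMap hk hξ, inv_pow]
  have h := pullForm_xiMap (k := k) (fun x v w => g.inner x v w) hξ (Complex.I • v) w
  rw [metric_tensorPow hg (radInv_ne_zero hξ), radSq_radInv] at h
  rw [← h]
  rfl

omit [NeZero n] in
theorem radForm_I_I (p q : ℝ) (z v w : Fin n → ℂ) :
    radForm p q z (Complex.I • v) (Complex.I • w) = radForm p q z v w := by
  simp only [radForm, I_smul_I_smul, map_neg, neg_apply, rin_I_left]
  ring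

theorem hermitian_hat (hg : ArisesFrom g φ) (hk : k ≠ 0) (hn : 2 ≤ n)
    (hc : ∀ (x : TautPow n k) (v w : TautTangent x),
      ghat.inner x v w = ((moment k φ x)⁻¹) ^ 2 * g.inner x v w)
    (x : TautPow n k) (v w : TautTangent x) :
    ghat.inner x (hatJ n k x v) (hatJ n k x w) = ghat.inner x v w := by
  have h1 : ∀ x : TautPow n k, fibreSq x ≠ 0 → ∀ v w : TautTangent x,
      ghat.inner x (hatJ n k x v) (hatJ n k x w) = ghat.inner x v w := by
    intro x hx v w
    obtain ⟨ξ, hξ, rfl⟩ := exists_xiMap_eq hk hx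
    obtain ⟨a, rfl⟩ := surjective_tautDiff_xiMap hk hξ v
    obtain ⟨b, rfl⟩ := surjective_tautDiff_xiMap hk hξ w
    have e1 := hatForm_xiMap hg hk hn hc hξ a (Complex.I • b)
    have e2 := hatForm_xiMap hg hk hn hc hξ (Complex.I • a) (Complex.I • Complex.I • b)
    rw [radForm_I_I, ← e1, I_smul_I_smul, pullForm, pullForm, fundamentalForm, fundamentalForm,
      ← tautDiff_xiMap_I hξ, ← tautDiff_xiMap_I hξ, I_smul_I_smul] at e2
    have hneg : ∀ a, tautDiff (xiMap n k) ξ (-a) = -tautDiff (xiMap n k) ξ a := fun a =>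
      ContinuousLinearMap.map_neg (mfderiv 𝓘(ℝ, Fin n → ℂ) 𝓘(ℝ, Fin n → ℂ) (xiMap n k) ξ) a
    rw [hneg, hneg, map_neg, map_neg, neg_apply, neg_neg] at e2
    rw [← tautDiff_xiMap_I hξ, ← tautDiff_xiMap_I hξ, e2]
  obtain ⟨j, q, rfl⟩ := exists_hatChartInv_eq x
  obtain ⟨a, rfl⟩ := (bijective_tautDiff_hatChartInv j q).2 v
  obtain ⟨b, rfl⟩ := (bijective_tautDiff_hatChartInv j q).2 w
  simp only [← hatJ_hatChartInv]
  refine congrFun (Continuous.ext_on (dense_apply_ne_zero j)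
    (continuous_pullMetric_hatChartInv ghat j (Complex.I • a) (Complex.I • b))
    (continuous_pullMetric_hatChartInv ghat j a b) fun y hy => ?_) q
  have hy0 : fibreSq (hatChartInv k j y) ≠ 0 := by
    refine (fibreSq_chartInv_pos.2 ?_).ne'
    have hr := (radSq_update_pos j y).ne'
    simpa [fromHat, hr] using hy
  have := h1 _ hy0 (tautDiff (hatChartInv k j) y a) (tautDiff (hatChartInv k j) y b)
  simpa only [← hatJ_hatChartInv] using this

theorem antisymm_hat (hg : ArisesFrom g φ) (hk : k ≠ 0) (hn : 2 ≤ n)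
    (hc : ∀ (x : TautPow n k) (v w : TautTangent x),
      ghat.inner x v w = ((moment k φ x)⁻¹) ^ 2 * g.inner x v w)
    (x : TautPow n k) (v w : TautTangent x) :
    fundamentalForm ghat (hatJ n k) x v w = -fundamentalForm ghat (hatJ n k) x w v := by
  rw [fundamentalForm, fundamentalForm, ← hermitian_hat hg hk hn hc x (hatJ n k x v) w, hatJ_hatJ,
    map_neg, neg_apply, ghat.symm]

omit [NeZero n] in
theorem contDiffAt_lineCoord_radInv {j : Fin n} {ξ : Fin n → ℂ} (hξ : ξ j ≠ 0) :
    ContDiffAt ℝ ∞ (fun y => lineCoord j k (radInv y)) ξ := by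
  have h0 := (radSq_pos.2 (ne_zero_of_apply_ne hξ)).ne'
  have hr : ∀ i, ContDiffAt ℝ ∞ (fun y : Fin n → ℂ => radInv y i) ξ := by
    intro i
    have h1 : ContDiffAt ℝ ∞ (fun y : Fin n → ℂ => (radSq y)⁻¹) ξ :=
      contDiff_radSq.contDiffAt.inv h0
    exact (Complex.ofRealCLM.contDiff.contDiffAt.comp ξ h1).mul
      (contDiff_apply ℝ ℂ i).contDiffAt
  refine contDiffAt_pi.2 fun i => ?_
  by_cases h : i = j
  · subst h
    simpa [lineCoord] using (hr i).pow k
  · simpa [lineCoord, h, div_eq_mul_inv] using (hr i).mul ((hr j).inv (radInv_apply_ne hξ))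

omit [NeZero n] in
theorem surjective_radInvDiff {ξ : Fin n → ℂ} (hξ : ξ ≠ 0) :
    Function.Surjective (radInvDiff ξ) := by
  have h0 := (radSq_pos.2 hξ).ne'
  intro w
  refine ⟨radSq ξ • (w - (2 * (radSq ξ)⁻¹ * rin ξ w) • ξ), ?_⟩
  simp only [radInvDiff, map_smul, map_sub, rin_self, smul_eq_mul]
  ext i
  simp only [Pi.smul_apply, Pi.sub_apply, Complex.real_smul]
  push_cast
  have h1 : (radSq ξ : ℂ) ≠ 0 := by exact_mod_cast h0
  field_simp
  ring

omit [NeZero n] in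
theorem surjective_fderiv_lineCoord_radInv (hk : k ≠ 0) {j : Fin n} {ξ : Fin n → ℂ}
    (hξ : ξ j ≠ 0) :
    Function.Surjective (fderiv ℝ (fun y : Fin n → ℂ => lineCoord j k (radInv y)) ξ) := by
  have hξ0 := ne_zero_of_apply_ne hξ
  obtain ⟨L, hL, hv⟩ := hasStrictFDerivAt_lineCoord k (radInv_apply_ne hξ)
  have hd := hL.hasFDerivAt.restrictScalars ℝ
  intro a
  obtain ⟨a₁, rfl⟩ := lineCoord_diff_surjective (by exact_mod_cast hk) (radInv_apply_ne hξ) L hv a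
  obtain ⟨a₂, rfl⟩ := surjective_radInvDiff hξ0 a₁
  refine ⟨a₂, ?_⟩
  have h := hd.comp ξ (differentiableAt_radInv hξ0).hasFDerivAt
  refine (DFunLike.congr_fun h.fderiv a₂).trans ?_
  rw [ContinuousLinearMap.comp_apply, fderiv_radInv hξ0]
  rfl

theorem chartForm_pullback (hg : ArisesFrom g φ) (hk : k ≠ 0) (hn : 2 ≤ n)
    (hc : ∀ (x : TautPow n k) (v w : TautTangent x),
      ghat.inner x v w = ((moment k φ x)⁻¹) ^ 2 * g.inner x v w)
    {j : Fin n} {ξ : Fin n → ℂ} (hξ : ξ j ≠ 0) (b c : Fin n → ℂ) :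
    chartForm ghat j (lineCoord j k (radInv ξ))
        (fderiv ℝ (fun y : Fin n → ℂ => lineCoord j k (radInv y)) ξ b)
        (fderiv ℝ (fun y : Fin n → ℂ => lineCoord j k (radInv y)) ξ c)
      = radForm (deriv φ (radSq ξ)⁻¹)⁻¹
          (deriv (deriv φ) (radSq ξ)⁻¹ / (radSq ξ ^ 2 * deriv φ (radSq ξ)⁻¹ ^ 2)) ξ b c := by
  rw [← hatForm_xiMap hg hk hn hc (ne_zero_of_apply_ne hξ), chartForm_apply]
  have h := pullForm_comp (fundamentalForm ghat (hatJ n k))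
    (mdifferentiableAt_chartInv j (lineCoord j k (radInv ξ)))
    (G := fun y => lineCoord j k (radInv y)) (z := ξ)
    ((contDiffAt_lineCoord_radInv hξ).differentiableAt (by simp)) b c
  refine h.symm.trans (pullForm_congr _ ?_ b c)
  filter_upwards [(continuous_apply j).continuousAt.eventually_ne hξ] with y hy
  rw [xiMap, tensorPow_eq (radInv_apply_ne hy)]
  rfl

theorem exists_hasDerivAt_hat {φ : ℝ → ℝ} (hφ : ContDiffOn ℝ ∞ φ (Ioi 0)) {s : ℝ} (hs : 0 < s)
    (h0 : deriv φ s⁻¹ ≠ 0) :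
    ∃ r, HasDerivAt (fun t => deriv (deriv φ) t⁻¹ / (t ^ 2 * deriv φ t⁻¹ ^ 2)) r s := by
  have hi := hasDerivAt_inv hs.ne'
  have h1 : ContDiffOn ℝ 2 (deriv φ) (Ioi 0) :=
    hφ.deriv_of_isOpen isOpen_Ioi (by norm_cast)
  have h2 : ContDiffOn ℝ 1 (deriv (deriv φ)) (Ioi 0) :=
    h1.deriv_of_isOpen isOpen_Ioi (by norm_num)
  have d1 := ((h1.contDiffAt (Ioi_mem_nhds (inv_pos.2 hs))).differentiableAt
    two_ne_zero).hasDerivAt.comp _ hi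
  have d2 := ((h2.contDiffAt (Ioi_mem_nhds (inv_pos.2 hs))).differentiableAt
    one_ne_zero).hasDerivAt.comp _ hi
  exact ⟨_, d2.div (((hasDerivAt_id _).pow 2).mul (d1.pow 2))
    (mul_ne_zero (pow_ne_zero _ hs.ne') (pow_ne_zero _ h0))⟩

set_option maxHeartbeats 1000000 in
/-- Off the zero section the form is pulled back to the coordinates `ξ`, where it is radial. -/
theorem closed_hat_lineCoord (hg : ArisesFrom g φ) (hk : k ≠ 0) (hn : 2 ≤ n)
    (hc : ∀ (x : TautPow n k) (v w : TautTangent x),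
      ghat.inner x v w = ((moment k φ x)⁻¹) ^ 2 * g.inner x v w)
    {j : Fin n} {ξ : Fin n → ℂ} (hξ : ξ j ≠ 0) (a b c : Fin n → ℂ) :
    fderiv ℝ (fun y => chartForm ghat j y b c) (lineCoord j k (radInv ξ)) a
      + fderiv ℝ (fun y => chartForm ghat j y c a) (lineCoord j k (radInv ξ)) b
      + fderiv ℝ (fun y => chartForm ghat j y a b) (lineCoord j k (radInv ξ)) c = 0 := by
  have hpull : ∀ b c, (fun y => chartForm ghat j (lineCoord j k (radInv y))
        (fderiv ℝ (fun y : Fin n → ℂ => lineCoord j k (radInv y)) y b)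
        (fderiv ℝ (fun y : Fin n → ℂ => lineCoord j k (radInv y)) y c))
      =ᶠ[𝓝 ξ] fun y => radForm ((fun t => (deriv φ t⁻¹)⁻¹) (radSq y))
        ((fun t => deriv (deriv φ) t⁻¹ / (t ^ 2 * deriv φ t⁻¹ ^ 2)) (radSq y)) y b c := by
    intro b c
    filter_upwards [(continuous_apply j).continuousAt.eventually_ne hξ] with y hy
    exact chartForm_pullback hg hk hn hc hy b c
  have hs := radSq_pos.2 (ne_zero_of_apply_ne hξ)
  have hp0 := (deriv_pot_pos hg hk hn (inv_pos.2 hs)).ne'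
  obtain ⟨r, hr⟩ := exists_hasDerivAt_hat hg.1 hs hp0
  obtain ⟨a', rfl⟩ := surjective_fderiv_lineCoord_radInv hk hξ a
  obtain ⟨b', rfl⟩ := surjective_fderiv_lineCoord_radInv hk hξ b
  obtain ⟨c', rfl⟩ := surjective_fderiv_lineCoord_radInv hk hξ c
  have h := cyclic_fderiv_pullback (A := chartForm ghat j)
    (G := fun y => lineCoord j k (radInv y)) (x := ξ)
    ((contDiff_chartForm ghat j).differentiable (by simp) _)
    ((contDiffAt_lineCoord_radInv hξ).of_le (by norm_cast))
    (fun v w => antisymm_hat hg hk hn hc _ _ _) a' b' c'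
  rw [(hpull b' c').fderiv_eq, (hpull c' a').fderiv_eq, (hpull a' b').fderiv_eq,
    radForm_closed (hasDerivAt_inv_deriv hg.1 hs hp0) hr] at h
  exact h.symm

theorem isClosed_hat (hg : ArisesFrom g φ) (hk : k ≠ 0) (hn : 2 ≤ n)
    (hc : ∀ (x : TautPow n k) (v w : TautTangent x),
      ghat.inner x v w = ((moment k φ x)⁻¹) ^ 2 * g.inner x v w) :
    IsClosedTwoForm (fundamentalForm ghat (hatJ n k)) := by
  rintro _ ⟨j, rfl⟩ p - a b c
  change fderiv ℝ (fun y => chartForm ghat j y b c) p a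
    + fderiv ℝ (fun y => chartForm ghat j y c a) p b
    + fderiv ℝ (fun y => chartForm ghat j y a b) p c = 0
  have hcont : ∀ a b c : Fin n → ℂ,
      Continuous fun p => fderiv ℝ (fun y => chartForm ghat j y b c) p a := fun a b c =>
    ((contDiff_chartForm_apply ghat j b c).continuous_fderiv (by simp)).clm_apply continuous_const
  have hz : ∀ p ∈ {p : Fin n → ℂ | p j ≠ 0}, fderiv ℝ (fun y => chartForm ghat j y b c) p a
      + fderiv ℝ (fun y => chartForm ghat j y c a) p b
      + fderiv ℝ (fun y => chartForm ghat j y a b) p c = 0 := by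
    intro p hp
    obtain ⟨z, hz, rfl⟩ := exists_lineCoord_eq (m := k) (by exact_mod_cast hk) hp
    have h := closed_hat_lineCoord hg hk hn hc (radInv_apply_ne hz) a b c
    rwa [radInv_radInv] at h
  exact congrFun (Continuous.ext_on (dense_apply_ne_zero j)
    (((hcont a b c).add (hcont b c a)).add (hcont c a b)) continuous_const hz) p

theorem isKahler_hat (hg : ArisesFrom g φ) (hk : k ≠ 0) (hn : 2 ≤ n)
    (hc : ∀ (x : TautPow n k) (v w : TautTangent x),
      ghat.inner x v w = ((moment k φ x)⁻¹) ^ 2 * g.inner x v w) :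
    IsKahler ghat (hatJ n k) where
  complexStructure := isComplexStructure_hatJ
  hermitian := hermitian_hat hg hk hn hc
  closed := isClosed_hat hg hk hn hc

end Kahler

/-! ### The topology of `𝒪(-k)` -/

section Topo

open TautPow

variable {n k : ℕ}

theorem normSq_apply_le_radSq (z : Fin n → ℂ) (i : Fin n) : Complex.normSq (z i) ≤ radSq z :=
  Finset.single_le_sum (f := fun i => Complex.normSq (z i)) (fun _ _ => Complex.normSq_nonneg _)
    (Finset.mem_univ i)

theorem norm_le_of_radSq_le {z : Fin n → ℂ} {r : ℝ} (hr : 0 ≤ r) (h : radSq z ≤ r ^ 2) :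
    ‖z‖ ≤ r := by
  refine (pi_norm_le_iff_of_nonneg hr).2 fun i => ?_
  have := (normSq_apply_le_radSq z i).trans h
  rw [Complex.normSq_eq_norm_sq] at this
  exact le_of_sq_le_sq this hr

theorem mk_normalize (p : LinePair n) : ∃ q : LinePair n, radSq q.1.1 = 1 ∧
    (mk p : TautPow n k) = mk q := by
  have h0 := radSq_pos.2 p.2
  set r := √(radSq p.1.1) with hr
  have hr0 : 0 < r := Real.sqrt_pos.2 h0
  have hrc : (r : ℂ) ≠ 0 := by exact_mod_cast hr0.ne'
  refine ⟨⟨(((r : ℂ)⁻¹) • p.1.1, r ^ k * p.1.2), smul_ne_zero (inv_ne_zero hrc) p.2⟩, ?_, ?_⟩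
  · rw [radSq_smul, Complex.normSq_inv, Complex.normSq_ofReal, hr, Real.mul_self_sqrt h0.le,
      inv_mul_cancel₀ h0.ne']
  · rw [mk_eq_mk]
    refine ⟨(r : ℂ)⁻¹, inv_ne_zero hrc, rfl, ?_⟩
    rw [← mul_assoc, ← mul_pow, inv_mul_cancel₀ hrc, one_pow, one_mul]

theorem isCompact_fibreSq_le (M : ℝ) : IsCompact {x : TautPow n k | fibreSq x ≤ M} := by
  set A : Set ((Fin n → ℂ) × ℂ) := {p | radSq p.1 = 1 ∧ Complex.normSq p.2 ≤ M} with hA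
  have hc : IsCompact A := by
    refine IsCompact.of_isClosed_subset ((isCompact_closedBall (0 : Fin n → ℂ) 1).prod
      (isCompact_closedBall (0 : ℂ) √M)) ?_ ?_
    · have h := (contDiff_radSq (n := n) (m := 0)).continuous
      exact (isClosed_eq (h.comp continuous_fst) continuous_const).inter
        (isClosed_le (Complex.continuous_normSq.comp continuous_snd) continuous_const)
    · rintro ⟨z, t⟩ ⟨h1, h2⟩
      refine ⟨mem_closedBall_zero_iff.2 (norm_le_of_radSq_le zero_le_one ?_),
        mem_closedBall_zero_iff.2 (Real.le_sqrt_of_sq_le ?_)⟩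
      · rw [one_pow]; exact h1.le
      · rw [← Complex.normSq_eq_norm_sq]; exact h2
  have := isCompact_iff_compactSpace.1 hc
  have h0 : ∀ p : A, p.1.1 ≠ 0 := fun p => radSq_pos.1 (by rw [p.2.1]; exact one_pos)
  have hcont : Continuous fun p : A => (mk ⟨p.1, h0 p⟩ : TautPow n k) :=
    isQuotientMap_mk.continuous.comp (continuous_subtype_val.subtype_mk _)
  convert isCompact_range hcont using 1
  ext x
  constructor
  · intro hx
    obtain ⟨p, rfl⟩ := isQuotientMap_mk.surjective x
    obtain ⟨q, hq, hpq⟩ := mk_normalize (k := k) p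
    rw [hpq] at hx ⊢
    have hx' : Complex.normSq q.1.2 ≤ M := by
      have : Complex.normSq q.1.2 * radSq q.1.1 ^ k ≤ M := hx
      rwa [hq, one_pow, mul_one] at this
    exact ⟨⟨q.1, hq, hx'⟩, rfl⟩
  · rintro ⟨p, rfl⟩
    change Complex.normSq p.1.2 * radSq p.1.1 ^ k ≤ M
    rw [p.2.1, one_pow, mul_one]
    exact p.2.2

/-- The Segre-type coordinates `z_i z̄_j / 𝐳` together with `t z_i ^ k` separate the points. -/
instance : T2Space (TautPow n k) := by
  set f : TautPow n k → (Fin n → Fin n → ℂ) × (Fin n → ℂ) :=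
    Quotient.lift (s := linePairSetoid n k)
      (fun p : LinePair n => (fun i j => p.1.1 i * starRingEnd ℂ (p.1.1 j) * ((radSq p.1.1 : ℂ))⁻¹,
        fun i => p.1.2 * p.1.1 i ^ k)) (by
      rintro p q ⟨μ, hμ, h1, h2⟩
      have hn : ((Complex.normSq μ : ℝ) : ℂ) = μ * starRingEnd ℂ μ := by rw [Complex.mul_conj]
      have hc : starRingEnd ℂ μ ≠ 0 := by simpa using hμ
      simp only [Prod.mk.injEq]
      constructor
      · funext i j
        simp only [h1, Pi.smul_apply, smul_eq_mul, map_mul, radSq_smul]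
        push_cast
        rw [hn, mul_inv, mul_inv]
        field_simp
      · funext i
        simp only [h1, h2, Pi.smul_apply, smul_eq_mul]
        ring) with hf
  have hfm : ∀ p : LinePair n, f (mk p) = (fun i j => p.1.1 i * starRingEnd ℂ (p.1.1 j) *
      ((radSq p.1.1 : ℂ))⁻¹, fun i => p.1.2 * p.1.1 i ^ k) := fun _ => rfl
  have hcont : Continuous f := by
    refine isQuotientMap_mk.continuous_iff.2 ?_
    change Continuous fun p : LinePair n => (fun i j => p.1.1 i * starRingEnd ℂ (p.1.1 j) *
        ((radSq p.1.1 : ℂ))⁻¹, fun i => p.1.2 * p.1.1 i ^ k)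
    have h := (contDiff_radSq (n := n) (m := 0)).continuous
    have h1 : Continuous fun p : LinePair n => p.1.1 := by fun_prop
    have h2 : Continuous fun p : LinePair n => ((radSq p.1.1 : ℂ))⁻¹ :=
      (Complex.continuous_ofReal.comp (h.comp h1)).inv₀ fun p =>
        Complex.ofReal_ne_zero.2 (radSq_pos.2 p.2).ne'
    refine Continuous.prodMk (continuous_pi fun i => continuous_pi fun j => ?_) (by fun_prop)
    refine Continuous.mul (Continuous.mul (by fun_prop) ?_) h2
    exact Complex.continuous_conj.comp (by fun_prop)
  refine T2Space.of_injective_continuous (f := f) ?_ hcont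
  intro x y hxy
  obtain ⟨p, rfl⟩ := isQuotientMap_mk.surjective x
  obtain ⟨q, rfl⟩ := isQuotientMap_mk.surjective y
  rw [hfm, hfm, Prod.mk.injEq] at hxy
  obtain ⟨e1, e2⟩ := hxy
  have hp0 : (radSq p.1.1 : ℂ) ≠ 0 := by exact_mod_cast (radSq_pos.2 p.2).ne'
  have hq0 : (radSq q.1.1 : ℂ) ≠ 0 := by exact_mod_cast (radSq_pos.2 q.2).ne'
  obtain ⟨j, hj⟩ := Function.ne_iff.1 q.2
  have hqj : starRingEnd ℂ (q.1.1 j) ≠ 0 := by simpa using hj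
  have hpj : p.1.1 j ≠ 0 := by
    intro h
    have := congrFun (congrFun e1 j) j
    rw [h, zero_mul, zero_mul] at this
    exact (mul_ne_zero (mul_ne_zero hj hqj) (inv_ne_zero hq0)) this.symm
  have hpj' : starRingEnd ℂ (p.1.1 j) ≠ 0 := by simpa using hpj
  set μ : ℂ := starRingEnd ℂ (p.1.1 j) * (radSq p.1.1 : ℂ)⁻¹ *
    (radSq q.1.1 * (starRingEnd ℂ (q.1.1 j))⁻¹) with hμ
  have hμ0 : μ ≠ 0 := mul_ne_zero (mul_ne_zero hpj' (inv_ne_zero hp0))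
    (mul_ne_zero hq0 (inv_ne_zero hqj))
  have h1 : q.1.1 = μ • p.1.1 := by
    funext i
    have := congrFun (congrFun e1 i) j
    rw [Pi.smul_apply, smul_eq_mul, hμ]
    field_simp at this ⊢
    linear_combination -this
  refine mk_eq_mk.2 ⟨μ, hμ0, h1, ?_⟩
  have := congrFun e2 j
  simp only [h1, Pi.smul_apply, smul_eq_mul, mul_pow] at this
  refine mul_right_cancel₀ (pow_ne_zero k hpj) ?_
  rw [this]; ring

variable [NeZero n]

omit [NeZero n] in
theorem one_lt_rank (hn : n ≠ 0) : 1 < Module.rank ℝ (Fin n → ℂ) := by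
  rw [← Module.finrank_eq_rank, Module.finrank_pi_fintype]
  simp only [Complex.finrank_real_complex, Finset.sum_const, Finset.card_univ, Fintype.card_fin,
    smul_eq_mul]
  exact_mod_cast (by omega : 1 < n * 2)

instance : PreconnectedSpace (TautPow n k) := by
  have h1 : IsPreconnected ({0}ᶜ ×ˢ univ : Set ((Fin n → ℂ) × ℂ)) :=
    (isConnected_compl_singleton_of_one_lt_rank (one_lt_rank (NeZero.ne n)) 0).isPreconnected.prod
      isPreconnected_univ
  have h2 : PreconnectedSpace (LinePair n) := by
    have h3 : IsPreconnected {p : (Fin n → ℂ) × ℂ | p.1 ≠ 0} := by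
      convert h1 using 1
      ext p; simp
    exact isPreconnected_iff_preconnectedSpace.1 h3
  constructor
  have := isPreconnected_range (isQuotientMap_mk (n := n) (k := k)).continuous
  rwa [(isQuotientMap_mk (n := n) (k := k)).surjective.range_eq] at this

/-- `𝒪(-k)` has one end. -/
theorem isPreconnected_lt_fibreSq (hk : k ≠ 0) {M : ℝ} (hM : 0 ≤ M) :
    IsPreconnected {x : TautPow n k | M < fibreSq x} := by
  have h1 : IsPreconnected ({0}ᶜ : Set (Fin n → ℂ)) :=
    (isConnected_compl_singleton_of_one_lt_rank (one_lt_rank (NeZero.ne n)) 0).isPreconnected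
  have h2 : IsPreconnected {τ : ℝ | 0 < τ ∧ M < (τ ^ 2) ^ k} := by
    refine OrdConnected.isPreconnected ⟨fun a ha b _ c hc => ?_⟩
    have ha1 : 0 < a := ha.1
    have hc1 : a ≤ c := hc.1
    exact ⟨ha1.trans_le hc1, ha.2.trans_le (by gcongr)⟩
  set f : (Fin n → ℂ) × ℝ → TautPow n k :=
    fun p => tensorPow n k ((p.2 * (√(radSq p.1))⁻¹ : ℝ) • p.1) with hf
  have hne : ∀ p ∈ ({0}ᶜ ×ˢ {τ : ℝ | 0 < τ ∧ M < (τ ^ 2) ^ k} : Set ((Fin n → ℂ) × ℝ)),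
      (p.2 * (√(radSq p.1))⁻¹ : ℝ) • p.1 ≠ 0 := by
    rintro ⟨z, τ⟩ ⟨hz, hτ⟩
    exact smul_ne_zero (mul_ne_zero hτ.1.ne' (inv_ne_zero (Real.sqrt_pos.2 (radSq_pos.2 hz)).ne'))
      hz
  have hfc : ContinuousOn f ({0}ᶜ ×ˢ {τ : ℝ | 0 < τ ∧ M < (τ ^ 2) ^ k}) := by
    intro p hp
    refine ContinuousAt.continuousWithinAt ?_
    have h := (contMDiffAt_tensorPow (k := k) (hne p hp)).continuousAt
    refine ContinuousAt.comp (g := tensorPow n k) h ?_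
    have hr : Continuous fun p : (Fin n → ℂ) × ℝ => √(radSq p.1) :=
      ((contDiff_radSq (m := 0)).continuous.comp continuous_fst).sqrt
    exact (continuous_snd.continuousAt.mul (hr.continuousAt.inv₀
      (Real.sqrt_pos.2 (radSq_pos.2 hp.1)).ne')).smul continuous_fst.continuousAt
  convert (h1.prod h2).image f hfc using 1
  ext x
  constructor
  · intro hx
    have hx' : M < fibreSq x := hx
    obtain ⟨z, hz, rfl⟩ := exists_tensorPow_eq hk (hM.trans_lt hx').ne'
    rw [fibreSq_tensorPow hz] at hx'
    have hr := Real.sqrt_pos.2 (radSq_pos.2 hz)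
    refine ⟨(z, √(radSq z)), ⟨hz, hr, ?_⟩, ?_⟩
    · rwa [Real.sq_sqrt (radSq_nonneg z)]
    · simp only [hf]
      rw [mul_inv_cancel₀ hr.ne', one_smul]
  · rintro ⟨p, hp, rfl⟩
    change M < fibreSq (tensorPow n k _)
    rw [fibreSq_tensorPow (hne p hp), radSq_real_smul, mul_pow p.2, inv_pow,
      Real.sq_sqrt (radSq_nonneg _), mul_assoc, inv_mul_cancel₀ (radSq_pos.2 hp.1).ne', mul_one]
    exact hp.2.2

/-! ### The orbifold chart at infinity -/

theorem fibreSq_xiMap {ξ : Fin n → ℂ} (hξ : ξ ≠ 0) :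
    fibreSq (xiMap n k ξ) = (radSq ξ ^ k)⁻¹ := by
  rw [xiMap, fibreSq_tensorPow (radInv_ne_zero hξ), radSq_radInv, inv_pow]

theorem map_xiMap_nhds (hk : k ≠ 0) {ξ : Fin n → ℂ} (hξ : ξ ≠ 0) :
    map (xiMap n k) (𝓝 ξ) = 𝓝 (xiMap n k ξ) := by
  obtain ⟨j, hj⟩ := Function.ne_iff.1 hξ
  have hev : xiMap n k =ᶠ[𝓝 ξ] chartInv j ∘ fun y => lineCoord j k (radInv y) := by
    filter_upwards [(continuous_apply j).continuousAt.eventually_ne hj] with y hy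
    exact tensorPow_eq (radInv_apply_ne hy)
  have h1 := ((contDiffAt_lineCoord_radInv (k := k) hj).hasStrictFDerivAt (by simp))
  have h2 := h1.map_nhds_eq_of_surj
    (LinearMap.range_eq_top.2 (surjective_fderiv_lineCoord_radInv hk hj))
  have h3 := (chart (k := k) j).symm.map_nhds_eq (x := lineCoord j k (radInv ξ)) (mem_univ _)
  rw [map_congr hev, ← map_map, h2, hev.self_of_nhds]
  exact h3

theorem xiChart_of_ne {ξ : Fin n → ℂ} (hξ : ξ ≠ 0) :
    xiChart n k ξ = (xiMap n k ξ : OnePoint (TautPow n k)) := by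
  rw [xiChart, if_neg hξ]

theorem map_xiChart_nhds (hk : k ≠ 0) {ξ : Fin n → ℂ} (hξ : ξ ≠ 0) :
    map (xiChart n k) (𝓝 ξ) = 𝓝 (xiChart n k ξ) := by
  have hev : xiChart n k =ᶠ[𝓝 ξ] (fun x : TautPow n k => (x : OnePoint (TautPow n k))) ∘
      xiMap n k := by
    filter_upwards [isOpen_ne.mem_nhds hξ] with y hy
    exact xiChart_of_ne hy
  rw [map_congr hev, ← map_map, map_xiMap_nhds hk hξ, xiChart_of_ne hξ]
  exact OnePoint.isOpenEmbedding_coe.map_nhds_eq _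

theorem continuous_xiChart (hk : k ≠ 0) : Continuous (xiChart n k) := by
  refine continuous_iff_continuousAt.2 fun ξ => ?_
  by_cases hξ : ξ = 0
  · subst hξ
    have h0 : xiChart n k 0 = OnePoint.infty := by rw [xiChart, if_pos rfl]
    rw [ContinuousAt, h0]
    refine tendsto_nhds.2 fun U hU hmem => ?_
    have hK := (OnePoint.isOpen_def.1 hU).1 hmem
    obtain ⟨M, hM⟩ := (hK.image continuous_fibreSq).bddAbove
    have hlim : Tendsto (fun ξ : Fin n → ℂ => radSq ξ ^ k) (𝓝 0) (𝓝 0) := by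
      have := ((contDiff_radSq (n := n) (m := 0)).continuous.pow k).tendsto 0
      rwa [Pi.pow_apply, radSq_eq_zero.2 rfl, zero_pow hk] at this
    have hpos : 0 < (|M| + 1)⁻¹ := by positivity
    filter_upwards [hlim.eventually (gt_mem_nhds hpos)] with ξ hξ
    by_cases h : ξ = 0
    · rw [mem_preimage, h, h0]; exact hmem
    · rw [mem_preimage, xiChart_of_ne h]
      by_contra hcon
      have h1 : fibreSq (xiMap n k ξ) ≤ M := hM (mem_image_of_mem _ hcon)
      rw [fibreSq_xiMap h] at h1
      have h2 : 0 < radSq ξ ^ k := pow_pos (radSq_pos.2 h) k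
      have h3 := (lt_inv_comm₀ h2 (by positivity)).1 hξ
      linarith [le_abs_self M]
  · exact (map_xiChart_nhds hk hξ).le

theorem isOpenMap_xiChart (hk : k ≠ 0) : IsOpenMap (xiChart n k) := by
  refine isOpenMap_iff_nhds_le.2 fun ξ => ?_
  by_cases hξ : ξ = 0
  · subst hξ
    have h0 : xiChart n k 0 = OnePoint.infty := by rw [xiChart, if_pos rfl]
    rw [h0]
    intro V hV
    obtain ⟨δ, hδ, hball⟩ := Metric.mem_nhds_iff.1 (mem_map.1 hV)
    set M : ℝ := (((δ / 2) ^ 2) ^ k)⁻¹ with hM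
    have hopen : IsOpen (((fun x : TautPow n k => (x : OnePoint (TautPow n k))) ''
        {x | fibreSq x ≤ M})ᶜ) := by
      refine OnePoint.isOpen_compl_image_coe.2 ⟨isClosed_le continuous_fibreSq continuous_const,
        isCompact_fibreSq_le M⟩
    refine mem_of_superset (hopen.mem_nhds OnePoint.infty_notMem_image_coe) ?_
    intro y hy
    induction y using OnePoint.rec with
    | infty =>
      have : xiChart n k 0 ∈ V := hball (Metric.mem_ball_self hδ)
      rwa [h0] at this
    | coe x =>
      have hx : M < fibreSq x := by
        by_contra hcon
        exact hy ⟨x, not_lt.1 hcon, rfl⟩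
      have hM0 : 0 < M := by positivity
      obtain ⟨ξ, hξ, rfl⟩ := exists_xiMap_eq hk (hM0.trans hx).ne'
      rw [← xiChart_of_ne hξ]
      refine hball (mem_ball_zero_iff.2 ?_)
      rw [fibreSq_xiMap hξ, hM] at hx
      have h1 := (inv_lt_inv₀ (by positivity) (pow_pos (radSq_pos.2 hξ) k)).1 hx
      have h2 := lt_of_pow_lt_pow_left₀ k (by positivity) h1
      have h3 := norm_le_of_radSq_le (by positivity) h2.le
      linarith
  · exact (map_xiChart_nhds hk hξ).ge

omit [NeZero n] in
theorem radInv_smul {ζ : ℂ} (hζ : Complex.normSq ζ = 1) (ξ : Fin n → ℂ) :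
    radInv (ζ • ξ) = ζ • radInv ξ := by
  rw [radInv, radInv, radSq_smul, hζ, one_mul, smul_comm]

theorem xiChart_fibre (hk : k ≠ 0) (ξ η : Fin n → ℂ) :
    xiChart n k ξ = xiChart n k η ↔ ∃ ζ : ℂ, ζ ^ k = 1 ∧ η = ζ • ξ := by
  have hinf : xiChart n k 0 = OnePoint.infty := by rw [xiChart, if_pos rfl]
  by_cases hξ : ξ = 0
  · subst hξ
    by_cases hη : η = 0
    · subst hη
      exact ⟨fun _ => ⟨1, by simp, by simp⟩, fun _ => rfl⟩
    · rw [hinf, xiChart_of_ne hη]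
      refine ⟨fun h => absurd h.symm (OnePoint.coe_ne_infty _), ?_⟩
      rintro ⟨ζ, -, h⟩
      exact absurd (h.trans (smul_zero ζ)) hη
  · by_cases hη : η = 0
    · subst hη
      rw [hinf, xiChart_of_ne hξ]
      refine ⟨fun h => absurd h (OnePoint.coe_ne_infty _), ?_⟩
      rintro ⟨ζ, h1, h2⟩
      rcases smul_eq_zero.1 h2.symm with h | h
      · rw [h, zero_pow hk] at h1; exact absurd h1 zero_ne_one
      · exact absurd h hξ
    · rw [xiChart_of_ne hξ, xiChart_of_ne hη, OnePoint.coe_eq_coe, xiMap, xiMap,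
        tensorPow_eq_iff (radInv_ne_zero hξ) (radInv_ne_zero hη) hk]
      have hz : ∀ ζ : ℂ, ζ ^ k = 1 → Complex.normSq ζ = 1 := by
        intro ζ h
        rw [Complex.normSq_eq_norm_sq, Complex.norm_eq_one_of_pow_eq_one h hk, one_pow]
      constructor
      · rintro ⟨ζ, h1, h2⟩
        refine ⟨ζ, h1, ?_⟩
        rw [← radInv_radInv η, h2, radInv_smul (hz ζ h1), radInv_radInv]
      · rintro ⟨ζ, h1, rfl⟩
        exact ⟨ζ, h1, radInv_smul (hz ζ h1) ξ⟩

end Topo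

/-! ### Lengths of curves and the Riemannian distance -/

section Distance

variable {n k : ℕ}

/-- The velocity of a curve. -/
def velocity (γ : ℝ → TautPow n k) (t : ℝ) : TautTangent (γ t) :=
  mfderiv 𝓘(ℝ, ℝ) 𝓘(ℝ, Fin n → ℂ) γ t (1 : ℝ)

/-- The speed of a curve with respect to the metric `g`. -/
def curveSpeed (g : TautMetric n k) (γ : ℝ → TautPow n k) (t : ℝ) : ℝ :=
  √(g.inner (γ t) (velocity γ t) (velocity γ t))

theorem pathELength_eq (g : TautMetric n k) (γ : ℝ → TautPow n k) (a b : ℝ) :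
    letI : RiemannianBundle (fun x : TautPow n k => TautTangent x) := ⟨g.toRiemannianMetric⟩
    Manifold.pathELength 𝓘(ℝ, Fin n → ℂ) γ a b
      = ∫⁻ t in Icc a b, ENNReal.ofReal (curveSpeed g γ t) := by
  let : RiemannianBundle (fun x : TautPow n k => TautTangent x) := ⟨g.toRiemannianMetric⟩
  rw [Manifold.pathELength_eq_lintegral_mfderiv_Icc]
  refine MeasureTheory.lintegral_congr fun t => ?_
  rw [← ofReal_norm, norm_eq_sqrt_real_inner]
  rfl

theorem riemDist_le_lintegral (g : TautMetric n k) {γ : ℝ → TautPow n k} {a b : ℝ} (hab : a ≤ b)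
    (hγ : ContMDiffOn 𝓘(ℝ, ℝ) 𝓘(ℝ, Fin n → ℂ) 1 γ (Icc a b)) :
    riemDist g (γ a) (γ b) ≤ ∫⁻ t in Icc a b, ENNReal.ofReal (curveSpeed g γ t) := by
  rw [← pathELength_eq]
  let : RiemannianBundle (fun x : TautPow n k => TautTangent x) := ⟨g.toRiemannianMetric⟩
  exact Manifold.riemannianEDist_le_pathELength hγ rfl rfl hab

theorem riemDist_le_of_curveSpeed_le (g : TautMetric n k) {γ : ℝ → TautPow n k} {a b C : ℝ}
    (hab : a ≤ b) (hγ : ContMDiffOn 𝓘(ℝ, ℝ) 𝓘(ℝ, Fin n → ℂ) 1 γ (Icc a b)) (hC : 0 ≤ C)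
    (h : ∀ t ∈ Icc a b, curveSpeed g γ t ≤ C) :
    riemDist g (γ a) (γ b) ≤ ENNReal.ofReal (C * (b - a)) := by
  refine (riemDist_le_lintegral g hab hγ).trans ?_
  refine (MeasureTheory.setLIntegral_mono measurable_const
    fun t ht => ENNReal.ofReal_le_ofReal (h t ht)).trans ?_
  rw [MeasureTheory.setLIntegral_const, Real.volume_Icc, ENNReal.ofReal_mul hC]

theorem exists_curve_of_riemDist_lt (g : TautMetric n k) {x y : TautPow n k} {r : ENNReal}
    (h : riemDist g x y < r) : ∃ γ : ℝ → TautPow n k, γ 0 = x ∧ γ 1 = y ∧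
      ContMDiff 𝓘(ℝ, ℝ) 𝓘(ℝ, Fin n → ℂ) 1 γ ∧
      ∫⁻ t in Icc (0 : ℝ) 1, ENNReal.ofReal (curveSpeed g γ t) < r := by
  let : RiemannianBundle (fun x : TautPow n k => TautTangent x) := ⟨g.toRiemannianMetric⟩
  obtain ⟨γ, h0, h1, hγ, hl, -, -⟩ :=
    Manifold.exists_lt_locally_constant_of_riemannianEDist_lt (I := 𝓘(ℝ, Fin n → ℂ)) h
      zero_lt_one
  refine ⟨γ, h0, h1, hγ, ?_⟩
  rw [← pathELength_eq]
  exact hl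

theorem riemDist_triangle (g : TautMetric n k) (x y z : TautPow n k) :
    riemDist g x z ≤ riemDist g x y + riemDist g y z := by
  let : RiemannianBundle (fun x : TautPow n k => TautTangent x) := ⟨g.toRiemannianMetric⟩
  exact Manifold.riemannianEDist_triangle

theorem riemDist_comm (g : TautMetric n k) (x y : TautPow n k) :
    riemDist g x y = riemDist g y x := by
  let : RiemannianBundle (fun x : TautPow n k => TautTangent x) := ⟨g.toRiemannianMetric⟩
  exact Manifold.riemannianEDist_comm

theorem riemDist_self (g : TautMetric n k) (x : TautPow n k) : riemDist g x x = 0 := by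
  let : RiemannianBundle (fun x : TautPow n k => TautTangent x) := ⟨g.toRiemannianMetric⟩
  exact Manifold.riemannianEDist_self

theorem eventually_riemDist_lt (g : TautMetric n k) (x : TautPow n k) {c : ENNReal} (hc : 0 < c) :
    ∀ᶠ y in 𝓝 x, riemDist g x y < c := by
  let : RiemannianBundle (fun x : TautPow n k => TautTangent x) := ⟨g.toRiemannianMetric⟩
  have : IsContinuousRiemannianBundle (Fin n → ℂ) (fun x : TautPow n k => TautTangent x) :=
    ⟨⟨g.inner, g.contMDiff.continuous, fun _ _ _ => rfl⟩⟩
  exact eventually_riemannianEDist_lt 𝓘(ℝ, Fin n → ℂ) x hc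

variable [NeZero n]

theorem riemDist_lt_top (g : TautMetric n k) (x y : TautPow n k) : riemDist g x y < ⊤ := by
  have h : IsClopen {y | riemDist g x y < ⊤} := by
    constructor
    · refine isOpen_compl_iff.1 (isOpen_iff_mem_nhds.2 fun y hy => ?_)
      filter_upwards [eventually_riemDist_lt g y ENNReal.zero_lt_top] with z hz hxz
      refine hy ((riemDist_triangle g x z y).trans_lt (ENNReal.add_lt_top.2 ⟨hxz, ?_⟩))
      rwa [riemDist_comm]
    · refine isOpen_iff_mem_nhds.2 fun y hy => ?_
      filter_upwards [eventually_riemDist_lt g y ENNReal.zero_lt_top] with z hz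
      exact (riemDist_triangle g x y z).trans_lt (ENNReal.add_lt_top.2 ⟨hy, hz⟩)
  have h1 := h.eq_univ ⟨x, by simp [riemDist_self]⟩
  have : y ∈ {y | riemDist g x y < ⊤} := h1 ▸ mem_univ y
  exact this

theorem exists_riemDist_le_of_isCompact (g : TautMetric n k) (x : TautPow n k)
    {K : Set (TautPow n k)} (hK : IsCompact K) :
    ∃ D : ℝ, ∀ y ∈ K, riemDist g x y ≤ ENNReal.ofReal D := by
  refine hK.induction_on (p := fun s => ∃ D : ℝ, ∀ y ∈ s, riemDist g x y ≤ ENNReal.ofReal D)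
    ⟨0, by simp⟩ ?_ ?_ ?_
  · rintro s t hst ⟨D, hD⟩
    exact ⟨D, fun y hy => hD y (hst hy)⟩
  · rintro s t ⟨D, hD⟩ ⟨D', hD'⟩
    refine ⟨max D D', ?_⟩
    rintro y (hy | hy)
    · exact (hD y hy).trans (ENNReal.ofReal_le_ofReal (le_max_left _ _))
    · exact (hD' y hy).trans (ENNReal.ofReal_le_ofReal (le_max_right _ _))
  · intro y _
    refine ⟨_, mem_nhdsWithin_of_mem_nhds (eventually_riemDist_lt g y one_pos),
      (riemDist g x y + 1).toReal, fun z hz => ?_⟩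
    have hz' : riemDist g y z < 1 := hz
    rw [ENNReal.ofReal_toReal (ENNReal.add_lt_top.2 ⟨riemDist_lt_top g x y, by simp⟩).ne]
    exact (riemDist_triangle g x y z).trans (by gcongr)

end Distance

/-! ### Horizontal arcs in the level sets of `𝐳` -/

/-- Orthogonality for the Hermitian inner product of `ℂⁿ`. -/
def HermOrth {n : ℕ} (a b : Fin n → ℂ) : Prop := rin a b = 0 ∧ rin a (Complex.I • b) = 0

theorem HermOrth.symm {n : ℕ} {a b : Fin n → ℂ} (h : HermOrth a b) : HermOrth b a := by
  refine ⟨by rw [rin_comm, h.1], ?_⟩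
  have := rin_I_left a b
  rw [h.2, rin_comm] at this
  simpa using this

theorem HermOrth.smul_right {n : ℕ} {a b : Fin n → ℂ} (h : HermOrth a b) (u : ℂ) :
    HermOrth a (u • b) := by
  have e : u • b = u.re • b + u.im • Complex.I • b := by
    ext i
    simp only [Pi.smul_apply, Pi.add_apply, smul_eq_mul, Complex.real_smul]
    conv_lhs => rw [← Complex.re_add_im u]
    ring
  have e' : Complex.I • u • b = u.re • Complex.I • b - u.im • b := by
    rw [e, smul_add, smul_comm Complex.I, smul_comm Complex.I u.im, I_smul_I_smul, smul_neg,
      sub_eq_add_neg]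
  constructor
  · rw [e, map_add, map_smul (rin a) u.re, map_smul (rin a) u.im, h.1, h.2]; simp
  · rw [e', map_sub, map_smul (rin a) u.re, map_smul (rin a) u.im, h.1, h.2]; simp

theorem exists_hermOrth {n : ℕ} (hn : 2 ≤ n) (z : Fin n → ℂ) : ∃ b, b ≠ 0 ∧ HermOrth z b := by
  by_cases hz : z = 0
  · refine ⟨Pi.single ⟨0, by omega⟩ 1, by simp, ?_⟩
    simp [hz, HermOrth]
  obtain ⟨j, hj⟩ := Function.ne_iff.1 hz
  have hj' : z j ≠ 0 := hj
  obtain ⟨i, hij⟩ := exists_ne_index hn j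
  refine ⟨Pi.single i (starRingEnd ℂ (z j)) - Pi.single j (starRingEnd ℂ (z i)), ?_, ?_⟩
  · intro h
    have := congrFun h i
    simp [hij, hj'] at this
  · constructor
    · rw [map_sub, rin_single, rin_single]
      simp; ring
    · rw [smul_sub, map_sub, ← Pi.single_smul, ← Pi.single_smul, rin_single, rin_single]
      simp; ring

/-- Decomposition of a vector of length `√s` along another one. -/
theorem exists_hermOrth_decomp {n : ℕ} (hn : 2 ≤ n) {z w : Fin n → ℂ} {s : ℝ} (hs : 0 < s)
    (hz : radSq z = s) (hw : radSq w = s) :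
    ∃ (u : ℂ) (b : Fin n → ℂ) (θ : ℝ), Complex.normSq u = 1 ∧ radSq b = s ∧ HermOrth z b ∧
      θ ∈ Icc 0 Real.pi ∧ w = Real.cos θ • u • z + Real.sin θ • b := by
  set h : ℂ := ⟨rin z w / s, -(rin z (Complex.I • w) / s)⟩ with hh
  set r := w - h • z with hr
  have ehz : h • z = h.re • z + h.im • Complex.I • z := by
    ext i
    simp only [Pi.smul_apply, Pi.add_apply, smul_eq_mul, Complex.real_smul]
    conv_lhs => rw [← Complex.re_add_im h]
    ring
  have hort : HermOrth z r := by
    constructor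
    · rw [hr, ehz, map_sub, map_add, map_smul (rin z) h.re, map_smul (rin z) h.im, rin_self,
        rin_self_I, hz, hh]
      simp only [smul_eq_mul]
      field_simp
      ring
    · rw [hr, ehz, smul_sub, smul_add, smul_comm Complex.I h.re, smul_comm Complex.I h.im,
        I_smul_I_smul, map_sub, map_add, map_smul (rin z) h.re, map_smul (rin z) h.im, map_neg,
        rin_self, rin_self_I, hz, hh]
      simp only [smul_eq_mul]
      field_simp
      ring
  have hwr : w = h • z + r := by rw [hr]; abel
  have hpy : s = Complex.normSq h * s + radSq r := by
    have h1 := (hort.symm.smul_right h).1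
    have h2 : rin (h • z) r = 0 := by rw [rin_comm]; exact h1
    conv_lhs => rw [← hw, ← rin_self, hwr]
    rw [map_add, map_add, add_apply, add_apply, h1, h2, rin_self, rin_self, radSq_smul, hz]
    ring
  obtain ⟨b, ρ, hb, hzb, hρ, hrb⟩ : ∃ (b : Fin n → ℂ) (ρ : ℝ), radSq b = s ∧ HermOrth z b ∧
      0 ≤ ρ ∧ r = ρ • b := by
    have key : ∀ v : Fin n → ℂ, v ≠ 0 → HermOrth z v → ∃ b : Fin n → ℂ, radSq b = s ∧
        HermOrth z b ∧ v = √(radSq v / s) • b := by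
      intro v hv hzv
      have hv0 := radSq_pos.2 hv
      have hq : 0 < √(radSq v / s) := Real.sqrt_pos.2 (div_pos hv0 hs)
      refine ⟨(√(radSq v / s))⁻¹ • v, ?_, ⟨?_, ?_⟩, ?_⟩
      · rw [radSq_real_smul, inv_pow, Real.sq_sqrt (by positivity)]
        field_simp
      · rw [map_smul, hzv.1, smul_zero]
      · rw [smul_comm, map_smul, hzv.2, smul_zero]
      · rw [smul_smul, mul_inv_cancel₀ hq.ne', one_smul]
    by_cases hr0 : r = 0
    · obtain ⟨v, hv, hzv⟩ := exists_hermOrth hn z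
      obtain ⟨b, hb, hzb, -⟩ := key v hv hzv
      exact ⟨b, 0, hb, hzb, le_rfl, by simp [hr0]⟩
    · obtain ⟨b, hb, hzb, e⟩ := key r hr0 hort
      exact ⟨b, _, hb, hzb, Real.sqrt_nonneg _, e⟩
  obtain ⟨u, hu, hhu⟩ : ∃ u : ℂ, Complex.normSq u = 1 ∧ h = (‖h‖ : ℂ) * u := by
    by_cases h0 : h = 0
    · exact ⟨1, by simp, by simp [h0]⟩
    · have hn0 : (‖h‖ : ℂ) ≠ 0 := by simpa using h0
      refine ⟨h / ‖h‖, ?_, by field_simp⟩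
      rw [Complex.normSq_eq_norm_sq, norm_div]
      simp [h0]
  have hρ2 : ‖h‖ ^ 2 + ρ ^ 2 = 1 := by
    rw [hrb, radSq_real_smul, hb, Complex.normSq_eq_norm_sq] at hpy
    have : (‖h‖ ^ 2 + ρ ^ 2 - 1) * s = 0 := by linarith
    rcases mul_eq_zero.1 this with h1 | h1
    · linarith
    · exact absurd h1 hs.ne'
  have hle : ‖h‖ ≤ 1 := by nlinarith [norm_nonneg h, sq_nonneg ρ]
  refine ⟨u, b, Real.arccos ‖h‖, hu, hb, hzb, ⟨Real.arccos_nonneg _, Real.arccos_le_pi _⟩, ?_⟩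
  rw [Real.cos_arccos (by linarith [norm_nonneg h]) hle, Real.sin_arccos,
    show 1 - ‖h‖ ^ 2 = ρ ^ 2 by linarith, Real.sqrt_sq hρ, ← hrb, hwr]
  congr 1
  conv_lhs => rw [hhu]
  ext i
  simp [mul_assoc]

/-- The great circle through `a` and `b`. -/
def greatCircle {n : ℕ} (a b : Fin n → ℂ) (θ : ℝ) : Fin n → ℂ := Real.cos θ • a + Real.sin θ • b

section GreatCircle

variable {n k : ℕ} {a b : Fin n → ℂ} {s : ℝ}

theorem radSq_greatCircle (ha : radSq a = s) (hb : radSq b = s) (hab : HermOrth a b) (θ : ℝ) :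
    radSq (greatCircle a b θ) = s := by
  have h := Real.sin_sq_add_cos_sq θ
  rw [← rin_self, greatCircle]
  simp only [map_add, map_smul, add_apply, smul_apply, smul_eq_mul, rin_self, ha, hb, hab.1,
    hab.symm.1]
  linear_combination s * h

theorem hasDerivAt_greatCircle (a b : Fin n → ℂ) (θ : ℝ) :
    HasDerivAt (greatCircle a b) (-Real.sin θ • a + Real.cos θ • b) θ :=
  ((Real.hasDerivAt_cos θ).smul_const a).add ((Real.hasDerivAt_sin θ).smul_const b)

theorem contDiff_greatCircle (a b : Fin n → ℂ) : ContDiff ℝ ∞ (greatCircle a b) :=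
  (Real.contDiff_cos.smul contDiff_const).add (Real.contDiff_sin.smul contDiff_const)

variable [NeZero n]

omit [NeZero n] in
theorem greatCircle_ne_zero (hs : 0 < s) (ha : radSq a = s) (hb : radSq b = s)
    (hab : HermOrth a b) (θ : ℝ) : greatCircle a b θ ≠ 0 :=
  radSq_pos.1 (by rw [radSq_greatCircle ha hb hab]; exact hs)

theorem contMDiff_tensorPow_greatCircle (hs : 0 < s) (ha : radSq a = s) (hb : radSq b = s)
    (hab : HermOrth a b) :
    ContMDiff 𝓘(ℝ, ℝ) 𝓘(ℝ, Fin n → ℂ) ∞ (fun θ => tensorPow n k (greatCircle a b θ)) := fun θ =>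
  (contMDiffAt_tensorPow (greatCircle_ne_zero hs ha hb hab θ)).comp θ
    (contDiff_greatCircle a b).contMDiff.contMDiffAt

/-- Great circles through Hermitian orthogonal vectors are horizontal: their speed is controlled
by `𝐳 φ'(𝐳)`. -/
theorem curveSpeed_greatCircle {g : TautMetric n k} {φ : ℝ → ℝ} (hg : ArisesFrom g φ)
    (hs : 0 < s) (ha : radSq a = s) (hb : radSq b = s) (hab : HermOrth a b) (θ : ℝ) :
    curveSpeed g (fun θ => tensorPow n k (greatCircle a b θ)) θ = √(2 * (s * deriv φ s)) := by
  have h0 := greatCircle_ne_zero hs ha hb hab θ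
  have hrs := radSq_greatCircle ha hb hab θ
  set v := -Real.sin θ • a + Real.cos θ • b with hv
  have hvel : velocity (fun θ => tensorPow n k (greatCircle a b θ)) θ
      = tautDiff (tensorPow n k) (greatCircle a b θ) v := by
    have h1 := mfderiv_comp θ (mdifferentiableAt_tensorPow (k := k) h0)
      ((contDiff_greatCircle a b).contMDiff.contMDiffAt.mdifferentiableAt (x := θ) (by simp))
    rw [mfderiv_eq_fderiv] at h1
    refine (DFunLike.congr_fun h1 (1 : ℝ)).trans ?_
    have h2 : fderiv ℝ (greatCircle a b) θ 1 = v := by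
      rw [(hasDerivAt_greatCircle a b θ).hasFDerivAt.fderiv]; simp [hv]
    change mfderiv 𝓘(ℝ, Fin n → ℂ) 𝓘(ℝ, Fin n → ℂ) (tensorPow n k) (greatCircle a b θ)
      (fderiv ℝ (greatCircle a b) θ 1) = _
    rw [h2]
    rfl
  have hrv : radSq v = s := by
    have h := Real.sin_sq_add_cos_sq θ
    rw [← rin_self, hv]
    simp only [map_add, map_smul, add_apply, smul_apply, smul_eq_mul, rin_self, ha, hb,
      hab.1, hab.symm.1]
    linear_combination s * h
  have h1 : rin (greatCircle a b θ) v = 0 := by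
    rw [greatCircle, hv]
    simp only [map_add, map_smul, add_apply, smul_apply, smul_eq_mul, rin_self, ha,
      hb, hab.1, hab.symm.1]
    ring
  have h2 : rin (greatCircle a b θ) (Complex.I • v) = 0 := by
    have e : Complex.I • v = -Real.sin θ • Complex.I • a + Real.cos θ • Complex.I • b := by
      rw [hv, smul_add, smul_comm Complex.I, smul_comm Complex.I]
    rw [greatCircle, e]
    simp only [map_add, map_smul, add_apply, smul_apply, smul_eq_mul, rin_self_I,
      hab.2, hab.symm.2]
    ring
  rw [curveSpeed, hvel]
  have := metric_tensorPow_horizontal hg h0 h1 h2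
  rw [pullForm, hrs, hrv] at this
  rw [this]
  congr 1
  ring

/-- Two points that are joined by a horizontal great circle in the level set `𝐳 = s`. -/
def ArcJoined (s : ℝ) (x y : TautPow n k) : Prop :=
  ∃ (a b : Fin n → ℂ) (θ : ℝ), radSq a = s ∧ radSq b = s ∧ HermOrth a b ∧ θ ∈ Icc 0 Real.pi ∧
    x = tensorPow n k (greatCircle a b 0) ∧ y = tensorPow n k (greatCircle a b θ)

/-- Any two points of a level set of `𝐳` are joined by three horizontal great circles. -/
theorem exists_arcJoined (hn : 2 ≤ n) (hk : k ≠ 0) {s : ℝ} (hs : 0 < s) {x y : TautPow n k}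
    (hx : fibreSq x = s ^ k) (hy : fibreSq y = s ^ k) :
    ∃ x₁ x₂, ArcJoined s x x₁ ∧ ArcJoined s x₁ x₂ ∧ ArcJoined s x₂ y := by
  have hsk : s ^ k ≠ 0 := by positivity
  obtain ⟨z, hz, rfl⟩ := exists_tensorPow_eq hk (hx.trans_ne hsk)
  obtain ⟨w, hw, rfl⟩ := exists_tensorPow_eq hk (hy.trans_ne hsk)
  rw [fibreSq_tensorPow hz] at hx
  rw [fibreSq_tensorPow hw] at hy
  have hzs := (pow_left_inj₀ (radSq_nonneg z) hs.le hk).1 hx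
  have hws := (pow_left_inj₀ (radSq_nonneg w) hs.le hk).1 hy
  obtain ⟨u, b, θ, hu, hb, hzb, hθ, e⟩ := exists_hermOrth_decomp hn hs hzs hws
  have hpi : Real.pi / 2 ∈ Icc 0 Real.pi := ⟨by positivity, by linarith [Real.pi_pos]⟩
  have huz : radSq (u • z) = s := by rw [radSq_smul, hu, hzs, one_mul]
  refine ⟨tensorPow n k b, tensorPow n k (u • z), ⟨z, b, Real.pi / 2, hzs, hb, hzb, hpi, ?_, ?_⟩,
    ⟨b, u • z, Real.pi / 2, hb, huz, hzb.symm.smul_right u, hpi, ?_, ?_⟩,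
    ⟨u • z, b, θ, huz, hb, (hzb.symm.smul_right u).symm, hθ, ?_, ?_⟩⟩
  · simp [greatCircle]
  · simp [greatCircle]
  · simp [greatCircle]
  · simp [greatCircle]
  · simp [greatCircle]
  · rw [e]; rfl

theorem ArcJoined.riemDist_le {g : TautMetric n k} {φ : ℝ → ℝ} (hg : ArisesFrom g φ) {s : ℝ}
    (hs : 0 < s) {x y : TautPow n k} (h : ArcJoined s x y) :
    riemDist g x y ≤ ENNReal.ofReal (√(2 * (s * deriv φ s)) * Real.pi) := by
  obtain ⟨a, b, θ, ha, hb, hab, hθ, rfl, rfl⟩ := h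
  refine (riemDist_le_of_curveSpeed_le g hθ.1
    ((contMDiff_tensorPow_greatCircle hs ha hb hab).of_le (by norm_cast)).contMDiffOn
    (Real.sqrt_nonneg _) fun t _ => (curveSpeed_greatCircle hg hs ha hb hab t).le).trans ?_
  refine ENNReal.ofReal_le_ofReal ?_
  have := hθ.2
  rw [sub_zero]
  gcongr

end GreatCircle

/-! ### Functions of bounded gradient -/

section Gradient

variable {n k : ℕ}

/-- At the point `x`, the function `Q` is differentiable with gradient of length at most `C`. -/
def GradBoundAt (g : TautMetric n k) (Q : TautPow n k → ℝ) (C : ℝ) (x : TautPow n k) : Prop :=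
  MDifferentiableAt 𝓘(ℝ, Fin n → ℂ) 𝓘(ℝ, ℝ) Q x ∧ ∀ v : TautTangent x,
    |(show ℝ from mfderiv 𝓘(ℝ, Fin n → ℂ) 𝓘(ℝ, ℝ) Q x v)| ≤ C * √(g.inner x v v)

theorem GradBoundAt.of_eventuallyEq_const {g : TautMetric n k} {Q : TautPow n k → ℝ} {C : ℝ}
    (hC : 0 ≤ C) {x : TautPow n k} {c : ℝ} (h : ∀ᶠ y in 𝓝 x, Q y = c) : GradBoundAt g Q C x := by
  have hd : HasMFDerivAt 𝓘(ℝ, Fin n → ℂ) 𝓘(ℝ, ℝ) Q x 0 :=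
    (hasMFDerivAt_const c x).congr_of_eventuallyEq h
  refine ⟨hd.mdifferentiableAt, fun v => ?_⟩
  rw [hd.mfderiv]
  refine (abs_zero (α := ℝ)).le.trans ?_
  positivity

/-- The variation of a function along a curve is bounded by the length of the curve and the
gradient of the function. -/
theorem ofReal_abs_sub_le_lintegral {g : TautMetric n k} {Q : TautPow n k → ℝ} {C : ℝ}
    (hC : 0 ≤ C) {γ : ℝ → TautPow n k} {a b : ℝ} (hab : a ≤ b)
    (hγ : ContMDiff 𝓘(ℝ, ℝ) 𝓘(ℝ, Fin n → ℂ) 1 γ)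
    (hQ : ∀ t ∈ Icc a b, GradBoundAt g Q C (γ t)) :
    ENNReal.ofReal |Q (γ b) - Q (γ a)|
      ≤ ENNReal.ofReal C * ∫⁻ t in Icc a b, ENNReal.ofReal (curveSpeed g γ t) := by
  by_cases htop : ENNReal.ofReal C * ∫⁻ t in Icc a b, ENNReal.ofReal (curveSpeed g γ t) = ⊤
  · rw [htop]; exact le_top
  have hd : ∀ t ∈ Icc a b, HasDerivAt (Q ∘ γ) (deriv (Q ∘ γ) t) t ∧
      |deriv (Q ∘ γ) t| ≤ C * curveSpeed g γ t := by
    intro t ht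
    obtain ⟨hL, hb⟩ := hQ t ht
    have hm := hγ.contMDiffAt.mdifferentiableAt (x := t) (by simp)
    refine ⟨(hL.comp t hm).differentiableAt.hasDerivAt, ?_⟩
    have h1 := mfderiv_comp t hL hm
    rw [mfderiv_eq_fderiv] at h1
    have h2 : deriv (Q ∘ γ) t = mfderiv 𝓘(ℝ, Fin n → ℂ) 𝓘(ℝ, ℝ) Q (γ t) (velocity γ t) :=
      DFunLike.congr_fun h1 (1 : ℝ)
    rw [h2]
    exact hb (velocity γ t)
  have hle : ∫⁻ t in Icc a b, ‖deriv (Q ∘ γ) t‖ₑ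
      ≤ ENNReal.ofReal C * ∫⁻ t in Icc a b, ENNReal.ofReal (curveSpeed g γ t) := by
    rw [← MeasureTheory.lintegral_const_mul' _ _ ENNReal.ofReal_ne_top]
    refine MeasureTheory.setLIntegral_mono' measurableSet_Icc fun t ht => ?_
    rw [← ENNReal.ofReal_mul hC, ← ofReal_norm]
    exact ENNReal.ofReal_le_ofReal (hd t ht).2
  have hint : MeasureTheory.IntegrableOn (deriv (Q ∘ γ)) (Icc a b) :=
    ⟨(measurable_deriv _).aestronglyMeasurable, lt_of_le_of_lt hle (lt_top_iff_ne_top.2 htop)⟩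
  have hftc := intervalIntegral.integral_eq_sub_of_hasDerivAt (f := Q ∘ γ)
    (f' := deriv (Q ∘ γ)) (a := a) (b := b) (by rw [uIcc_of_le hab]; exact fun t ht => (hd t ht).1)
    ((intervalIntegrable_iff_integrableOn_Icc_of_le hab).2 hint)
  rw [intervalIntegral.integral_of_le hab] at hftc
  calc ENNReal.ofReal |Q (γ b) - Q (γ a)| = ‖∫ t in Ioc a b, deriv (Q ∘ γ) t‖ₑ := by
        rw [hftc, ← ofReal_norm]; rfl
    _ ≤ ∫⁻ t in Ioc a b, ‖deriv (Q ∘ γ) t‖ₑ := MeasureTheory.enorm_integral_le_lintegral_enorm _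
    _ ≤ ∫⁻ t in Icc a b, ‖deriv (Q ∘ γ) t‖ₑ :=
        MeasureTheory.lintegral_mono_set Ioc_subset_Icc_self
    _ ≤ _ := hle

/-- The inverse function theorem for maps into `𝒪(-k)`. -/
theorem exists_local_section {E : Type*} [NormedAddCommGroup E] [NormedSpace ℝ E]
    [CompleteSpace E] {Ψ : E → TautPow n k} {y : E}
    (hΨ : ContMDiffAt 𝓘(ℝ, E) 𝓘(ℝ, Fin n → ℂ) ∞ Ψ y)
    (hb : Function.Bijective (mfderiv 𝓘(ℝ, E) 𝓘(ℝ, Fin n → ℂ) Ψ y)) :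
    ∃ G : TautPow n k → E, MDifferentiableAt 𝓘(ℝ, Fin n → ℂ) 𝓘(ℝ, E) G (Ψ y) ∧ G (Ψ y) = y ∧
      ∀ᶠ x in 𝓝 (Ψ y), Ψ (G x) = x := by
  set j := (Ψ y).idx with hj
  have hsrc : Ψ y ∈ TautPow.chartSource j := TautPow.mem_chartSource_idx (Ψ y)
  set F : E → (Fin n → ℂ) := fun x => TautPow.chartFun j (Ψ x) with hF
  have hFc : ContDiffAt ℝ ∞ F y :=
    ((TautPow.contMDiffAt_chartFun hsrc).comp y hΨ).contDiffAt
  have hm : mfderiv 𝓘(ℝ, E) 𝓘(ℝ, Fin n → ℂ) Ψ y = fderiv ℝ F y := by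
    rw [(hΨ.mdifferentiableAt (by simp)).mfderiv]
    simp only [writtenInExtChartAt, mfld_simps, fderivWithin_univ]
    rfl
  have hbF : Function.Bijective (fderiv ℝ F y) := by rw [hm] at hb; exact hb
  set e := ContinuousLinearEquiv.ofBijective (fderiv ℝ F y) (LinearMap.ker_eq_bot.2 hbF.1)
    (LinearMap.range_eq_top.2 hbF.2) with he
  have hs : HasStrictFDerivAt F (e : E →L[ℝ] (Fin n → ℂ)) y := by
    rw [he, ContinuousLinearEquiv.coe_ofBijective]
    exact hFc.hasStrictFDerivAt (by simp)
  have hcy : ContinuousAt Ψ y := hΨ.continuousAt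
  have hcc : ContinuousAt (TautPow.chartFun j) (Ψ y) :=
    (TautPow.contMDiffAt_chartFun hsrc).continuousAt
  refine ⟨hs.localInverse F e y ∘ TautPow.chartFun j, ?_, hs.localInverse_apply_image, ?_⟩
  · exact (hs.to_localInverse.hasFDerivAt.differentiableAt.mdifferentiableAt).comp (Ψ y)
      ((TautPow.contMDiffAt_chartFun hsrc).mdifferentiableAt (by simp))
  · have h1 : ∀ᶠ x in 𝓝 (Ψ y), F (hs.localInverse F e y (TautPow.chartFun j x))
        = TautPow.chartFun j x := hcc.eventually hs.eventually_right_inverse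
    have h2 : ∀ᶠ x in 𝓝 (Ψ y), Ψ (hs.localInverse F e y (TautPow.chartFun j x))
        ∈ TautPow.chartSource j :=
      hcc.eventually (hs.localInverse_tendsto.eventually
        (hcy.eventually ((TautPow.isOpen_chartSource j).mem_nhds hsrc)))
    filter_upwards [h1, h2, (TautPow.isOpen_chartSource j).mem_nhds hsrc] with x hx1 hx2 hx3
    have := congrArg (TautPow.chartInv (k := k) j) hx1
    rwa [TautPow.chartInv_chartFun hx3, show F (hs.localInverse F e y (TautPow.chartFun j x))
      = TautPow.chartFun j (Ψ (hs.localInverse F e y (TautPow.chartFun j x))) from rfl,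
      TautPow.chartInv_chartFun hx2] at this

/-- A gradient bound for `Q ∘ Ψ` gives one for `Q`, if the local diffeomorphism `Ψ` shrinks lengths
by at most the factor `√2`. -/
theorem GradBoundAt.of_comp {E : Type*} [NormedAddCommGroup E] [NormedSpace ℝ E]
    [CompleteSpace E] {g : TautMetric n k} {Ψ : E → TautPow n k} {y : E}
    (hΨ : ContMDiffAt 𝓘(ℝ, E) 𝓘(ℝ, Fin n → ℂ) ∞ Ψ y)
    (hb : Function.Bijective (mfderiv 𝓘(ℝ, E) 𝓘(ℝ, Fin n → ℂ) Ψ y))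
    (hlow : ∀ v : E, ‖v‖ ^ 2 ≤ 2 * g.inner (Ψ y) (mfderiv 𝓘(ℝ, E) 𝓘(ℝ, Fin n → ℂ) Ψ y v)
      (mfderiv 𝓘(ℝ, E) 𝓘(ℝ, Fin n → ℂ) Ψ y v))
    {Q : TautPow n k → ℝ} {q : E → ℝ} (hQ : ∀ᶠ x in 𝓝 y, Q (Ψ x) = q x)
    (hq : DifferentiableAt ℝ q y) {C : ℝ} (hC : ‖fderiv ℝ q y‖ ≤ C) :
    GradBoundAt g Q (C * √2) (Ψ y) := by
  obtain ⟨G, hG, hGy, hev⟩ := exists_local_section hΨ hb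
  have hQG : Q =ᶠ[𝓝 (Ψ y)] q ∘ G := by
    have h1 : ∀ᶠ x in 𝓝 (Ψ y), Q (Ψ (G x)) = q (G x) := by
      have := hG.continuousAt.tendsto
      rw [hGy] at this
      exact this.eventually hQ
    filter_upwards [hev, h1] with x hx hx1
    rw [Function.comp_apply, ← hx1, hx]
  have hqG : MDifferentiableAt 𝓘(ℝ, Fin n → ℂ) 𝓘(ℝ, ℝ) (q ∘ G) (Ψ y) := by
    refine MDifferentiableAt.comp (Ψ y) ?_ hG
    rw [hGy]
    exact hq.mdifferentiableAt
  have hQd := hqG.congr_of_eventuallyEq hQG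
  refine ⟨hQd, fun w => ?_⟩
  obtain ⟨v, hv⟩ := hb.2 w
  change E at v
  subst hv
  have h3 := mfderiv_comp y hQd (hΨ.mdifferentiableAt (by simp))
  rw [mfderiv_eq_fderiv, Filter.EventuallyEq.fderiv_eq (show Q ∘ Ψ =ᶠ[𝓝 y] q from hQ)] at h3
  have h4 : mfderiv 𝓘(ℝ, Fin n → ℂ) 𝓘(ℝ, ℝ) Q (Ψ y) (mfderiv 𝓘(ℝ, E) 𝓘(ℝ, Fin n → ℂ) Ψ y v)
      = fderiv ℝ q y v := (DFunLike.congr_fun h3 v).symm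
  rw [h4]
  have h5 := (fderiv ℝ q y).le_of_opNorm_le hC v
  have hC0 : 0 ≤ C := (norm_nonneg _).trans hC
  refine LE.le.trans (b := C * ‖v‖) h5 ?_
  rw [mul_assoc, ← Real.sqrt_mul (by norm_num)]
  gcongr
  exact Real.le_sqrt_of_sq_le (hlow v)

end Gradient

/-! ### The Euclidean end of an ALE metric -/

section EuclideanEnd

variable {n k : ℕ}

/-- The map `Ψ` presents an end of `𝒪(-k)` as the quotient of the exterior of a ball by a finite
group `Γ` of linear isometries, in such a way that `Ψ^* g` and the Euclidean metric are comparable. -/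
structure EuclideanEnd (g : TautMetric n k)
    (Γ : Subgroup (EuclideanSpace ℝ (Fin (2 * n)) ≃ₗᵢ[ℝ] EuclideanSpace ℝ (Fin (2 * n))))
    (R : ℝ) (Ψ : EuclideanSpace ℝ (Fin (2 * n)) → TautPow n k) : Prop where
  finite : Finite Γ
  pos : 0 < R
  smooth : ∀ y, R < ‖y‖ →
    ContMDiffAt 𝓘(ℝ, EuclideanSpace ℝ (Fin (2 * n))) 𝓘(ℝ, Fin n → ℂ) ∞ Ψ y
  bijective : ∀ y, R < ‖y‖ → Function.Bijective
    (mfderiv 𝓘(ℝ, EuclideanSpace ℝ (Fin (2 * n))) 𝓘(ℝ, Fin n → ℂ) Ψ y)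
  fibre : ∀ x y, R < ‖x‖ → R < ‖y‖ → (Ψ x = Ψ y ↔ ∃ γ ∈ Γ, γ x = y)
  lower : ∀ y, R < ‖y‖ → ∀ v : EuclideanSpace ℝ (Fin (2 * n)), ‖v‖ ^ 2 ≤ 2 * g.inner (Ψ y)
    (mfderiv 𝓘(ℝ, EuclideanSpace ℝ (Fin (2 * n))) 𝓘(ℝ, Fin n → ℂ) Ψ y v)
    (mfderiv 𝓘(ℝ, EuclideanSpace ℝ (Fin (2 * n))) 𝓘(ℝ, Fin n → ℂ) Ψ y v)
  upper : ∀ y, R < ‖y‖ → ∀ v : EuclideanSpace ℝ (Fin (2 * n)), g.inner (Ψ y)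
    (mfderiv 𝓘(ℝ, EuclideanSpace ℝ (Fin (2 * n))) 𝓘(ℝ, Fin n → ℂ) Ψ y v)
    (mfderiv 𝓘(ℝ, EuclideanSpace ℝ (Fin (2 * n))) 𝓘(ℝ, Fin n → ℂ) Ψ y v) ≤ 2 * ‖v‖ ^ 2

theorem inner_mfderiv_eq_sum (g : TautMetric n k)
    (Ψ : EuclideanSpace ℝ (Fin (2 * n)) → TautPow n k) (y v : EuclideanSpace ℝ (Fin (2 * n))) :
    g.inner (Ψ y) (mfderiv 𝓘(ℝ, EuclideanSpace ℝ (Fin (2 * n))) 𝓘(ℝ, Fin n → ℂ) Ψ y v)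
      (mfderiv 𝓘(ℝ, EuclideanSpace ℝ (Fin (2 * n))) 𝓘(ℝ, Fin n → ℂ) Ψ y v)
      = ∑ i, ∑ j, v i * v j * metricCoeff g Ψ i j y := by
  let A : EuclideanSpace ℝ (Fin (2 * n)) →L[ℝ] (Fin n → ℂ) :=
    mfderiv 𝓘(ℝ, EuclideanSpace ℝ (Fin (2 * n))) 𝓘(ℝ, Fin n → ℂ) Ψ y
  let B : (Fin n → ℂ) →L[ℝ] (Fin n → ℂ) →L[ℝ] ℝ := g.inner (Ψ y)
  have hv : v = ∑ i, v i • EuclideanSpace.single i (1 : ℝ) := by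
    have := (EuclideanSpace.basisFun (Fin (2 * n)) ℝ).sum_repr v
    simpa using this.symm
  have h1 : A v = ∑ i, v i • A (EuclideanSpace.single i (1 : ℝ)) := by
    conv_lhs => rw [hv]
    simp [map_sum]
  change B (A v) (A v) = ∑ i, ∑ j, v i * v j * B (A (EuclideanSpace.single i (1 : ℝ)))
    (A (EuclideanSpace.single j (1 : ℝ)))
  rw [h1]
  simp only [map_sum, map_smul, sum_apply, smul_apply, smul_eq_mul, Finset.mul_sum]
  rw [Finset.sum_comm]
  refine Finset.sum_congr rfl fun i _ => Finset.sum_congr rfl fun j _ => ?_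
  ring


theorem abs_sum_sub_norm_sq_le {N : ℕ} {a : Fin N → Fin N → ℝ} {ε : ℝ} (hε : 0 ≤ ε)
    (ha : ∀ i j, |a i j - if i = j then 1 else 0| ≤ ε) (v : EuclideanSpace ℝ (Fin N)) :
    |(∑ i, ∑ j, v i * v j * a i j) - ‖v‖ ^ 2| ≤ ε * N * ‖v‖ ^ 2 := by
  have h1 : ‖v‖ ^ 2 = ∑ i, ∑ j, v i * v j * (if i = j then 1 else 0) := by
    rw [EuclideanSpace.real_norm_sq_eq]
    simp [sq]
  have h2 : (∑ i, ∑ j, v i * v j * a i j) - ‖v‖ ^ 2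
      = ∑ i, ∑ j, v i * v j * (a i j - if i = j then 1 else 0) := by
    rw [h1, ← Finset.sum_sub_distrib]
    simp only [← Finset.sum_sub_distrib, mul_sub]
  rw [h2]
  have h3 : |∑ i, ∑ j, v i * v j * (a i j - if i = j then 1 else 0)|
      ≤ ∑ i, ∑ j, |v i| * |v j| * ε := by
    refine (Finset.abs_sum_le_sum_abs _ _).trans (Finset.sum_le_sum fun i _ => ?_)
    refine (Finset.abs_sum_le_sum_abs _ _).trans (Finset.sum_le_sum fun j _ => ?_)
    rw [abs_mul, abs_mul]
    exact mul_le_mul_of_nonneg_left (ha i j) (by positivity)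
  have h4 : ∑ i, ∑ j, |v i| * |v j| * ε = ε * (∑ i, |v i|) ^ 2 := by
    rw [sq, Finset.sum_mul_sum, Finset.mul_sum]
    refine Finset.sum_congr rfl fun i _ => ?_
    rw [Finset.mul_sum]
    exact Finset.sum_congr rfl fun j _ => by ring
  have h5 : (∑ i, |v i|) ^ 2 ≤ N * ‖v‖ ^ 2 := by
    have := sq_sum_le_card_mul_sum_sq (s := Finset.univ) (f := fun i => |v i|)
    rw [EuclideanSpace.real_norm_sq_eq]
    simpa using this
  rw [h4] at h3
  refine h3.trans ?_
  rw [mul_assoc]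
  exact mul_le_mul_of_nonneg_left h5 hε

theorem eventually_abs_metricCoeff_sub_le {g : TautMetric n k} {τ ε : ℝ} (hτ : 0 < τ) (hε : 0 < ε)
    {Ψ : EuclideanSpace ℝ (Fin (2 * n)) → TautPow n k}
    (h : ∀ (i j : Fin (2 * n)) (m : ℕ),
      (fun x => iteratedFDeriv ℝ m (fun y => metricCoeff g Ψ i j y - if i = j then 1 else 0) x)
        =O[Bornology.cobounded _] (fun x => ‖x‖ ^ (-τ - m))) :
    ∃ R₁, ∀ y, R₁ < ‖y‖ → ∀ i j, |metricCoeff g Ψ i j y - if i = j then 1 else 0| ≤ ε := by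
  have h1 : ∀ i j, ∀ᶠ y in Bornology.cobounded (EuclideanSpace ℝ (Fin (2 * n))),
      |metricCoeff g Ψ i j y - if i = j then 1 else 0| ≤ ε := by
    intro i j
    have h0 := h i j 0
    have ht : Tendsto (fun x : EuclideanSpace ℝ (Fin (2 * n)) => ‖x‖ ^ (-τ - (0 : ℕ)))
        (Bornology.cobounded _) (𝓝 0) := by
      simp only [Nat.cast_zero, sub_zero]
      exact (tendsto_rpow_neg_atTop hτ).comp tendsto_norm_cobounded_atTop
    have h2 := (h0.trans_tendsto ht).norm
    simp only [norm_iteratedFDeriv_zero, norm_zero] at h2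
    filter_upwards [h2.eventually (gt_mem_nhds hε)] with y hy
    exact hy.le
  have h2 := eventually_all.2 fun i => eventually_all.2 (h1 i)
  obtain ⟨R₁, -, hR⟩ := hasBasis_cobounded_norm.eventually_iff.1 h2
  exact ⟨R₁, fun y hy => hR hy.le⟩

theorem IsALE.exists_euclideanEnd {g : TautMetric n k} {τ : ℝ} (hτ : 0 < τ) (h : IsALE g τ) :
    ∃ Γ R Ψ, EuclideanEnd g Γ R Ψ := by
  obtain ⟨-, Γ, K, R, Ψ, hf, -, -, -, hR, hs, hb, -, hfib, hdec⟩ := h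
  have hε : (0 : ℝ) < 1 / (2 * ((2 * n : ℕ) + 1)) := by positivity
  obtain ⟨R₁, hR₁⟩ := eventually_abs_metricCoeff_sub_le hτ hε hdec
  have hop : IsOpen {x : EuclideanSpace ℝ (Fin (2 * n)) | R < ‖x‖} :=
    isOpen_lt continuous_const continuous_norm
  have key : ∀ y, R₁ < ‖y‖ → ∀ v : EuclideanSpace ℝ (Fin (2 * n)),
      |g.inner (Ψ y) (mfderiv 𝓘(ℝ, EuclideanSpace ℝ (Fin (2 * n))) 𝓘(ℝ, Fin n → ℂ) Ψ y v)
        (mfderiv 𝓘(ℝ, EuclideanSpace ℝ (Fin (2 * n))) 𝓘(ℝ, Fin n → ℂ) Ψ y v) - ‖v‖ ^ 2|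
        ≤ 1 / 2 * ‖v‖ ^ 2 := by
    intro y hy v
    rw [inner_mfderiv_eq_sum]
    refine (abs_sum_sub_norm_sq_le hε.le (hR₁ y hy) v).trans ?_
    refine mul_le_mul_of_nonneg_right ?_ (by positivity)
    rw [div_mul_eq_mul_div, one_mul, div_le_div_iff₀ (by positivity) (by norm_num)]
    linarith
  refine ⟨Γ, max R R₁, Ψ, hf, lt_max_of_lt_left hR, fun y hy => ?_,
    fun y hy => hb y ((le_max_left _ _).trans_lt hy),
    fun x y hx hy => hfib x y ((le_max_left _ _).trans_lt hx) ((le_max_left _ _).trans_lt hy),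
    fun y hy v => ?_, fun y hy v => ?_⟩
  · exact hs.contMDiffAt (hop.mem_nhds ((le_max_left _ _).trans_lt hy))
  · have := (abs_le.1 (key y ((le_max_right _ _).trans_lt hy) v)).1
    linarith
  · have := (abs_le.1 (key y ((le_max_right _ _).trans_lt hy) v)).2
    linarith [sq_nonneg ‖v‖]

open Classical in
/-- The function on `𝒪(-k)` induced by a function of the Euclidean coordinates `|y| > R` at
infinity, extended by zero. It is meaningful for functions that are constant on the fibres of `Ψ`
(see `EuclideanEnd.descend_eq`). -/
def descend (Ψ : EuclideanSpace ℝ (Fin (2 * n)) → TautPow n k) (R : ℝ)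
    (q : EuclideanSpace ℝ (Fin (2 * n)) → ℝ) (x : TautPow n k) : ℝ :=
  if h : ∃ y, R < ‖y‖ ∧ Ψ y = x then q h.choose else 0

theorem descend_of_not {Ψ : EuclideanSpace ℝ (Fin (2 * n)) → TautPow n k} {R : ℝ}
    (q : EuclideanSpace ℝ (Fin (2 * n)) → ℝ) {x : TautPow n k} (h : ¬∃ y, R < ‖y‖ ∧ Ψ y = x) :
    descend Ψ R q x = 0 := dif_neg h

namespace EuclideanEnd

variable {g : TautMetric n k}
  {Γ : Subgroup (EuclideanSpace ℝ (Fin (2 * n)) ≃ₗᵢ[ℝ] EuclideanSpace ℝ (Fin (2 * n)))} {R : ℝ}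
  {Ψ : EuclideanSpace ℝ (Fin (2 * n)) → TautPow n k}

theorem norm_eq (h : EuclideanEnd g Γ R Ψ) {x y} (hx : R < ‖x‖) (hy : R < ‖y‖) (hxy : Ψ x = Ψ y) :
    ‖x‖ = ‖y‖ := by
  obtain ⟨γ, -, rfl⟩ := (h.fibre x y hx hy).1 hxy
  rw [γ.norm_map]

theorem descend_eq (h : EuclideanEnd g Γ R Ψ) {q : EuclideanSpace ℝ (Fin (2 * n)) → ℝ}
    (hq : ∀ γ ∈ Γ, ∀ y, q (γ y) = q y) {y} (hy : R < ‖y‖) : descend Ψ R q (Ψ y) = q y := by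
  have hex : ∃ y', R < ‖y'‖ ∧ Ψ y' = Ψ y := ⟨y, hy, rfl⟩
  rw [descend, dif_pos hex]
  obtain ⟨γ, hγ, e⟩ := (h.fibre _ _ hex.choose_spec.1 hy).1 hex.choose_spec.2
  conv_rhs => rw [← e, hq γ hγ]

theorem isOpen_exterior : IsOpen {y : EuclideanSpace ℝ (Fin (2 * n)) | R < ‖y‖} :=
  isOpen_lt continuous_const continuous_norm

theorem gradBoundAt_descend (h : EuclideanEnd g Γ R Ψ) {q : EuclideanSpace ℝ (Fin (2 * n)) → ℝ}
    (hq : ∀ γ ∈ Γ, ∀ y, q (γ y) = q y) {y} (hy : R < ‖y‖) (hd : DifferentiableAt ℝ q y) {C : ℝ}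
    (hC : ‖fderiv ℝ q y‖ ≤ C) : GradBoundAt g (descend Ψ R q) (C * √2) (Ψ y) := by
  refine GradBoundAt.of_comp (h.smooth y hy) (h.bijective y hy) (h.lower y hy) ?_ hd hC
  filter_upwards [isOpen_exterior.mem_nhds hy] with x hx
  exact h.descend_eq hq hx

theorem image_mem_nhds (h : EuclideanEnd g Γ R Ψ) {y} (hy : R < ‖y‖)
    {s : Set (EuclideanSpace ℝ (Fin (2 * n)))} (hs : s ∈ 𝓝 y) : Ψ '' s ∈ 𝓝 (Ψ y) := by
  obtain ⟨G, hG, hGy, hev⟩ := exists_local_section (h.smooth y hy) (h.bijective y hy)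
  have h1 : ∀ᶠ x in 𝓝 (Ψ y), G x ∈ s := by
    have := hG.continuousAt.tendsto
    rw [hGy] at this
    exact this hs
  filter_upwards [hev, h1] with x hx hx1
  exact ⟨G x, hx1, hx⟩

theorem isCompact_image_annulus (h : EuclideanEnd g Γ R Ψ) {a b : ℝ} (ha : R < a) :
    IsCompact (Ψ '' {y | a ≤ ‖y‖ ∧ ‖y‖ ≤ b}) := by
  have hc : IsCompact {y : EuclideanSpace ℝ (Fin (2 * n)) | a ≤ ‖y‖ ∧ ‖y‖ ≤ b} := by
    refine (isCompact_closedBall (0 : EuclideanSpace ℝ (Fin (2 * n))) b).of_isClosed_subset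
      ((isClosed_le continuous_const continuous_norm).inter
        (isClosed_le continuous_norm continuous_const)) fun y hy => ?_
    simpa using hy.2
  exact hc.image_of_continuousOn fun y hy =>
    (h.smooth y (ha.trans_le hy.1)).continuousAt.continuousWithinAt

end EuclideanEnd

end EuclideanEnd

/-! ### Level sets of `𝐳` far out in the end -/

namespace EuclideanEnd

variable {n k : ℕ} {g : TautMetric n k}
  {Γ : Subgroup (EuclideanSpace ℝ (Fin (2 * n)) ≃ₗᵢ[ℝ] EuclideanSpace ℝ (Fin (2 * n)))} {R : ℝ}
  {Ψ : EuclideanSpace ℝ (Fin (2 * n)) → TautPow n k}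

/-- Balls of a small fixed radius around points far out in the end stay in thin shells: a bump
function of `|y| - |y₀|` has a gradient bound that does not depend on `y₀`. -/
theorem exists_shell [NeZero n] (h : EuclideanEnd g Γ R Ψ) :
    ∃ δ : ℝ, 0 < δ ∧ ∀ y₀, R + 2 < ‖y₀‖ → ∀ x, riemDist g (Ψ y₀) x < ENNReal.ofReal δ →
      ∃ y, R < ‖y‖ ∧ Ψ y = x ∧ |‖y‖ - ‖y₀‖| ≤ 1 := by
  let b : ContDiffBump (0 : ℝ) := ⟨1 / 2, 1, by norm_num, by norm_num⟩
  obtain ⟨C, hC⟩ := b.contDiff.lipschitzWith_of_hasCompactSupport (n := 1) b.hasCompactSupport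
    one_ne_zero
  refine ⟨(C * √2 + 1)⁻¹, by positivity, fun y₀ hy₀ x hx => ?_⟩
  set q : EuclideanSpace ℝ (Fin (2 * n)) → ℝ := fun y => b (‖y‖ - ‖y₀‖) with hq
  have hq0 : ∀ y, 1 ≤ |‖y‖ - ‖y₀‖| → q y = 0 := fun y hy =>
    b.zero_of_le_dist (by simpa [Real.dist_eq, b] using hy)
  have hinv : ∀ γ ∈ Γ, ∀ y, q (γ y) = q y := fun γ _ y => by simp only [hq, γ.norm_map]
  have hlip : LipschitzWith C q := LipschitzWith.of_dist_le_mul fun x y => by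
    refine (hC.dist_le_mul _ _).trans (mul_le_mul_of_nonneg_left ?_ C.2)
    rw [Real.dist_eq, dist_eq_norm, sub_sub_sub_cancel_right]
    exact abs_norm_sub_norm_le x y
  have hR := h.pos
  have hgrad : ∀ p, GradBoundAt g (descend Ψ R q) (C * √2) p := by
    intro p
    have hA := h.isCompact_image_annulus (a := ‖y₀‖ - 1) (b := ‖y₀‖ + 1) (by linarith)
    by_cases hp : p ∈ Ψ '' {y | ‖y₀‖ - 1 ≤ ‖y‖ ∧ ‖y‖ ≤ ‖y₀‖ + 1}
    · obtain ⟨y, hy, rfl⟩ := hp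
      have hyR : R < ‖y‖ := by linarith [hy.1]
      have hy0 : y ≠ 0 := norm_pos_iff.1 (hR.trans hyR)
      refine h.gradBoundAt_descend hinv hyR ?_ (norm_fderiv_le_of_lipschitz ℝ hlip)
      exact (b.contDiff.differentiable (n := 1) (by simp)).differentiableAt.comp y
        (((contDiffAt_norm ℝ (n := 1) hy0).differentiableAt (by simp)).sub_const _)
    · refine GradBoundAt.of_eventuallyEq_const (by positivity) (c := 0) ?_
      filter_upwards [hA.isClosed.isOpen_compl.mem_nhds hp] with p' hp'
      by_cases hex : ∃ y, R < ‖y‖ ∧ Ψ y = p'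
      · obtain ⟨y, hy, rfl⟩ := hex
        rw [h.descend_eq hinv hy]
        refine hq0 y ?_
        by_contra hlt
        rw [not_le, abs_lt] at hlt
        exact hp' ⟨y, ⟨by linarith [hlt.1], by linarith [hlt.2]⟩, rfl⟩
      · exact descend_of_not q hex
  obtain ⟨γ, h0, h1, hγ, hl⟩ := exists_curve_of_riemDist_lt g hx
  have hmv := ofReal_abs_sub_le_lintegral (Q := descend Ψ R q) (by positivity) zero_le_one hγ
    fun t _ => hgrad (γ t)
  rw [h0, h1, h.descend_eq hinv (by linarith)] at hmv
  have hq1 : q y₀ = 1 := by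
    simp only [hq, sub_self]
    exact b.one_of_mem_closedBall (by simp [b.rIn_pos.le])
  have hlt : ENNReal.ofReal |descend Ψ R q x - q y₀| < ENNReal.ofReal 1 := by
    refine hmv.trans_lt ((mul_le_mul_right hl.le _).trans_lt ?_)
    rw [← ENNReal.ofReal_mul (by positivity), ENNReal.ofReal_lt_ofReal_iff one_pos,
      ← div_eq_mul_inv, div_lt_one (by positivity)]
    linarith
  rw [ENNReal.ofReal_lt_ofReal_iff one_pos, hq1] at hlt
  have hne : descend Ψ R q x ≠ 0 := fun h0 => by rw [h0] at hlt; norm_num at hlt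
  by_cases hex : ∃ y, R < ‖y‖ ∧ Ψ y = x
  · obtain ⟨y, hy, rfl⟩ := hex
    refine ⟨y, hy, rfl, ?_⟩
    by_contra hgt
    exact hne (by rw [h.descend_eq hinv hy, hq0 y (not_le.1 hgt).le])
  · exact absurd (descend_of_not q hex) hne

/-- Points far out in the end leave every compact set: otherwise the preimages of an accumulation
point would have arbitrarily large norm, but they form a single orbit. -/
theorem exists_notMem_of_isCompact [NeZero n] (h : EuclideanEnd g Γ R Ψ) {K : Set (TautPow n k)}
    (hK : IsCompact K) : ∃ N, ∀ y, N < ‖y‖ → Ψ y ∉ K := by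
  obtain ⟨δ, hδ, hsh⟩ := h.exists_shell
  refine hK.induction_on (p := fun s => ∃ N, ∀ y, N < ‖y‖ → Ψ y ∉ s) ⟨0, by simp⟩ ?_ ?_ ?_
  · rintro s t hst ⟨N, hN⟩
    exact ⟨N, fun y hy hs => hN y hy (hst hs)⟩
  · rintro s t ⟨N, hN⟩ ⟨N', hN'⟩
    refine ⟨max N N', fun y hy => ?_⟩
    rintro (hs | ht)
    · exact hN y ((le_max_left _ _).trans_lt hy) hs
    · exact hN' y ((le_max_right _ _).trans_lt hy) ht
  · intro x _
    have hU := eventually_riemDist_lt g x (ENNReal.ofReal_pos.2 hδ)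
    -- All points over `x` have the same norm.
    obtain ⟨c, hc⟩ : ∃ c, ∀ y, R < ‖y‖ → Ψ y = x → ‖y‖ = c := by
      by_cases hex : ∃ y, R < ‖y‖ ∧ Ψ y = x
      · obtain ⟨y, hy, rfl⟩ := hex
        exact ⟨‖y‖, fun y' hy' e => h.norm_eq hy' hy e⟩
      · exact ⟨0, fun y hy e => absurd ⟨y, hy, e⟩ hex⟩
    refine ⟨_, mem_nhdsWithin_of_mem_nhds hU, max (R + 2) (c + 1), fun y hy hyx => ?_⟩
    have hyx' : riemDist g (Ψ y) x < ENNReal.ofReal δ := by rw [riemDist_comm]; exact hyx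
    obtain ⟨y', hy', e, hd⟩ := hsh y ((le_max_left _ _).trans_lt hy) x hyx'
    rw [hc y' hy' e] at hd
    have := (abs_le.1 hd).1
    linarith [(le_max_right _ _).trans_lt hy]

variable [NeZero n]

/-- The points where `𝐳` is large lie in the end: they form a connected set that meets the end but
not its boundary. -/
theorem exists_fibreSq_bound (h : EuclideanEnd g Γ R Ψ) (hk : k ≠ 0) {R' : ℝ} (hR' : R < R') :
    ∃ M, 0 ≤ M ∧ (∀ y, ‖y‖ = R' → fibreSq (Ψ y) ≤ M) ∧
      ∀ x, M < fibreSq x → ∃ y, R' < ‖y‖ ∧ Ψ y = x := by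
  have hA := h.isCompact_image_annulus (b := R') hR'
  obtain ⟨M₀, hM₀⟩ := (hA.image continuous_fibreSq).bddAbove
  have hbd : ∀ y, ‖y‖ = R' → fibreSq (Ψ y) ≤ max M₀ 0 := fun y hy =>
    (hM₀ ⟨Ψ y, ⟨y, ⟨hy.ge, hy.le⟩, rfl⟩, rfl⟩).trans (le_max_left _ _)
  refine ⟨max M₀ 0, le_max_right _ _, hbd, ?_⟩
  have hO : IsOpen (Ψ '' {y | R' < ‖y‖}) := by
    refine isOpen_iff_mem_nhds.2 ?_
    rintro _ ⟨y, hy, rfl⟩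
    exact h.image_mem_nhds (hR'.trans hy) (isOpen_exterior.mem_nhds hy)
  have hsub : {x : TautPow n k | max M₀ 0 < fibreSq x} ⊆ Ψ '' {y | R' < ‖y‖} := by
    refine (isPreconnected_lt_fibreSq hk (le_max_right _ _)).subset_of_closure_inter_subset hO ?_ ?_
    · obtain ⟨N, hN⟩ := h.exists_notMem_of_isCompact (isCompact_fibreSq_le (k := k) (max M₀ 0))
      obtain ⟨y, hy⟩ := NormedSpace.exists_lt_norm ℝ (EuclideanSpace ℝ (Fin (2 * n))) (max N R')
      have hy1 : max M₀ 0 < fibreSq (Ψ y) :=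
        not_le.1 fun hle => hN y ((le_max_left _ _).trans_lt hy) hle
      exact ⟨Ψ y, hy1, y, (le_max_right _ _).trans_lt hy, rfl⟩
    · rintro x ⟨hx, hxM⟩
      obtain ⟨N, hN⟩ := h.exists_notMem_of_isCompact
        (isCompact_fibreSq_le (k := k) (fibreSq x + 1))
      have hU : {p : TautPow n k | fibreSq p < fibreSq x + 1} ∈ 𝓝 x :=
        (isOpen_lt continuous_fibreSq continuous_const).mem_nhds (lt_add_one (fibreSq x))
      have hB := h.isCompact_image_annulus (b := N) hR'
      have hxB : x ∈ Ψ '' {y | R' ≤ ‖y‖ ∧ ‖y‖ ≤ N} := by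
        refine closure_minimal ?_ hB.isClosed (mem_closure_iff_nhds.2 fun t ht => ?_)
          (s := Ψ '' {y | R' < ‖y‖} ∩ {p | fibreSq p < fibreSq x + 1})
        · rintro _ ⟨⟨y, hy, rfl⟩, hlt⟩
          refine ⟨y, ⟨le_of_lt hy, not_lt.1 fun hyN => ?_⟩, rfl⟩
          have hle : fibreSq (Ψ y) ≤ fibreSq x + 1 := le_of_lt hlt
          exact hN y hyN hle
        · obtain ⟨p, ⟨hp1, hp2⟩, hp3⟩ := mem_closure_iff_nhds.1 hx _ (inter_mem ht hU)
          exact ⟨p, hp1, hp3, hp2⟩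
      obtain ⟨y, hy, rfl⟩ := hxB
      refine ⟨y, lt_of_le_of_ne hy.1 fun e => ?_, rfl⟩
      exact absurd (hbd y e.symm) (not_le.2 hxM)
  exact fun x hx => hsub hx

end EuclideanEnd

/-! ### Decay of the conformal factor -/

/-- A finite linear isometry group has an invariant function that is homogeneous of degree one, has
bounded gradient, and is not constant on the unit sphere. The function below vanishes precisely on the
cone over the orbit of `e₁`. -/
theorem exists_invariant_homogeneous {E : Type*} [NormedAddCommGroup E] [InnerProductSpace ℝ E]
    [FiniteDimensional ℝ E] (hE : 1 < Module.rank ℝ E) (Γ : Subgroup (E ≃ₗᵢ[ℝ] E)) [Finite Γ] :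
    ∃ (f : E → ℝ) (C : ℝ) (e₁ e₂ : E), (∀ γ ∈ Γ, ∀ y, f (γ y) = f y) ∧
      (∀ t : ℝ, 0 < t → ∀ y, f (t • y) = t * f y) ∧
      (∀ y, y ≠ 0 → DifferentiableAt ℝ f y ∧ ‖fderiv ℝ f y‖ ≤ C) ∧
      ‖e₁‖ = 1 ∧ ‖e₂‖ = 1 ∧ f e₁ = 0 ∧ 0 < f e₂ := by
  have := Fintype.ofFinite Γ
  have : Nontrivial E := rank_pos_iff_nontrivial.1 (zero_lt_one.trans hE)
  obtain ⟨e₁, he₁⟩ := exists_norm_eq E zero_le_one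
  obtain ⟨e₂, he₂, hne⟩ : ∃ e₂ : E, ‖e₂‖ = 1 ∧ ∀ γ : Γ, γ.1 e₁ ≠ e₂ := by
    have hinf : (Metric.sphere (0 : E) 1).Infinite := by
      refine (isPreconnected_sphere hE 0 1).infinite_of_nontrivial
        ⟨e₁, by simpa using he₁, -e₁, by simpa using he₁, fun h => ?_⟩
      have h0 : e₁ = 0 := by
        have h2 : (2 : ℝ) • e₁ = 0 := by
          rw [two_smul]
          nth_rewrite 2 [h]
          exact add_neg_cancel e₁
        simpa using h2
      simp [h0] at he₁
    obtain ⟨e₂, h1, h2⟩ := (hinf.sdiff (finite_range fun γ : Γ => γ.1 e₁)).nonempty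
    exact ⟨e₂, by simpa using h1, fun γ h => h2 ⟨γ, h⟩⟩
  set f : E → ℝ := fun y => ‖y‖ * ∏ γ : Γ, (1 - inner ℝ y (γ.1 e₁) / ‖y‖) with hf
  have hhom : ∀ t : ℝ, 0 < t → ∀ y, f (t • y) = t * f y := by
    intro t ht y
    simp only [hf, norm_smul, Real.norm_eq_abs, abs_of_pos ht, inner_smul_left,
      RCLike.conj_to_real, mul_div_mul_left _ _ ht.ne']
    ring
  have hcd : ∀ y, y ≠ 0 → ContDiffAt ℝ 1 f y := by
    intro y hy
    have hn := contDiffAt_norm ℝ (n := 1) hy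
    refine hn.mul (contDiffAt_prod fun γ _ => contDiffAt_const.sub ?_)
    simp only [div_eq_mul_inv]
    exact (contDiffAt_id.inner ℝ contDiffAt_const).mul (hn.inv (norm_ne_zero_iff.2 hy))
  have hscale : ∀ t : ℝ, 0 < t → ∀ y, fderiv ℝ f (t • y) = fderiv ℝ f y := by
    intro t ht y
    have h1 := fderiv_comp_smul (f := f) (x := y) t
    have h2 : (fun x => f (t • x)) = t • f := funext fun x => hhom t ht x
    rw [h2, fderiv_const_smul_field] at h1
    exact (smul_right_injective _ ht.ne' h1).symm
  obtain ⟨C, hC⟩ := (isCompact_sphere (0 : E) 1).exists_bound_of_continuousOn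
    (f := fderiv ℝ f) fun y hy =>
      ((hcd y (Metric.ne_of_mem_sphere hy one_ne_zero)).fderiv_right (m := 0)
        (by norm_num)).continuousAt.continuousWithinAt
  refine ⟨f, C, e₁, e₂, fun γ hγ y => ?_, hhom,
    fun y hy => ⟨(hcd y hy).differentiableAt (by simp), ?_⟩, he₁, he₂, ?_, ?_⟩
  · simp only [hf, γ.norm_map]
    congr 1
    refine Fintype.prod_equiv (Equiv.mulLeft (⟨γ, hγ⟩⁻¹ : Γ)) _ _ fun δ => ?_
    congr 2
    have h1 : γ ((γ⁻¹ * δ.1) e₁) = δ.1 e₁ := by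
      change (γ * (γ⁻¹ * δ.1)) e₁ = _
      rw [mul_inv_cancel_left]
    rw [← h1]
    exact γ.inner_map_map y ((γ⁻¹ * δ.1) e₁)
  · have hy0 := norm_pos_iff.2 hy
    rw [← hscale _ (inv_pos.2 hy0)]
    exact hC _ (by simp [norm_smul, hy0.ne'])
  · simp only [hf]
    rw [Finset.prod_eq_zero (Finset.mem_univ (1 : Γ)), mul_zero]
    simp [he₁]
  · simp only [hf, he₂, one_mul, div_one]
    refine Finset.prod_pos fun γ _ => sub_pos.2 (lt_of_le_of_ne ?_ ?_)
    · refine (real_inner_le_norm _ _).trans ?_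
      rw [γ.1.norm_map, he₁, he₂, one_mul]
    · intro h
      exact hne γ ((inner_eq_one_iff_of_norm_eq_one he₂ (by rw [γ.1.norm_map, he₁])).1 h).symm

namespace EuclideanEnd

variable {n k : ℕ} {g : TautMetric n k}
  {Γ : Subgroup (EuclideanSpace ℝ (Fin (2 * n)) ≃ₗᵢ[ℝ] EuclideanSpace ℝ (Fin (2 * n)))} {R : ℝ}
  {Ψ : EuclideanSpace ℝ (Fin (2 * n)) → TautPow n k}

theorem riemDist_ray_le (h : EuclideanEnd g Γ R Ψ) {e : EuclideanSpace ℝ (Fin (2 * n))}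
    (he : ‖e‖ = 1) {a b : ℝ} (ha : R < a) (hab : a ≤ b) :
    riemDist g (Ψ (a • e)) (Ψ (b • e)) ≤ ENNReal.ofReal (√2 * (b - a)) := by
  have hray : ∀ t ∈ Icc a b, R < ‖t • e‖ := fun t ht => by
    rw [norm_smul, he, mul_one]
    exact (ha.trans_le ht.1).trans_le (le_abs_self t)
  have hc : ContDiff ℝ ∞ fun t : ℝ => t • e := contDiff_id.smul contDiff_const
  have hsm : ∀ t ∈ Icc a b, ContMDiffAt 𝓘(ℝ, ℝ) 𝓘(ℝ, Fin n → ℂ) ∞ (fun t : ℝ => Ψ (t • e)) t :=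
    fun t ht => (h.smooth _ (hray t ht)).comp t hc.contMDiff.contMDiffAt
  refine riemDist_le_of_curveSpeed_le g (γ := fun t : ℝ => Ψ (t • e)) hab
    (fun t ht => ((hsm t ht).of_le (by norm_cast)).contMDiffWithinAt) (Real.sqrt_nonneg 2)
    fun t ht => ?_
  refine Real.sqrt_le_sqrt ?_
  have hvel : velocity (fun t : ℝ => Ψ (t • e)) t
      = mfderiv 𝓘(ℝ, EuclideanSpace ℝ (Fin (2 * n))) 𝓘(ℝ, Fin n → ℂ) Ψ (t • e) e := by
    have h1 := mfderiv_comp t ((h.smooth _ (hray t ht)).mdifferentiableAt (by simp))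
      (hc.contMDiff.contMDiffAt.mdifferentiableAt (x := t) (by simp))
    rw [mfderiv_eq_fderiv] at h1
    have h2 : fderiv ℝ (fun t : ℝ => t • e) t 1 = e := by
      have := ((hasDerivAt_id t).smul_const e).hasFDerivAt.fderiv
      simp only [id] at this
      rw [this]; simp
    refine (DFunLike.congr_fun h1 (1 : ℝ)).trans ?_
    change mfderiv 𝓘(ℝ, EuclideanSpace ℝ (Fin (2 * n))) 𝓘(ℝ, Fin n → ℂ) Ψ (t • e)
      (fderiv ℝ (fun t : ℝ => t • e) t 1) = _
    rw [h2]
  rw [hvel]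
  have := h.upper _ (hray t ht) e
  rw [he, one_pow, mul_one] at this
  exact this

variable [NeZero n]

/-- A level set of `𝐳` in the end meets every ray. -/
theorem exists_ray_mem_level (h : EuclideanEnd g Γ R Ψ) {R' σ : ℝ} (hR' : R < R')
    (hbd : ∀ y, ‖y‖ = R' → fibreSq (Ψ y) ≤ σ) {e : EuclideanSpace ℝ (Fin (2 * n))}
    (he : ‖e‖ = 1) : ∃ t, R' ≤ t ∧ fibreSq (Ψ (t • e)) = σ := by
  have hR0 := h.pos.trans hR'
  obtain ⟨N, hN⟩ := h.exists_notMem_of_isCompact (isCompact_fibreSq_le (k := k) σ)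
  have hnorm : ∀ t, R' ≤ t → ‖t • e‖ = t := fun t ht => by
    rw [norm_smul, he, mul_one, Real.norm_eq_abs, abs_of_pos (hR0.trans_le ht)]
  set T := max N R' + 1 with hT
  have hRT : R' ≤ T := by linarith [le_max_right N R']
  have hcont : ContinuousOn (fun t : ℝ => fibreSq (Ψ (t • e))) (Icc R' T) := fun t ht => by
    have h1 : ContinuousAt Ψ (t • e) :=
      (h.smooth _ (by rw [hnorm t ht.1]; linarith [ht.1])).continuousAt
    exact (continuous_fibreSq.continuousAt.comp
      (h1.comp (f := fun t : ℝ => t • e) (by fun_prop))).continuousWithinAt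
  have hT' : σ ≤ fibreSq (Ψ (T • e)) := by
    refine le_of_lt (not_le.1 fun hle => hN (T • e) ?_ hle)
    rw [hnorm T hRT]
    linarith [le_max_left N R']
  obtain ⟨t, ht, e'⟩ := intermediate_value_Icc hRT hcont ⟨hbd _ (hnorm R' le_rfl), hT'⟩
  exact ⟨t, ht.1, e'⟩

end EuclideanEnd

/-- The variation of a function along a horizontal great circle. -/
theorem ArcJoined.abs_sub_le {n k : ℕ} [NeZero n] {g : TautMetric n k} {φ : ℝ → ℝ}
    (hg : ArisesFrom g φ) {s : ℝ} (hs : 0 < s) {Q : TautPow n k → ℝ} {C : ℝ} (hC : 0 ≤ C)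
    (hQ : ∀ x, fibreSq x = s ^ k → GradBoundAt g Q C x) {x y : TautPow n k}
    (h : ArcJoined s x y) : |Q y - Q x| ≤ C * (√(2 * (s * deriv φ s)) * Real.pi) := by
  obtain ⟨a, b, θ, ha, hb, hab, hθ, rfl, rfl⟩ := h
  have hc := contMDiff_tensorPow_greatCircle (k := k) hs ha hb hab
  have h1 := ofReal_abs_sub_le_lintegral (g := g) (Q := Q) hC hθ.1 (hc.of_le (by norm_cast))
    fun t _ => hQ _ (by
      rw [fibreSq_tensorPow (greatCircle_ne_zero hs ha hb hab t), radSq_greatCircle ha hb hab])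
  simp only [curveSpeed_greatCircle hg hs ha hb hab] at h1
  rw [MeasureTheory.setLIntegral_const, Real.volume_Icc, ← ENNReal.ofReal_mul (by positivity),
    ← ENNReal.ofReal_mul hC, sub_zero] at h1
  have hθ0 := hθ.1
  refine ((ENNReal.ofReal_le_ofReal_iff (by positivity)).1 h1).trans ?_
  have := hθ.2
  gcongr

/-- In the end, the distance to a base point is bounded by a multiple of the square root of `𝐳 φ'(𝐳)`:
the level sets of `𝐳` have diameter at most `C √(𝐳 φ')`, but they wrap around the end. -/
theorem EuclideanEnd.exists_riemDist_le_sqrt_moment {n k : ℕ} [NeZero n] (hk : k ≠ 0) (hn : 2 ≤ n)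
    {g : TautMetric n k} {φ : ℝ → ℝ} (hg : ArisesFrom g φ)
    {Γ : Subgroup (EuclideanSpace ℝ (Fin (2 * n)) ≃ₗᵢ[ℝ] EuclideanSpace ℝ (Fin (2 * n)))} {R : ℝ}
    {Ψ : EuclideanSpace ℝ (Fin (2 * n)) → TautPow n k} (h : EuclideanEnd g Γ R Ψ)
    (x₀ : TautPow n k) : ∃ M C : ℝ, 0 ≤ C ∧ ∀ x, M < fibreSq x →
      riemDist g x₀ x ≤ ENNReal.ofReal (C * √(moment k φ x)) := by
  have := h.finite
  have hrank : 1 < Module.rank ℝ (EuclideanSpace ℝ (Fin (2 * n))) := by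
    rw [← Module.finrank_eq_rank, finrank_euclideanSpace_fin]
    exact_mod_cast (by omega : 1 < 2 * n)
  obtain ⟨f, C, e₁, e₂, hinv, hhom, hdf, he₁, he₂, hf₁, hf₂⟩ :=
    exists_invariant_homogeneous hrank Γ
  have hC : 0 ≤ C := (norm_nonneg _).trans (hdf e₁ (norm_pos_iff.1 (he₁ ▸ one_pos))).2
  set R' := R + 1 with hR'
  have hRR' : R < R' := lt_add_one R
  have hR0 : 0 < R' := h.pos.trans hRR'
  obtain ⟨M, hM0, hMb, hM⟩ := h.exists_fibreSq_bound hk hRR'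
  set D := (riemDist g x₀ (Ψ (R' • e₂))).toReal with hD
  have hD0 : 0 ≤ D := ENNReal.toReal_nonneg
  have hDle : riemDist g x₀ (Ψ (R' • e₂)) = ENNReal.ofReal D :=
    (ENNReal.ofReal_toReal (riemDist_lt_top g x₀ _).ne).symm
  set B := 3 * (C * √2 * (√2 * Real.pi)) / f e₂ with hB
  have hB0 : 0 ≤ B := by positivity
  refine ⟨M, D * (B / R') + √2 * B + 3 * (√2 * Real.pi), by positivity, fun x hx => ?_⟩
  obtain ⟨z, hz, rfl⟩ := exists_tensorPow_eq hk (hM0.trans_lt hx).ne'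
  rw [moment_eq hk (radSq_pos.2 hz) (fibreSq_tensorPow hz)]
  set s := radSq z with hs'
  have hs : 0 < s := radSq_pos.2 hz
  have hσ := fibreSq_tensorPow (k := k) hz
  rw [← hs'] at hσ
  rw [hσ] at hx
  set p := s * deriv φ s with hp
  have hp0 : 0 < p := mul_pos hs (deriv_pot_pos hg hk hn hs)
  have hsq : √(2 * p) = √2 * √p := Real.sqrt_mul (by norm_num) p
  have hQ : ∀ y, fibreSq y = s ^ k → GradBoundAt g (descend Ψ R f) (C * √2) y := by
    intro y hy
    obtain ⟨y', hy', rfl⟩ := hM y (by rw [hy]; exact hx)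
    have hy0 : y' ≠ 0 := norm_pos_iff.1 (hR0.trans hy')
    exact h.gradBoundAt_descend hinv (hRR'.trans hy') (hdf y' hy0).1 (hdf y' hy0).2
  have hMb' : ∀ y, ‖y‖ = R' → fibreSq (Ψ y) ≤ s ^ k := fun y hy => (hMb y hy).trans hx.le
  obtain ⟨t₁, ht₁, hl₁⟩ := h.exists_ray_mem_level hRR' hMb' he₁
  obtain ⟨t₂, ht₂, hl₂⟩ := h.exists_ray_mem_level hRR' hMb' he₂
  have hval : ∀ {t : ℝ} {e : EuclideanSpace ℝ (Fin (2 * n))}, R' ≤ t → ‖e‖ = 1 →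
      descend Ψ R f (Ψ (t • e)) = t * f e := by
    intro t e ht he
    rw [h.descend_eq hinv, hhom t (hR0.trans_le ht)]
    rw [norm_smul, he, mul_one, Real.norm_eq_abs]
    exact (hRR'.trans_le ht).trans_le (le_abs_self t)
  -- The level set contains points on the rays through `e₁`, where `f` vanishes, and `e₂`.
  have ht₂B : t₂ ≤ B * √p := by
    obtain ⟨y₁, y₂, a₁, a₂, a₃⟩ := exists_arcJoined hn hk hs hl₁ hl₂
    have b₁ := (abs_le.1 (a₁.abs_sub_le hg hs (by positivity) hQ)).2
    have b₂ := (abs_le.1 (a₂.abs_sub_le hg hs (by positivity) hQ)).2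
    have b₃ := (abs_le.1 (a₃.abs_sub_le hg hs (by positivity) hQ)).2
    rw [hval ht₁ he₁, hf₁, mul_zero, ← hp, hsq] at b₁
    rw [← hp, hsq] at b₂
    rw [hval ht₂ he₂, ← hp, hsq] at b₃
    rw [hB, div_mul_eq_mul_div, le_div_iff₀ hf₂]
    linarith
  -- The base point is joined to `z` along the ray through `e₂` and then inside the level set.
  obtain ⟨y₁, y₂, a₁, a₂, a₃⟩ := exists_arcJoined hn hk hs hl₂ hσ
  have d₁ := a₁.riemDist_le hg hs
  have d₂ := a₂.riemDist_le hg hs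
  have d₃ := a₃.riemDist_le hg hs
  rw [← hp, hsq] at d₁ d₂ d₃
  have dr := h.riemDist_ray_le he₂ hRR' ht₂
  have hE : 0 ≤ √2 * √p * Real.pi := by positivity
  have htot : riemDist g x₀ (tensorPow n k z) ≤ ENNReal.ofReal (D + √2 * (t₂ - R')
      + √2 * √p * Real.pi + √2 * √p * Real.pi + √2 * √p * Real.pi) := by
    have hr : 0 ≤ √2 * (t₂ - R') := mul_nonneg (Real.sqrt_nonneg 2) (sub_nonneg.2 ht₂)
    rw [ENNReal.ofReal_add (by positivity) hE, ENNReal.ofReal_add (by positivity) hE,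
      ENNReal.ofReal_add (by positivity) hE, ENNReal.ofReal_add hD0 hr, ← hDle]
    refine (riemDist_triangle g _ y₂ _).trans (add_le_add ?_ d₃)
    refine (riemDist_triangle g _ y₁ _).trans (add_le_add ?_ d₂)
    refine (riemDist_triangle g _ (Ψ (t₂ • e₂)) _).trans (add_le_add ?_ d₁)
    exact (riemDist_triangle g _ (Ψ (R' • e₂)) _).trans (add_le_add le_rfl dr)
  refine htot.trans (ENNReal.ofReal_le_ofReal ?_)
  have h1 : 1 ≤ B / R' * √p := by
    rw [div_mul_eq_mul_div, one_le_div hR0]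
    exact ht₂.trans ht₂B
  have h2 : D ≤ D * (B / R' * √p) := le_mul_of_one_le_right hD0 h1
  have h3 : √2 * (t₂ - R') ≤ √2 * (B * √p) :=
    mul_le_mul_of_nonneg_left (by linarith) (Real.sqrt_nonneg 2)
  linarith

/-- The function `(𝐳 φ'(𝐳))⁻¹` is `O(r⁻²)`. -/
theorem moment_inv_decay {n k : ℕ} [NeZero n] (hn : 2 ≤ n) (hk : k ≠ 0) {g : TautMetric n k}
    {φ : ℝ → ℝ} (hg : ArisesFrom g φ) {τ : ℝ} (hτ : 0 < τ) (hA : IsALE g τ) (x₀ : TautPow n k) :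
    ∃ C r₀ : ℝ, ∀ x : TautPow n k, ENNReal.ofReal r₀ ≤ riemDist g x₀ x →
      ENNReal.ofReal (moment k φ x)⁻¹ * riemDist g x₀ x ^ 2 ≤ ENNReal.ofReal C := by
  obtain ⟨Γ, R, Ψ, h⟩ := hA.exists_euclideanEnd hτ
  obtain ⟨M, C, hC, hM⟩ := h.exists_riemDist_le_sqrt_moment hk hn hg x₀
  obtain ⟨D, hD⟩ := exists_riemDist_le_of_isCompact g x₀ (isCompact_fibreSq_le (k := k) M)
  refine ⟨C ^ 2, |D| + 1, fun x hx => ?_⟩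
  have hxM : M < fibreSq x := by
    refine not_le.1 fun hle => ?_
    have h1 := (ENNReal.ofReal_le_ofReal_iff' ).1 (hx.trans (hD x hle))
    rcases h1 with h1 | h1
    · linarith [le_abs_self D]
    · linarith [abs_nonneg D]
  have hp := moment_pos hg hk hn x
  calc ENNReal.ofReal (moment k φ x)⁻¹ * riemDist g x₀ x ^ 2
      ≤ ENNReal.ofReal (moment k φ x)⁻¹ * ENNReal.ofReal (C * √(moment k φ x)) ^ 2 := by
        gcongr
        exact hM x hxM
    _ = ENNReal.ofReal (C ^ 2) := by
        rw [← ENNReal.ofReal_pow (by positivity), ← ENNReal.ofReal_mul (by positivity), mul_pow,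
          Real.sq_sqrt hp.le]
        congr 1
        field_simp

/-! ### The Kähler conformal compactification -/

section Main

variable {n k : ℕ} [NeZero n] {g : TautMetric n k} {φ : ℝ → ℝ}

omit [NeZero n] in
theorem radInvDiff_self {ξ : Fin n → ℂ} (hξ : ξ ≠ 0) : radInvDiff ξ ξ = -(radInv ξ) := by
  have h0 := (radSq_pos.2 hξ).ne'
  rw [radInvDiff, rin_self, radInv_eq, mul_assoc, inv_mul_cancel₀ h0, ← smul_neg]
  congr 1
  module

omit [NeZero n] in
theorem radInvDiff_I_self (ξ : Fin n → ℂ) :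
    radInvDiff ξ (Complex.I • ξ) = Complex.I • radInv ξ := by
  rw [radInvDiff, rin_self_I, radInv_eq, mul_zero, zero_smul, sub_zero, smul_comm]

/-- If the complex structures agreed, then the squared length of the image of `i ξ` under the
differential of `xiMap` would be equal to its negative, as the inversion reverses the orientation of
the complex lines through the origin. -/
theorem hatJ_ne_stdJ (hg : ArisesFrom g φ) (hk : k ≠ 0) : hatJ n k ≠ stdJ n k := by
  intro h
  have hξ : (fun _ => 1 : Fin n → ℂ) ≠ 0 := fun h0 => one_ne_zero (congrFun h0 (0 : Fin n))
  set ξ : Fin n → ℂ := fun _ => 1 with hξ'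
  have hIξ : Complex.I • ξ ≠ 0 := smul_ne_zero Complex.I_ne_zero hξ
  have hz := radInv_ne_zero hξ
  have h1 := pullForm_xiMap (k := k) (fundamentalForm g (stdJ n k)) hξ ξ (Complex.I • ξ)
  rw [hg.2 _ hz, ddbar_pot hg.1 hz, pullForm, fundamentalForm, ← h, ← tautDiff_xiMap_I hξ,
    radInvDiff_self hξ, radInvDiff_I_self] at h1
  have h2 := pullForm_xiMap (k := k) (fun x v w => g.inner x v w) hξ (Complex.I • ξ)
    (Complex.I • ξ)
  rw [metric_tensorPow hg hz, pullForm, radInvDiff_I_self, I_smul_I_smul, neg_neg] at h2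
  have h3 : ∀ (p q : ℝ) (z w : Fin n → ℂ), radForm p q z (-z) w = -radForm p q z z w := by
    intro p q z w
    simp only [radForm, smul_neg, map_neg, neg_apply]
    ring
  rw [h3] at h1
  have h4 : tautDiff (xiMap n k) ξ (Complex.I • ξ) ≠ 0 := by
    let L : (Fin n → ℂ) →ₗ[ℝ] (Fin n → ℂ) :=
      (mfderiv 𝓘(ℝ, Fin n → ℂ) 𝓘(ℝ, Fin n → ℂ) (xiMap n k) ξ).toLinearMap
    have hL : Function.Injective L :=
      LinearMap.injective_iff_surjective.2 (surjective_tautDiff_xiMap hk hξ)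
    exact fun h0 => hIξ ((map_eq_zero_iff L hL).1 h0)
  have h5 := g.pos (xiMap n k ξ) _ h4
  linarith

end Main
end

theorem corollary1p2 (n k : ℕ) [NeZero n] (hn : 2 ≤ n) (hk : 1 ≤ k)
    (g : TautMetric n k) (φ : ℝ → ℝ) (hg : IsInvariantKahlerALE g φ) :
    ∃ (u : TautPow n k → ℝ) (ghat : TautMetric n k) (Jhat : TautEndo n k),
      IsKahlerCompactification g u ghat Jhat ∧
      (∀ z : Fin n → ℂ, z ≠ 0 →
        u (tensorPow n k z) ^ 2 = ((radSq z * deriv φ (radSq z)) ^ 2)⁻¹) ∧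
      (∃ φhat : ℝ → ℝ, IsHatPotential φ φhat) ∧
      ∀ φhat : ℝ → ℝ, IsHatPotential φ φhat →
        (∀ ξ : Fin n → ℂ, ξ ≠ 0 → ∀ v w : Fin n → ℂ,
          pullForm (fundamentalForm ghat Jhat) (xiMap n k) ξ v w
            = ddbar (fun η => φhat (radSq η)⁻¹) ξ v w) ∧
        (∀ (j : Fin n) (z : Fin n → ℂ), z ≠ 0 → (∀ i, i ≠ j → z i = 0) → ∀ v w : Fin n → ℂ,
          ddbar (fun η => φhat (radSq η)⁻¹) (conjInv j z)
              (fderiv ℝ (conjInv j) z v) (fderiv ℝ (conjInv j) z w)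
            = ((radSq z * deriv φ (radSq z)) ^ 2)⁻¹
              * ddbar (fun y => φ (radSq y)) z v w) := by
  have hk0 : k ≠ 0 := by omega
  obtain ⟨τ, hτ, hA⟩ := hg.ale
  have ha := hg.potential
  have hφ := ha.1
  have hd : ∀ {t : ℝ}, 0 < t → deriv φ t ≠ 0 := fun ht => (deriv_pot_pos ha hk0 hn ht).ne'
  have hsm : ContMDiff 𝓘(ℝ, Fin n → ℂ) 𝓘(ℝ, ℝ) ∞ (fun x : TautPow n k => (moment k φ x)⁻¹) :=
    (contMDiff_moment ha hk0 hn).inv₀ fun x => (moment_pos ha hk0 hn x).ne'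
  have hpos : ∀ x : TautPow n k, 0 < (moment k φ x)⁻¹ := fun x =>
    inv_pos.2 (moment_pos ha hk0 hn x)
  have hc : ∀ (x : TautPow n k) (v w : TautTangent x), (conformalMetric g _ hsm hpos).inner x v w
      = ((moment k φ x)⁻¹) ^ 2 * g.inner x v w := fun _ _ _ => rfl
  refine ⟨fun x => (moment k φ x)⁻¹, conformalMetric g _ hsm hpos, hatJ n k,
    ⟨⟨hsm, hpos, moment_inv_decay hn hk0 ha hτ hA⟩, hc, isKahler_hat ha hk0 hn hc,
      hatJ_ne_stdJ ha hk0, continuous_xiChart hk0, isOpenMap_xiChart hk0, xiChart_fibre hk0,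
      fun ξ hξ v => tautDiff_xiMap_I hξ v⟩, fun z hz => ?_,
    exists_isHatPotential (hφ.continuousOn_deriv_of_isOpen isOpen_Ioi (by simp)) fun t ht => hd ht,
    fun φhat hh => ⟨fun ξ hξ v w => ?_, fun j z hz hj v w => ?_⟩⟩
  · have := moment_eq (φ := φ) hk0 (radSq_pos.2 hz) (fibreSq_tensorPow (k := k) hz)
    simp only [this, inv_pow]
  · rw [hatForm_xiMap ha hk0 hn hc hξ, ddbar_hat hφ hh hξ (hd (inv_pos.2 (radSq_pos.2 hξ)))]
  · have hs := radSq_pos.2 hz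
    have hci : conjInv j z ≠ 0 := radSq_pos.1 (by rw [radSq_conjInv]; exact inv_pos.2 hs)
    rw [ddbar_hat hφ hh hci (by rw [radSq_conjInv, inv_inv]; exact hd hs), radSq_conjInv, inv_inv,
      radForm_conjInv (hd hs) hz hj, ddbar_pot hφ hz]
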